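/- Conventions. A polygon is a closed set $P\subset\mathbb R^2$ that is the region enclosed by a simple closed polygonal line (the line included). A vertex of $P$ is concave if its interior angle is larger than $\pi$; $\mathcal V'_P$ denotes the set of concave vertices. For $p,q\in P$ let $d_P(p,q)$ be the infimum (in fact minimum) of the lengths of Lipschitz curves in $P$ connecting $p$ and $q$, and let $d(P)=\sup_{p,q\in P}d_P(p,q)$ be the intrinsic diameter. A segment $[p;q]\subset P$ with $p,q\in\partial P$ induces a partition $P=Q_1\cup Q_2$ if $Q_1,Q_2$ are polygons with $P=Q_1\cup Q_2$ and $[p;q]=Q_1\cap Q_2$. For $0<\vartheta<1$ a polygon $P$ is called $\vartheta$-semiconvex if for every segment $[v;w]$ with $v\in\mathcal V'_P$ and $w\in\partial P$ and every partition $P=Q_1\cup Q_2$ induced by it, $$|[v;w]|\ \ge\ \vartheta\min\{d(Q_1),d(Q_2)\}.$$ For $A\subset\mathbb R^2$ and a unit vector $e$ let $|A|_e=\sup_{x,y\in A}|(x-y)\cdot e|$ be the width of $A$ in direction $e$, let $w_{\max}(A)=\sup_{|e|=1}|A|_e$ and $w_{\min}(A)=\inf_{|e|=1}|A|_e$ (both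 are $0$ for $A=\emptyset$). Theorem. Let $0<\vartheta<1$. There is a constant $C=C(\vartheta)>0$ such that for every $\vartheta$-semiconvex polygon $P$ there are two segments $S_1,S_2$ inducing a partition $P=P_1\cup P'\cup P_2$ with $P_i\cap P'=S_i$ for $i=1,2$, where $P'$ is a convex polygon, such that for $i=1,2$ (i) $\mathcal H^1(S_i)\le\vartheta\,\mathcal H^1(\partial P)$, (ii) $w_{\max}(P_i)\le C\,w_{\min}(P_i)$, (iii) $w_{\max}(P_i)\le C\operatorname{dist}(v,S_i)$ for every concave vertex $v\in\mathcal V'_{P_i}$. Here "$S_1,S_2$ induce the partition $P=P_1\cup P'\cup P_2$" means that for $\{i,j\}=\{1,2\}$ the segment $S_i$ induces the partition of $P$ into the polygons $P_i$ and $P'\cup P_j$, where for each $i$ the degenerate choice $P_i=S_i=\emptyset$ is allowed as well. Moreover, the trivial choice $P_1=P$, $P'=P_2=\emptyset$, $S_1=S_2=\emptyset$ is also admissible. By convention $\operatorname{dist}(v,\emptyset)=+\infty$. -/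

import Mathlib

open Set MeasureTheory
open scoped ENNReal

noncomputable section

/-- The Euclidean plane. -/
abbrev Plane : Type := EuclideanSpace ℝ (Fin 2)

/-- A closed polygonal line with vertices `γ 0, …, γ (n - 1)` is simple if it has at least three
vertices and its cyclic parametrization by the half-open edges `[γ i, γ (i + 1))` is injective. -/
def IsSimplePolygonalLine {n : ℕ} (γ : Polygon Plane n) : Prop :=
  3 ≤ n ∧ ∀ i j : Fin n, ∀ s ∈ Ico (0 : ℝ) 1, ∀ t ∈ Ico (0 : ℝ) 1,
    γ.edgePath ℝ i s = γ.edgePath ℝ j t → i = j ∧ s = t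

/-- The closed region enclosed by a set `Γ`: the set `Γ` together with the bounded connected
components of its complement. -/
def enclosedRegion (Γ : Set Plane) : Set Plane :=
  Γ ∪ {x | x ∈ Γᶜ ∧ Bornology.IsBounded (connectedComponentIn Γᶜ x)}

/-- A (closed) polygon: the region enclosed by a simple closed polygonal line. -/
def IsPolygon (P : Set Plane) : Prop :=
  ∃ (n : ℕ) (γ : Polygon Plane n), IsSimplePolygonalLine γ ∧ P = enclosedRegion (γ.boundary ℝ)

/-- The closed-at-the-sides circular sector with apex `v`, radius `r`, initial direction `φ` and
opening angle `α`. -/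
def sector (v : Plane) (r φ α : ℝ) : Set Plane :=
  {x | ∃ ρ ∈ Ico (0 : ℝ) r, ∃ ψ ∈ Icc φ (φ + α), x = v + ρ • !₂[Real.cos ψ, Real.sin ψ]}

/-- `P` has interior angle `α ∈ (0, 2π)` at `v`: near `v`, it is a sector of opening angle `α`. -/
def HasInteriorAngle (P : Set Plane) (v : Plane) (α : ℝ) : Prop :=
  0 < α ∧ α < 2 * Real.pi ∧ ∃ r > 0, ∃ φ : ℝ, P ∩ Metric.ball v r = sector v r φ α

/-- The concave vertices of a polygon `P`, i.e. the vertices whose interior angle exceeds `π`.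
(All points of `∂P` which are not vertices have interior angle `π`.) -/
def concaveVertices (P : Set Plane) : Set Plane :=
  {v | ∃ α, Real.pi < α ∧ HasInteriorAngle P v α}

/-- The intrinsic distance on `P`: the infimum of the lengths of Lipschitz curves in `P`
connecting `p` and `q`. -/
def intrinsicEDist (P : Set Plane) (p q : Plane) : ℝ≥0∞ :=
  ⨅ (γ : ℝ → Plane) (_ : (∃ K, LipschitzOnWith K γ (Icc 0 1)) ∧ MapsTo γ (Icc 0 1) P ∧
    γ 0 = p ∧ γ 1 = q), eVariationOn γ (Icc 0 1)

/-- The intrinsic diameter of `P`. -/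
def intrinsicDiam (P : Set Plane) : ℝ≥0∞ :=
  ⨆ p ∈ P, ⨆ q ∈ P, intrinsicEDist P p q

/-- The segment `[p; q] ⊆ P` with endpoints in `∂P` induces the partition `P = Q₁ ∪ Q₂` into two
polygons with `Q₁ ∩ Q₂ = [p; q]`. -/
def InducesPartition (P : Set Plane) (p q : Plane) (Q₁ Q₂ : Set Plane) : Prop :=
  p ∈ frontier P ∧ q ∈ frontier P ∧ segment ℝ p q ⊆ P ∧ IsPolygon Q₁ ∧ IsPolygon Q₂ ∧
    P = Q₁ ∪ Q₂ ∧ segment ℝ p q = Q₁ ∩ Q₂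

/-- `ϑ`-semiconvexity: `|[v; w]| ≥ ϑ min_k d(Q_k)` whenever a segment between a concave vertex `v`
and a boundary point `w` induces a partition `P = Q₁ ∪ Q₂`. -/
def IsSemiconvex (ϑ : ℝ) (P : Set Plane) : Prop :=
  ∀ v ∈ concaveVertices P, ∀ w ∈ frontier P, ∀ Q₁ Q₂ : Set Plane,
    InducesPartition P v w Q₁ Q₂ →
      ENNReal.ofReal ϑ * min (intrinsicDiam Q₁) (intrinsicDiam Q₂) ≤ edist v w

/-- The width of `A` in direction `e`: the length of the projection of `A` to the line `ℝ e`. -/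
def widthAlong (A : Set Plane) (e : Plane) : ℝ≥0∞ :=
  ⨆ x ∈ A, ⨆ y ∈ A, ENNReal.ofReal |inner ℝ (x - y) e|

/-- The maximal width of `A`. The unit vectors are exactly the vectors `R e₁` with `R ∈ SO(2)`. -/
def maxWidth (A : Set Plane) : ℝ≥0∞ :=
  ⨆ e ∈ Metric.sphere (0 : Plane) 1, widthAlong A e

/-- The minimal width of `A`. -/
def minWidth (A : Set Plane) : ℝ≥0∞ :=
  ⨅ e ∈ Metric.sphere (0 : Plane) 1, widthAlong A e

/-- `S` cuts `P` into `A` and `B`: either `S` is a segment inducing the partition `P = A ∪ B`, or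
nothing is cut off, that is `A = S = ∅` and `B = P`. -/
def CutsOff (P S A B : Set Plane) : Prop :=
  (A = ∅ ∧ S = ∅ ∧ B = P) ∨ ∃ p q : Plane, S = segment ℝ p q ∧ InducesPartition P p q A B

/-- `S 0, S 1` cut the polygon `P` into `P = Q 0 ∪ P' ∪ Q 1` with `Q i ∩ P' = S i`, where `P'` is a
convex polygon. Either `Q i` (together with `S i`) may be empty, and the trivial
choice `Q 0 = P`, `P' = Q 1 = ∅` without any segment is admissible as well. -/
def IsTwoSegmentPartition (P : Set Plane) (S Q : Fin 2 → Set Plane) (P' : Set Plane) : Prop :=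
  (Q 0 = P ∧ P' = ∅ ∧ Q 1 = ∅ ∧ ∀ i, S i = ∅) ∨
  (IsPolygon P' ∧ Convex ℝ P' ∧ P = Q 0 ∪ P' ∪ Q 1 ∧ (∀ i, Q i ∩ P' = S i) ∧
    ∀ i j, i ≠ j → CutsOff P (S i) (Q i) (P' ∪ Q j))

end

/-!
If `w_max(P) ≤ C w_min(P)`, nothing has to be cut. Otherwise there is a unit vector `e`, the
vertical direction, in which `P` is much thinner than it is long.

**The convex core.** At a concave vertex `v` of `P` one of the directions `± e` points into the
interior of `P`, so that there is a vertical chord from `v` to another boundary point. By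
semiconvexity the chord cuts off a piece whose diameter is at most `1 / ϑ` times the length of the
chord. This piece is removed and called a pocket. A concave vertex of the remaining polygon is a
concave vertex of `P` from which a vertical direction into the interior is left, and each cut uses
up one of these finitely many directions; hence the process stops at a polygon `K` without concave
vertices (`IsCore.exists_smaller`, `exists_convex_core`). Such a polygon is convex
(`IsPolygon.convex`). A vertical chord on the boundary of a convex set lies on a vertical supporting
line, so that all pockets sit at the left or the right end of `K` (`IsCore.pocket_at_end`).

**The choice of the cuts.** The pockets have diameter at most `w / ϑ`, where `w` is the width of `P`
in direction `e`; therefore `K` is much longer than `w`. If there are pockets at the left end, `K` is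
cut along the vertical slice at distance `H` from this end, where `H` is the largest number of the
form `2 ^ (-j) * 16 w / ϑ` such that this slice has length at least `ϑ H / 8`
(`IsFrame.exists_scale`). The slice at distance `2 H` is then shorter than `ϑ H / 4`, and by convexity
the slice at the left end is no longer than `ϑ H / 2`. Thus the pockets at this end have diameter at
most `H / 2` and the piece that is cut off has diameter at most `5 H`. It contains a slice of length
`ϑ H / 8` at horizontal distance `H` from its left end, and so it is thick in each direction. Its
concave vertices belong to the pockets and hence have distance at least `H / 2` from the slice
(`IsCore.exists_end`). The right end is treated in the same way, and what is left of `K` between the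
slices is convex.

**Plane topology.** The boundary of a polygon is encoded as a sequence of vertices (`IsSimpleLoop`).
Its complement has at least two components, since the winding number is constant on components,
vanishes far away and jumps by `2 π` across an edge, and at most two, since each component touches
each boundary point and near such a point the complement consists of two sectors
(`IsSimpleLoop.isJordanRegion`). This theorem also shows that a chord cuts a polygon into two polygons
(`IsPolygon.exists_chordCut`).
-/

/-! ### Closed polygonal lines -/

/-- The half-open segment `[a, b)`. -/
def hoSeg (a b : Plane) : Set Plane := AffineMap.lineMap a b '' Ico (0 : ℝ) 1

/-- A simple closed polygonal line with `n` edges `[v i, v (i + 1))`, `i < n`, given by a sequence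
with `v n = v 0`; the values of `v` beyond `n` are irrelevant. -/
structure IsSimpleLoop (n : ℕ) (v : ℕ → Plane) : Prop where
  pos : 0 < n
  closed : v n = v 0
  ne : ∀ i < n, v i ≠ v (i + 1)
  disj : ∀ i < n, ∀ j < n, i ≠ j → Disjoint (hoSeg (v i) (v (i + 1))) (hoSeg (v j) (v (j + 1)))

/-- The union of the first `n` edges of a polygonal line. -/
def pathSet (n : ℕ) (v : ℕ → Plane) : Set Plane := ⋃ i < n, segment ℝ (v i) (v (i + 1))

lemma mem_pathSet {n : ℕ} {v : ℕ → Plane} {x : Plane} :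
    x ∈ pathSet n v ↔ ∃ i < n, x ∈ segment ℝ (v i) (v (i + 1)) := by
  simp [pathSet]

lemma left_mem_hoSeg (a b : Plane) : a ∈ hoSeg a b := ⟨0, by simp, by simp⟩

lemma hoSeg_subset_segment (a b : Plane) : hoSeg a b ⊆ segment ℝ a b := by
  rintro _ ⟨t, ht, rfl⟩
  rw [segment_eq_image_lineMap]
  exact ⟨t, ⟨ht.1, ht.2.le⟩, rfl⟩

lemma segment_eq_hoSeg_union (a b : Plane) : segment ℝ a b = hoSeg a b ∪ {b} := by
  apply subset_antisymm
  · rw [segment_eq_image_lineMap]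
    rintro _ ⟨t, ht, rfl⟩
    rcases ht.2.lt_or_eq with h | h
    · exact Or.inl ⟨t, ⟨ht.1, h⟩, rfl⟩
    · right; simp [h]
  · exact union_subset (hoSeg_subset_segment a b) (by simp [right_mem_segment])

lemma hoSeg_eq_union_openSegment {a b : Plane} : hoSeg a b = {a} ∪ openSegment ℝ a b := by
  rw [openSegment_eq_image_lineMap]
  apply subset_antisymm
  · rintro _ ⟨t, ht, rfl⟩
    rcases ht.1.lt_or_eq with h | h
    · exact Or.inr ⟨t, ⟨h, ht.2⟩, rfl⟩
    · left; simp [← h]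
  · rintro x (rfl | ⟨t, ht, rfl⟩)
    · exact left_mem_hoSeg _ _
    · exact ⟨t, ⟨ht.1.le, ht.2⟩, rfl⟩

/-- A point of the open segment splits a half-open segment into two half-open segments. -/
lemma hoSeg_split {a b p : Plane} (hab : a ≠ b) (hp : p ∈ openSegment ℝ a b) :
    hoSeg a b = hoSeg a p ∪ hoSeg p b ∧ Disjoint (hoSeg a p) (hoSeg p b) := by
  rw [openSegment_eq_image_lineMap] at hp
  obtain ⟨s, ⟨hs0, hs1⟩, rfl⟩ := hp
  have e1 : ∀ t : ℝ, AffineMap.lineMap a (AffineMap.lineMap a b s) t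
      = AffineMap.lineMap a b (t * s) := by
    intro t; simp [AffineMap.lineMap_apply_module']; module
  have e2 : ∀ t : ℝ, AffineMap.lineMap (AffineMap.lineMap a b s) b t
      = AffineMap.lineMap a b (s + t * (1 - s)) := by
    intro t; simp [AffineMap.lineMap_apply_module']; module
  constructor
  · apply subset_antisymm
    · rintro _ ⟨t, ht, rfl⟩
      rcases lt_or_ge t s with h | h
      · refine Or.inl ⟨t / s, ⟨by have := ht.1; positivity, by rw [div_lt_one hs0]; exact h⟩, ?_⟩
        rw [e1, div_mul_cancel₀ _ hs0.ne']
      · have h1 : 0 < 1 - s := by linarith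
        refine Or.inr ⟨(t - s) / (1 - s), ⟨div_nonneg (by linarith) h1.le, ?_⟩, ?_⟩
        · rw [div_lt_one h1]; linarith [ht.2]
        · rw [e2, div_mul_cancel₀ _ h1.ne']; congr 1; ring
    · rintro x (⟨t, ht, rfl⟩ | ⟨t, ht, rfl⟩)
      · rw [e1]
        exact ⟨_, ⟨mul_nonneg ht.1 hs0.le, by nlinarith [ht.1, ht.2]⟩, rfl⟩
      · rw [e2]
        exact ⟨_, ⟨by nlinarith [ht.1, ht.2], by nlinarith [ht.1, ht.2]⟩, rfl⟩
  · rw [Set.disjoint_left]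
    rintro _ ⟨t, ht, rfl⟩ ⟨t', ht', h⟩
    rw [e1, e2] at h
    have := AffineMap.lineMap_injective ℝ hab h
    nlinarith [ht.1, ht.2, ht'.1, ht'.2]

lemma pathSet_eq_iUnion_hoSeg {n : ℕ} (hn : 0 < n) (v : ℕ → Plane) :
    pathSet n v = (⋃ i < n, hoSeg (v i) (v (i + 1))) ∪ {v n} := by
  ext x
  simp only [mem_pathSet, mem_union, mem_iUnion, exists_prop, mem_singleton_iff]
  constructor
  · rintro ⟨i, hi, hx⟩
    rw [segment_eq_hoSeg_union] at hx
    rcases hx with hx | rfl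
    · exact Or.inl ⟨i, hi, hx⟩
    · rcases (Nat.succ_le_of_lt hi).lt_or_eq with h | h
      · exact Or.inl ⟨i + 1, h, left_mem_hoSeg _ _⟩
      · right; rw [← h]
  · rintro (⟨i, hi, hx⟩ | rfl)
    · exact ⟨i, hi, hoSeg_subset_segment _ _ hx⟩
    · refine ⟨n - 1, by omega, ?_⟩
      rw [Nat.sub_add_cancel hn]
      exact right_mem_segment _ _ _

lemma isCompact_pathSet (n : ℕ) (v : ℕ → Plane) : IsCompact (pathSet n v) := by
  have : pathSet n v = ⋃ i ∈ Finset.range n, segment ℝ (v i) (v (i + 1)) := by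
    simp [pathSet]
  rw [this]
  refine Finset.isCompact_biUnion _ fun i _ => ?_
  rw [segment_eq_image_lineMap]
  exact isCompact_Icc.image AffineMap.lineMap_continuous

lemma pathSet_succ (n : ℕ) (v : ℕ → Plane) :
    pathSet (n + 1) v = pathSet n v ∪ segment ℝ (v n) (v (n + 1)) := by
  ext x
  simp only [mem_pathSet, mem_union, Nat.lt_succ_iff_lt_or_eq]
  constructor
  · rintro ⟨i, hi | rfl, hx⟩
    · exact Or.inl ⟨i, hi, hx⟩
    · exact Or.inr hx
  · rintro (⟨i, hi, hx⟩ | hx)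
    · exact ⟨i, Or.inl hi, hx⟩
    · exact ⟨n, Or.inr rfl, hx⟩

lemma isPreconnected_pathSet (n : ℕ) (v : ℕ → Plane) : IsPreconnected (pathSet n v) := by
  induction n with
  | zero =>
    have : pathSet 0 v = ∅ := by simp [pathSet]
    rw [this]; exact isPreconnected_empty
  | succ n ih =>
    rw [pathSet_succ]
    have hs : IsPreconnected (segment ℝ (v n) (v (n + 1))) := (convex_segment _ _).isPreconnected
    rcases Nat.eq_zero_or_pos n with rfl | hn
    · have : pathSet 0 v = ∅ := by simp [pathSet]
      rwa [this, empty_union]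
    · refine ih.union (v n) ?_ (left_mem_segment _ _ _) hs
      rw [pathSet_eq_iUnion_hoSeg hn]
      exact Or.inr rfl

lemma pathSet_congr {n : ℕ} {v w : ℕ → Plane} (h : ∀ i ≤ n, v i = w i) :
    pathSet n v = pathSet n w := by
  ext x
  simp only [mem_pathSet]
  exact exists_congr fun i => and_congr_right fun hi => by rw [h i hi.le, h (i + 1) hi]

namespace IsSimpleLoop

variable {n : ℕ} {v : ℕ → Plane}

lemma pathSet_eq (hv : IsSimpleLoop n v) :
    pathSet n v = ⋃ i < n, hoSeg (v i) (v (i + 1)) := by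
  rw [pathSet_eq_iUnion_hoSeg hv.pos]
  apply union_eq_self_of_subset_right
  rintro _ rfl
  rw [hv.closed]
  simp only [mem_iUnion]
  exact ⟨0, hv.pos, left_mem_hoSeg _ _⟩

lemma eq_of_mem (hv : IsSimpleLoop n v) {i j : ℕ} (hi : i < n) (hj : j < n) {x : Plane}
    (h : x ∈ hoSeg (v i) (v (i + 1))) (h' : x ∈ hoSeg (v j) (v (j + 1))) : i = j := by
  by_contra hij
  exact Set.disjoint_left.1 (hv.disj i hi j hj hij) h h'

lemma inj (hv : IsSimpleLoop n v) {i j : ℕ} (hi : i < n) (hj : j < n) (h : v i = v j) : i = j :=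
  hv.eq_of_mem hi hj (left_mem_hoSeg _ _) (h ▸ left_mem_hoSeg _ _)

lemma vertex_mod (hv : IsSimpleLoop n v) {i : ℕ} (hi : i < n) :
    v ((i + 1) % n) = v (i + 1) := by
  rcases (Nat.succ_le_of_lt hi).lt_or_eq with h | h
  · rw [Nat.mod_eq_of_lt h]
  · have : i + 1 = n := h
    rw [this, Nat.mod_self, hv.closed]

/-- Starting the line at its `k`-th vertex. -/
lemma rotate_edge (hv : IsSimpleLoop n v) (k i : ℕ) :
    (i + k) % n < n ∧ v ((i + 1 + k) % n) = v ((i + k) % n + 1) := by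
  have h := Nat.mod_lt (i + k) hv.pos
  refine ⟨h, ?_⟩
  rw [← hv.vertex_mod h]
  congr 1
  rw [Nat.mod_add_mod]; congr 1; ring

lemma rotate (hv : IsSimpleLoop n v) (k : ℕ) : IsSimpleLoop n fun i => v ((i + k) % n) where
  pos := hv.pos
  closed := by simp
  ne i hi := by
    obtain ⟨h, e⟩ := hv.rotate_edge k i
    simp only [e]
    exact hv.ne _ h
  disj i hi j hj hij := by
    obtain ⟨h, e⟩ := hv.rotate_edge k i
    obtain ⟨h', e'⟩ := hv.rotate_edge k j
    simp only [e, e']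
    refine hv.disj _ h _ h' fun hh => hij ?_
    have : i ≡ j [MOD n] := Nat.ModEq.add_right_cancel' k hh
    exact Nat.ModEq.eq_of_lt_of_lt this hi hj

lemma exists_rotate_index (hv : IsSimpleLoop n v) (k : ℕ) {i : ℕ} (hi : i < n) :
    ∃ j < n, (j + k) % n = i := by
  refine ⟨(i + (n - 1) * k) % n, Nat.mod_lt _ hv.pos, ?_⟩
  obtain ⟨m, rfl⟩ := Nat.exists_eq_succ_of_ne_zero hv.pos.ne'
  rw [Nat.mod_add_mod, Nat.succ_eq_add_one, Nat.add_sub_cancel,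
    show i + m * k + k = i + (m + 1) * k by ring, Nat.add_mul_mod_self_left, Nat.mod_eq_of_lt hi]

lemma pathSet_rotate (hv : IsSimpleLoop n v) (k : ℕ) :
    pathSet n (fun i => v ((i + k) % n)) = pathSet n v := by
  ext x
  simp only [mem_pathSet]
  constructor
  · rintro ⟨i, hi, hx⟩
    obtain ⟨h, e⟩ := hv.rotate_edge k i
    rw [e] at hx
    exact ⟨_, h, hx⟩
  · rintro ⟨i, hi, hx⟩
    obtain ⟨j, hj, rfl⟩ := hv.exists_rotate_index k hi
    refine ⟨j, hj, ?_⟩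
    rw [(hv.rotate_edge k j).2]
    exact hx

/-- A point of the last open edge may be added as a vertex. -/
lemma insert_last (hv : IsSimpleLoop (n + 1) v) {p : Plane}
    (hp : p ∈ openSegment ℝ (v n) (v (n + 1))) :
    IsSimpleLoop (n + 2) (fun i => if i ≤ n then v i else if i = n + 1 then p else v 0) ∧
    pathSet (n + 2) (fun i => if i ≤ n then v i else if i = n + 1 then p else v 0) =
      pathSet (n + 1) v := by
  set w : ℕ → Plane := fun i => if i ≤ n then v i else if i = n + 1 then p else v 0 with hw
  have w1 : ∀ i ≤ n, w i = v i := fun i hi => by simp [hw, hi]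
  have w2 : w (n + 1) = p := by simp [hw]
  have w3 : w (n + 2) = v (n + 1) := by simp [hw, hv.closed]
  have hne := hv.ne n (by omega)
  obtain ⟨hs, hd⟩ := hoSeg_split hne hp
  have hpe : p ≠ v n := by
    rintro rfl
    exact hne (left_mem_openSegment_iff.1 hp)
  have hpe' : p ≠ v (n + 1) := by
    rintro rfl
    exact hne (right_mem_openSegment_iff.1 hp)
  have hold : ∀ i < n, w i = v i ∧ w (i + 1) = v (i + 1) := fun i hi =>
    ⟨w1 i hi.le, w1 _ hi⟩
  have key : ∀ i < n, ∀ j < n + 2, i ≠ j →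
      Disjoint (hoSeg (w i) (w (i + 1))) (hoSeg (w j) (w (j + 1))) := by
    intro i hi j hj hij
    rw [(hold i hi).1, (hold i hi).2]
    rcases Nat.lt_or_ge j n with h | h
    · rw [(hold j h).1, (hold j h).2]
      exact hv.disj _ (by omega) _ (by omega) hij
    · have := hv.disj i (by omega) n (by omega) (by omega)
      rw [hs, disjoint_union_right] at this
      rcases (show j = n ∨ j = n + 1 by omega) with rfl | rfl
      · rw [w1 _ le_rfl, w2]; exact this.1
      · rw [w2, w3]; exact this.2
  have hd' : Disjoint (hoSeg (w n) (w (n + 1))) (hoSeg (w (n + 1)) (w (n + 1 + 1))) := by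
    rw [w1 n le_rfl, w2, w3]; exact hd
  have hloop : IsSimpleLoop (n + 2) w := by
    refine ⟨by omega, ?_, ?_, ?_⟩
    · rw [w3, w1 0 (by omega), hv.closed]
    · intro i hi
      rcases Nat.lt_or_ge i n with h | h
      · rw [(hold i h).1, (hold i h).2]; exact hv.ne i (by omega)
      · rcases (show i = n ∨ i = n + 1 by omega) with rfl | rfl
        · rw [w1 _ le_rfl, w2]; exact hpe.symm
        · rw [w2, w3]; exact hpe'
    · intro i hi j hj hij
      rcases Nat.lt_or_ge i n with h | h
      · exact key i h j hj hij
      rcases Nat.lt_or_ge j n with h' | h'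
      · exact (key j h' i hi hij.symm).symm
      rcases (show i = n ∨ i = n + 1 by omega) with rfl | rfl
      · obtain rfl : j = i + 1 := by omega
        exact hd'
      · obtain rfl : j = n := by omega
        exact hd'.symm
  refine ⟨hloop, ?_⟩
  rw [hloop.pathSet_eq, hv.pathSet_eq]
  ext x
  simp only [mem_iUnion, exists_prop]
  constructor
  · rintro ⟨i, hi, hx⟩
    rcases Nat.lt_or_ge i n with h | h
    · rw [(hold i h).1, (hold i h).2] at hx
      exact ⟨i, by omega, hx⟩
    · refine ⟨n, by omega, ?_⟩
      rw [hs]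
      rcases (show i = n ∨ i = n + 1 by omega) with rfl | rfl
      · rw [w1 _ le_rfl, w2] at hx; exact Or.inl hx
      · rw [w2, w3] at hx; exact Or.inr hx
  · rintro ⟨i, hi, hx⟩
    rcases Nat.lt_or_ge i n with h | h
    · refine ⟨i, by omega, ?_⟩
      rwa [(hold i h).1, (hold i h).2]
    · obtain rfl : i = n := by omega
      rw [hs] at hx
      rcases hx with hx | hx
      · refine ⟨i, by omega, ?_⟩
        rwa [w1 _ le_rfl, w2]
      · refine ⟨i + 1, by omega, ?_⟩
        rwa [w2, w3]

/-- Every point of a simple closed polygonal line is the initial vertex of some subdivision. -/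
lemma exists_vertex_zero (hv : IsSimpleLoop n v) {p : Plane} (hp : p ∈ pathSet n v) :
    ∃ m w, IsSimpleLoop m w ∧ pathSet m w = pathSet n v ∧ w 0 = p ∧
      ∀ i < n, ∃ j < m, w j = v i := by
  have hp' := hp
  rw [hv.pathSet_eq] at hp'
  simp only [mem_iUnion] at hp'
  obtain ⟨k, hk, hpk⟩ := hp'
  have hrot : ∀ {m : ℕ} {w : ℕ → Plane}, IsSimpleLoop m w → ∀ k, ∀ i < m, ∃ j < m,
      (fun i => w ((i + k) % m)) j = w i := by
    intro m w hw k i hi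
    obtain ⟨j, hj, rfl⟩ := hw.exists_rotate_index k hi
    exact ⟨j, hj, rfl⟩
  rw [hoSeg_eq_union_openSegment] at hpk
  rcases hpk with rfl | hpk
  · refine ⟨n, _, hv.rotate k, hv.pathSet_rotate k, ?_, hrot hv k⟩
    simp [Nat.mod_eq_of_lt hk]
  · obtain ⟨m, rfl⟩ := Nat.exists_eq_succ_of_ne_zero hv.pos.ne'
    have hr := hv.rotate (k + 1)
    have e1 : (m + (k + 1)) % (m + 1) = k := by
      rw [show m + (k + 1) = k + (m + 1) by ring, Nat.add_mod_right, Nat.mod_eq_of_lt hk]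
    obtain ⟨hl, hs⟩ := hr.insert_last (p := p) (by
      have := (hv.rotate_edge (k + 1) m).2
      simp only [Nat.succ_eq_add_one, e1] at this ⊢
      rwa [this])
    refine ⟨m + 2, _, hl.rotate (m + 1), ?_, ?_, ?_⟩
    · rw [hl.pathSet_rotate, hs, hv.pathSet_rotate]
    · simp
    · intro i hi
      obtain ⟨j, hj, hji⟩ := hrot hv (k + 1) i hi
      obtain ⟨l, hlm, hlj⟩ := hrot hl (m + 1) j (by omega)
      refine ⟨l, hlm, hlj.trans ?_⟩
      rw [if_pos (by omega)]
      exact hji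

lemma exists_vertex_zero_vertex (hv : IsSimpleLoop n v) {p q : Plane} (hp : p ∈ pathSet n v)
    (hq : q ∈ pathSet n v) (hpq : p ≠ q) :
    ∃ m w k, IsSimpleLoop m w ∧ pathSet m w = pathSet n v ∧ w 0 = p ∧ w k = q ∧ 0 < k ∧ k < m := by
  obtain ⟨m, w, hw, hws, hwq, -⟩ := hv.exists_vertex_zero hq
  obtain ⟨m', w', hw', hws', hwp, hi⟩ := hw.exists_vertex_zero (p := p) (hws ▸ hp)
  obtain ⟨k, hk, hkq⟩ := hi 0 hw.pos
  refine ⟨m', w', k, hw', hws'.trans hws, hwp, hkq.trans hwq, Nat.pos_of_ne_zero ?_, hk⟩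
  rintro rfl
  exact hpq (hwp.symm.trans (hkq.trans hwq))

/-- The chord from the `k`-th to the initial vertex closes the first `k` edges to a simple
closed polygonal line. -/
lemma truncate (hv : IsSimpleLoop n v) {k : ℕ} (hk0 : 0 < k) (hkn : k < n)
    (hd : Disjoint (openSegment ℝ (v k) (v 0)) (pathSet n v)) :
    IsSimpleLoop (k + 1) (fun i => if i ≤ k then v i else v 0) ∧
    pathSet (k + 1) (fun i => if i ≤ k then v i else v 0) =
      pathSet k v ∪ segment ℝ (v k) (v 0) := by
  set w : ℕ → Plane := fun i => if i ≤ k then v i else v 0 with hw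
  have w1 : ∀ i ≤ k, w i = v i := fun i hi => by simp [hw, hi]
  have w2 : w (k + 1) = v 0 := by simp [hw]
  have key : ∀ i < k, Disjoint (hoSeg (w i) (w (i + 1))) (hoSeg (w k) (w (k + 1))) := by
    intro i hi
    rw [w1 i hi.le, w1 _ hi, w1 k le_rfl, w2, hoSeg_eq_union_openSegment (a := v k),
      disjoint_union_right]
    constructor
    · rw [disjoint_singleton_right]
      intro h
      exact hi.ne (hv.eq_of_mem (by omega) hkn h (left_mem_hoSeg _ _))
    · refine (hd.mono_right ?_).symm
      rw [hv.pathSet_eq]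
      exact subset_iUnion₂ (s := fun i (_ : i < n) => hoSeg (v i) (v (i + 1))) i (by omega)
  refine ⟨⟨by omega, by rw [w2, w1 0 (by omega)], ?_, ?_⟩, ?_⟩
  · intro i hi
    rcases Nat.lt_or_ge i k with h | h
    · rw [w1 i h.le, w1 _ h]; exact hv.ne i (by omega)
    · obtain rfl : i = k := by omega
      rw [w1 _ le_rfl, w2]
      intro h
      exact hk0.ne' (hv.inj hkn hv.pos h)
  · intro i hi j hj hij
    rcases Nat.lt_or_ge i k with h | h
    · rcases Nat.lt_or_ge j k with h' | h'
      · rw [w1 i h.le, w1 _ h, w1 j h'.le, w1 _ h']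
        exact hv.disj _ (by omega) _ (by omega) hij
      · obtain rfl : j = k := by omega
        exact key i h
    · obtain rfl : i = k := by omega
      exact (key j (by omega)).symm
  · rw [pathSet_succ, w1 k le_rfl, w2, pathSet_congr w1]

/-- A chord divides a simple closed polygonal line into two arcs, each of which it closes to a
simple closed polygonal line. -/
lemma exists_arcs (hv : IsSimpleLoop n v) {p q : Plane} (hp : p ∈ pathSet n v)
    (hq : q ∈ pathSet n v) (hpq : p ≠ q) (hd : Disjoint (openSegment ℝ p q) (pathSet n v)) :
    ∃ A : Fin 2 → Set Plane, pathSet n v = A 0 ∪ A 1 ∧ A 0 ∩ A 1 = {p, q} ∧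
      ∀ i, IsCompact (A i) ∧ (∃ x ∈ A i, x ≠ p ∧ x ≠ q) ∧
        ∃ m w, IsSimpleLoop m w ∧ pathSet m w = A i ∪ segment ℝ p q := by
  obtain ⟨m, w, k, hw, hws, hwp, hwq, hk0, hkm⟩ := hv.exists_vertex_zero_vertex hp hq hpq
  have aux : ∀ {m : ℕ} {w : ℕ → Plane} {k : ℕ}, IsSimpleLoop m w → 0 < k → k < m →
      ∃ x ∈ pathSet k w, x ≠ w 0 ∧ x ≠ w k := by
    intro m w k hw hk0 hkm
    have hne := hw.ne 0 (by omega)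
    have hmem : AffineMap.lineMap (w 0) (w 1) (1 / 2 : ℝ) ∈ hoSeg (w 0) (w (0 + 1)) :=
      ⟨1 / 2, by norm_num, rfl⟩
    refine ⟨_, mem_pathSet.2 ⟨0, hk0, hoSeg_subset_segment _ _ hmem⟩, fun h => hne ?_, fun h => ?_⟩
    · have h0 : AffineMap.lineMap (w 0) (w 1) (1 / 2 : ℝ) = AffineMap.lineMap (w 0) (w 1) (0 : ℝ) := by
        simpa using h
      by_contra h1
      have := AffineMap.lineMap_injective ℝ h1 h0
      norm_num at this
    · rw [h] at hmem
      exact hk0.ne (hw.eq_of_mem hw.pos hkm hmem (left_mem_hoSeg _ _))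
  -- the second arc consists of the first edges after a rotation
  have hr := hw.rotate k
  have hrs := hw.pathSet_rotate k
  set u : ℕ → Plane := fun i => w ((i + k) % m) with hu
  have hu0 : u 0 = q := by simp [hu, Nat.mod_eq_of_lt hkm, hwq]
  have huk : u (m - k) = p := by simp [hu, Nat.sub_add_cancel hkm.le, hwp]
  have hd1 : Disjoint (openSegment ℝ (w k) (w 0)) (pathSet m w) := by
    rw [hwq, hwp, hws, openSegment_symm]; exact hd
  have hd2 : Disjoint (openSegment ℝ (u (m - k)) (u 0)) (pathSet m u) := by
    rw [hu0, huk, hrs, hws]; exact hd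
  have t1 := hw.truncate hk0 hkm hd1
  have t2 := hr.truncate (k := m - k) (by omega) (by omega) hd2
  have t1s := t1.2
  rw [show segment ℝ (w k) (w 0) = segment ℝ p q by rw [hwq, hwp, segment_symm]] at t1s
  have t2s := t2.2
  rw [show segment ℝ (u (m - k)) (u 0) = segment ℝ p q by rw [hu0, huk]] at t2s
  obtain ⟨x1, hx1, hx1p, hx1q⟩ := aux hw hk0 hkm
  obtain ⟨x2, hx2, hx2q, hx2p⟩ := aux (k := m - k) hr (by omega) (by omega)
  rw [hwp] at hx1p; rw [hwq] at hx1q; rw [hu0] at hx2q; rw [huk] at hx2p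
  have e2 : pathSet (m - k) u = (⋃ i < m - k, hoSeg (w (i + k)) (w (i + k + 1))) ∪ {p} := by
    rw [pathSet_eq_iUnion_hoSeg (by omega), huk]
    congr 1
    refine iUnion₂_congr fun i hi => ?_
    have := (hw.rotate_edge k i).2
    simp only [hu]
    rw [this, Nat.mod_eq_of_lt (by omega)]
  have e1 : pathSet k w = (⋃ i < k, hoSeg (w i) (w (i + 1))) ∪ {q} := by
    rw [pathSet_eq_iUnion_hoSeg hk0, hwq]
  have hp1 : p ∈ pathSet k w := by
    rw [← hwp]; exact mem_pathSet.2 ⟨0, hk0, left_mem_segment _ _ _⟩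
  have hq2 : q ∈ pathSet (m - k) u := by
    rw [← hu0]; exact mem_pathSet.2 ⟨0, by omega, left_mem_segment _ _ _⟩
  refine ⟨![pathSet k w, pathSet (m - k) u], ?_, ?_, fun i => ?_⟩
  · rw [← hws]
    apply subset_antisymm
    · rw [hw.pathSet_eq]
      refine iUnion₂_subset fun i hi => ?_
      rcases Nat.lt_or_ge i k with h | h
      · refine Subset.trans ?_ subset_union_left
        simp only [Matrix.cons_val_zero, e1]
        exact Subset.trans (subset_iUnion₂ (s := fun i (_ : i < k) => hoSeg (w i) (w (i + 1))) i h)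
          subset_union_left
      · refine Subset.trans ?_ subset_union_right
        simp only [Matrix.cons_val_one, Matrix.cons_val_fin_one, e2]
        have := subset_iUnion₂ (s := fun i (_ : i < m - k) => hoSeg (w (i + k)) (w (i + k + 1)))
          (i - k) (by omega)
        simp only [Nat.sub_add_cancel h] at this
        exact this.trans subset_union_left
    · refine union_subset ?_ ?_
      · rintro x hx
        obtain ⟨i, hi, hx⟩ := mem_pathSet.1 hx
        exact mem_pathSet.2 ⟨i, by omega, hx⟩
      · rw [← hrs]
        rintro x hx
        obtain ⟨i, hi, hx⟩ := mem_pathSet.1 hx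
        exact mem_pathSet.2 ⟨i, by omega, hx⟩
  · simp only [Matrix.cons_val_zero, Matrix.cons_val_one, Matrix.cons_val_fin_one]
    apply subset_antisymm
    · rw [e1, e2]
      rintro x ⟨h1 | h1, h2 | h2⟩
      · simp only [mem_iUnion] at h1 h2
        obtain ⟨i, hi, h1⟩ := h1
        obtain ⟨j, hj, h2⟩ := h2
        have := hw.eq_of_mem (by omega) (by omega) h1 h2
        omega
      · exact Or.inl h2
      · exact Or.inr h1
      · exact Or.inr h1
    · rintro x (rfl | rfl)
      · exact ⟨hp1, by rw [e2]; exact Or.inr rfl⟩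
      · exact ⟨by rw [e1]; exact Or.inr rfl, hq2⟩
  · fin_cases i
    · exact ⟨isCompact_pathSet _ _, ⟨x1, hx1, hx1p, hx1q⟩, _, _, t1.1, t1s⟩
    · exact ⟨isCompact_pathSet _ _, ⟨x2, hx2, hx2p, hx2q⟩, _, _, t2.1, t2s⟩

/-- Near its initial vertex a simple closed polygonal line consists of two segments emanating
from it in different directions. -/
lemma exists_local (hv : IsSimpleLoop n v) :
    ∃ a b : Plane, a ≠ 0 ∧ b ≠ 0 ∧ ¬ SameRay ℝ a b ∧ ∃ r > 0, ∀ x ∈ Metric.ball (v 0) r,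
      x ∈ pathSet n v ↔ x ∈ segment ℝ (v 0) (v 0 + a) ∨ x ∈ segment ℝ (v 0) (v 0 + b) := by
  obtain ⟨m, rfl⟩ := Nat.exists_eq_succ_of_ne_zero hv.pos.ne'
  have hcl : v (m + 1) = v 0 := hv.closed
  have hm : 0 < m := by
    rcases Nat.eq_zero_or_pos m with rfl | h
    · exact absurd hv.closed.symm (hv.ne 0 hv.pos)
    · exact h
  have ha := hv.ne 0 (by omega)
  have hb := hv.ne m (by omega)
  rw [hcl] at hb
  have hrest : IsClosed (⋃ i ∈ (Finset.range m).erase 0, segment ℝ (v i) (v (i + 1))) := by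
    refine (Finset.isCompact_biUnion _ fun i _ => ?_).isClosed
    rw [segment_eq_image_lineMap]
    exact isCompact_Icc.image AffineMap.lineMap_continuous
  have hnot : v 0 ∉ ⋃ i ∈ (Finset.range m).erase 0, segment ℝ (v i) (v (i + 1)) := by
    simp only [mem_iUnion, Finset.mem_erase, Finset.mem_range, not_exists, and_imp]
    intro i hi0 him h
    rw [segment_eq_hoSeg_union] at h
    rcases h with h | h
    · exact hi0 (hv.eq_of_mem (by omega) hv.pos h (left_mem_hoSeg _ _))
    · have := hv.inj hv.pos (j := i + 1) (by omega) h
      omega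
  obtain ⟨r, hr, hball⟩ := Metric.isOpen_iff.1 hrest.isOpen_compl _ hnot
  refine ⟨v 1 - v 0, v m - v 0, sub_ne_zero.2 ha.symm, sub_ne_zero.2 hb, ?_, r, hr, ?_⟩
  · intro hs
    obtain ⟨c, hc, h⟩ := hs.exists_pos_left (sub_ne_zero.2 ha.symm) (sub_ne_zero.2 hb)
    -- the point common to both edges near the vertex
    set t : ℝ := min (c / 2) (1 / 2) with ht
    have ht0 : 0 < t := by positivity
    have ht1 : t ≤ 1 / 2 := min_le_right _ _
    have ht2 : t ≤ c / 2 := min_le_left _ _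
    have h1 : AffineMap.lineMap (v 0) (v 1) t ∈ hoSeg (v 0) (v (0 + 1)) :=
      ⟨t, ⟨ht0.le, by linarith⟩, rfl⟩
    have h2 : AffineMap.lineMap (v 0) (v 1) t ∈ hoSeg (v m) (v (m + 1)) := by
      refine ⟨1 - t / c, ⟨?_, ?_⟩, ?_⟩
      · rw [sub_nonneg, div_le_one hc]; linarith
      · have : 0 < t / c := by positivity
        linarith
      · have h' : v m = v 0 + c • (v 1 - v 0) := by rw [h]; abel
        rw [hcl, AffineMap.lineMap_apply_module', AffineMap.lineMap_apply_module', h']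
        have : t • (v 1 - v 0) = (t / c) • (c • (v 1 - v 0)) := by
          rw [smul_smul, div_mul_cancel₀ _ hc.ne']
        rw [this]
        module
    exact hm.ne (hv.eq_of_mem hv.pos (by omega) h1 h2)
  · intro x hx
    rw [mem_pathSet, add_sub_cancel, add_sub_cancel, segment_symm ℝ (v 0) (v m)]
    constructor
    · rintro ⟨i, hi, h⟩
      by_cases h0 : i = 0
      · subst h0; exact Or.inl h
      by_cases h1 : i = m
      · subst h1; rw [hcl] at h; exact Or.inr h
      · refine absurd ?_ (hball hx)
        simp only [mem_iUnion, Finset.mem_erase, Finset.mem_range]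
        exact ⟨i, ⟨h0, by omega⟩, h⟩
    · rintro (h | h)
      · exact ⟨0, by omega, h⟩
      · exact ⟨m, by omega, by rwa [hcl]⟩

lemma three_le (hv : IsSimpleLoop n v) : 3 ≤ n := by
  have h1 : n ≠ 1 := by
    rintro rfl
    exact hv.ne 0 hv.pos hv.closed.symm
  have h2 : n ≠ 2 := by
    rintro rfl
    have hcl : v 2 = v 0 := hv.closed
    have h0 : AffineMap.lineMap (v 0) (v 1) (1 / 2 : ℝ) ∈ hoSeg (v 0) (v (0 + 1)) :=
      ⟨1 / 2, by norm_num, rfl⟩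
    have h1 : AffineMap.lineMap (v 0) (v 1) (1 / 2 : ℝ) ∈ hoSeg (v 1) (v (1 + 1)) := by
      refine ⟨1 / 2, by norm_num, ?_⟩
      rw [hcl, AffineMap.lineMap_apply_module', AffineMap.lineMap_apply_module']
      module
    exact absurd (hv.eq_of_mem hv.pos (by omega) h0 h1) (by omega)
  have := hv.pos
  omega

end IsSimpleLoop

lemma val_finRotate_eq_mod {n : ℕ} (i : Fin n) : (finRotate n i : ℕ) = (i + 1) % n := by
  obtain ⟨m, rfl⟩ := Nat.exists_eq_succ_of_ne_zero (Fin.pos i).ne'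
  rw [finRotate_apply, Fin.val_add]
  simp [Nat.add_mod]

/-- Polygonal lines with vertices indexed by `Fin n` and simple loops indexed by `ℕ` enclose the
same sets. -/
lemma isPolygon_iff {P : Set Plane} :
    IsPolygon P ↔ ∃ n v, IsSimpleLoop n v ∧ P = enclosedRegion (pathSet n v) := by
  constructor
  · rintro ⟨n, γ, ⟨hn, hγ⟩, rfl⟩
    have hn0 : 0 < n := by omega
    set v : ℕ → Plane := fun i => γ ⟨i % n, Nat.mod_lt _ hn0⟩ with hv
    have hvi : ∀ i : Fin n, v i = γ i := fun i => by
      simp only [hv]; congr 1; ext; exact Nat.mod_eq_of_lt i.2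
    have hvs : ∀ i : Fin n, v (i + 1) = γ (finRotate n i) := fun i => by
      simp only [hv]; congr 1; ext; exact (val_finRotate_eq_mod i).symm
    refine ⟨n, v, ⟨hn0, by simp [hv], ?_, ?_⟩, ?_⟩
    · intro i hi h
      have e1 := hvi ⟨i, hi⟩
      have e2 := hvs ⟨i, hi⟩
      simp only at e1 e2
      rw [e1, e2] at h
      have := hγ ⟨i, hi⟩ ⟨i, hi⟩ 0 (by norm_num) (1 / 2) (by norm_num)
        (by simp [Polygon.edgePath, h])
      norm_num at this
    · intro i hi j hj hij
      have e1 := hvi ⟨i, hi⟩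
      have e2 := hvs ⟨i, hi⟩
      have e3 := hvi ⟨j, hj⟩
      have e4 := hvs ⟨j, hj⟩
      simp only at e1 e2 e3 e4
      rw [e1, e2, e3, e4, Set.disjoint_left]
      rintro _ ⟨s, hs, rfl⟩ ⟨t, ht, h⟩
      exact hij (by simpa using (hγ ⟨i, hi⟩ ⟨j, hj⟩ s hs t ht h.symm).1)
    · congr 1
      ext x
      simp only [Polygon.boundary, mem_iUnion, mem_pathSet, Polygon.edgeSet,
        affineSegment_eq_segment]
      constructor
      · rintro ⟨i, hi⟩
        exact ⟨i, i.2, by rwa [hvi, hvs]⟩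
      · rintro ⟨i, hi, hx⟩
        refine ⟨⟨i, hi⟩, ?_⟩
        rwa [← hvi, ← hvs]
  · rintro ⟨n, v, hv, rfl⟩
    have hvs : ∀ i : Fin n, v (finRotate n i) = v (i + 1) := fun i => by
      rw [val_finRotate_eq_mod]; exact hv.vertex_mod i.2
    refine ⟨n, ⟨fun i => v i⟩, ⟨hv.three_le, ?_⟩, ?_⟩
    · intro i j s hs t ht h
      simp only [Polygon.edgePath, hvs] at h
      obtain rfl : i = j := Fin.ext (hv.eq_of_mem i.2 j.2 ⟨s, hs, rfl⟩ ⟨t, ht, h.symm⟩)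
      exact ⟨rfl, AffineMap.lineMap_injective ℝ (hv.ne i i.2) h⟩
    · congr 1
      ext x
      simp only [Polygon.boundary, mem_iUnion, mem_pathSet, Polygon.edgeSet,
        affineSegment_eq_segment, hvs]
      exact ⟨fun ⟨i, hi, hx⟩ => ⟨⟨i, hi⟩, hx⟩, fun ⟨i, hx⟩ => ⟨i, i.2, hx⟩⟩

/-! ### Polar coordinates and sectors -/

/-- The unit vector at angle `ψ`. -/
noncomputable def dir (ψ : ℝ) : Plane := !₂[Real.cos ψ, Real.sin ψ]

@[simp] lemma dir_zero' (ψ : ℝ) : dir ψ 0 = Real.cos ψ := rfl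
@[simp] lemma dir_one' (ψ : ℝ) : dir ψ 1 = Real.sin ψ := rfl

lemma plane_ext {x y : Plane} (h0 : x 0 = y 0) (h1 : x 1 = y 1) : x = y := by
  ext i; fin_cases i
  · exact h0
  · exact h1

lemma plane_norm_sq (x : Plane) : ‖x‖ ^ 2 = x 0 ^ 2 + x 1 ^ 2 := by
  rw [EuclideanSpace.norm_sq_eq]; simp

lemma plane_norm (x : Plane) : ‖x‖ = √(x 0 ^ 2 + x 1 ^ 2) := by
  rw [← plane_norm_sq, Real.sqrt_sq (norm_nonneg _)]

lemma plane_inner (x y : Plane) : inner ℝ x y = x 0 * y 0 + x 1 * y 1 := by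
  simp [PiLp.inner_apply, mul_comm]

@[simp] lemma norm_dir (ψ : ℝ) : ‖dir ψ‖ = 1 := by
  rw [plane_norm]; simp

lemma dir_ne_zero (ψ : ℝ) : dir ψ ≠ 0 := by
  rw [← norm_ne_zero_iff]; simp

lemma norm_smul_dir {ρ : ℝ} (h : 0 ≤ ρ) (ψ : ℝ) : ‖ρ • dir ψ‖ = ρ := by
  rw [norm_smul, norm_dir, mul_one, Real.norm_of_nonneg h]

lemma continuous_dir : Continuous dir := by
  unfold dir
  fun_prop

lemma dir_add_two_pi (ψ : ℝ) : dir (ψ + 2 * Real.pi) = dir ψ := by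
  simp [dir]

lemma dir_add_pi (ψ : ℝ) : dir (ψ + Real.pi) = -dir ψ := by
  apply plane_ext <;> simp

lemma inner_dir_dir (φ ψ : ℝ) : inner ℝ (dir φ) (dir ψ) = Real.cos (φ - ψ) := by
  rw [plane_inner, Real.cos_sub]; rfl

lemma exists_dir (φ : ℝ) (x : Plane) : ∃ ψ ∈ Ico φ (φ + 2 * Real.pi), x = ‖x‖ • dir ψ := by
  set z : ℂ := ⟨x 0, x 1⟩ with hz
  have hzn : ‖z‖ = ‖x‖ := by
    rw [plane_norm, Complex.norm_def, Complex.normSq_apply]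
    simp [hz, sq]
  refine ⟨toIcoMod Real.two_pi_pos φ z.arg, toIcoMod_mem_Ico _ _ _, ?_⟩
  have hd : dir (toIcoMod Real.two_pi_pos φ z.arg) = dir z.arg := by
    have := self_sub_toIcoDiv_zsmul Real.two_pi_pos φ z.arg
    rw [← this, zsmul_eq_mul]
    apply plane_ext
    · exact Real.cos_sub_int_mul_two_pi _ _
    · exact Real.sin_sub_int_mul_two_pi _ _
  rw [hd, ← hzn]
  apply plane_ext
  · simp [Complex.norm_mul_cos_arg, hz]
  · simp [Complex.norm_mul_sin_arg, hz]

lemma dir_inj {φ ψ ψ' : ℝ} (h : ψ ∈ Ico φ (φ + 2 * Real.pi)) (h' : ψ' ∈ Ico φ (φ + 2 * Real.pi))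
    (e : dir ψ = dir ψ') : ψ = ψ' := by
  have h1 : Real.cos (ψ - ψ') = 1 := by
    rw [← inner_dir_dir, e, inner_dir_dir]; simp
  rw [Real.cos_eq_one_iff_of_lt_of_lt (by linarith [h.1, h'.2]) (by linarith [h.2, h'.1])] at h1
  linarith

lemma smul_dir_inj {φ ψ ψ' ρ ρ' : ℝ} (hρ : 0 < ρ) (hρ' : 0 ≤ ρ')
    (h : ψ ∈ Ico φ (φ + 2 * Real.pi)) (h' : ψ' ∈ Ico φ (φ + 2 * Real.pi))
    (e : ρ • dir ψ = ρ' • dir ψ') : ρ = ρ' ∧ ψ = ψ' := by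
  have hn : ρ = ρ' := by
    rw [← norm_smul_dir hρ.le ψ, e, norm_smul_dir hρ']
  subst hn
  exact ⟨rfl, dir_inj h h' (smul_right_injective _ hρ.ne' e)⟩

/-- The open circular sector with apex `u`, radius `r`, between the angles `φ` and `φ + α`. -/
def openSector (u : Plane) (r φ α : ℝ) : Set Plane :=
  {x | ∃ ρ ∈ Ioo (0 : ℝ) r, ∃ ψ ∈ Ioo φ (φ + α), x = u + ρ • dir ψ}

lemma openSector_eq_image (u : Plane) (r φ α : ℝ) : openSector u r φ α =
    (fun p : ℝ × ℝ => u + p.1 • dir p.2) '' (Ioo 0 r ×ˢ Ioo φ (φ + α)) := by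
  ext x
  simp only [openSector, mem_ofPred_eq, mem_image, Prod.exists, mem_prod]
  constructor
  · rintro ⟨ρ, hρ, ψ, hψ, rfl⟩; exact ⟨ρ, ψ, ⟨hρ, hψ⟩, rfl⟩
  · rintro ⟨ρ, ψ, ⟨hρ, hψ⟩, rfl⟩; exact ⟨ρ, hρ, ψ, hψ, rfl⟩

lemma continuous_polar (u : Plane) : Continuous fun p : ℝ × ℝ => u + p.1 • dir p.2 :=
  continuous_const.add (continuous_fst.smul (continuous_dir.comp continuous_snd))

lemma isPreconnected_openSector (u : Plane) (r φ α : ℝ) :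
    IsPreconnected (openSector u r φ α) := by
  rw [openSector_eq_image]
  exact (isPreconnected_Ioo.prod isPreconnected_Ioo).image _ (continuous_polar u).continuousOn

/-- The complement of an open sector consists of the exterior of the disc and of the compact
complementary sector. -/
lemma isOpen_openSector (u : Plane) (r φ : ℝ) {α : ℝ} (hα0 : 0 < α) (hα : α ≤ 2 * Real.pi) :
    IsOpen (openSector u r φ α) := by
  have : (openSector u r φ α)ᶜ = {x | r ≤ dist x u} ∪
      (fun p : ℝ × ℝ => u + p.1 • dir p.2) '' (Icc 0 r ×ˢ Icc (φ + α) (φ + 2 * Real.pi)) := by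
    ext x
    simp only [mem_compl_iff, openSector, mem_ofPred_eq, mem_union, mem_image, Prod.exists,
      mem_prod]
    constructor
    · intro h
      by_cases hr : r ≤ dist x u
      · exact Or.inl hr
      right
      push Not at hr
      obtain ⟨ψ, hψ, hx⟩ := exists_dir φ (x - u)
      rw [dist_eq_norm] at hr
      rcases (norm_nonneg (x - u)).lt_or_eq with h0 | h0
      · by_cases hψα : ψ < φ + α
        · rcases hψ.1.lt_or_eq with h1 | h1
          · exact absurd ⟨_, ⟨h0, hr⟩, ψ, ⟨h1, hψα⟩, by rw [← hx]; abel⟩ h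
          · refine ⟨‖x - u‖, φ + 2 * Real.pi, ⟨⟨h0.le, hr.le⟩, by linarith, le_rfl⟩, ?_⟩
            rw [dir_add_two_pi, h1, ← hx]; abel
        · refine ⟨‖x - u‖, ψ, ⟨⟨h0.le, hr.le⟩, by linarith, hψ.2.le⟩, ?_⟩
          rw [← hx]; abel
      · refine ⟨0, φ + α, ⟨⟨le_rfl, by linarith⟩, le_rfl, by linarith⟩, ?_⟩
        have : x - u = 0 := by rw [← norm_eq_zero, ← h0]
        rw [zero_smul, add_zero, sub_eq_zero.1 this]
    · rintro (h | ⟨ρ, ψ, ⟨hρ, hψ⟩, rfl⟩) ⟨ρ', hρ', ψ', hψ', h'⟩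
      · rw [h', dist_eq_norm, add_sub_cancel_left, norm_smul_dir hρ'.1.le] at h
        linarith [hρ'.2]
      · have h' := (add_left_cancel h').symm
        rcases hψ.2.lt_or_eq with h2 | h2
        · have := (smul_dir_inj (φ := φ) hρ'.1 hρ.1 ⟨hψ'.1.le, by linarith [hψ'.2]⟩
            ⟨by linarith [hψ.1], h2⟩ h').2
          linarith [hψ'.2, hψ.1]
        · rw [h2, dir_add_two_pi] at h'
          have := (smul_dir_inj (φ := φ) hρ'.1 hρ.1 ⟨hψ'.1.le, by linarith [hψ'.2]⟩
            ⟨le_rfl, by linarith [Real.pi_pos]⟩ h').2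
          linarith [hψ'.1]
  rw [← isClosed_compl_iff, this]
  exact (isClosed_le continuous_const (continuous_id.dist continuous_const)).union
    ((isCompact_Icc.prod isCompact_Icc).image (continuous_polar u)).isClosed

/-- Within the ball of radius `r`, the set `Γ` consists of the two radii at the angles
`φ` and `φ + α`. -/
structure IsPolyCorner (Γ : Set Plane) (u : Plane) (r φ α : ℝ) : Prop where
  r_pos : 0 < r
  pos : 0 < α
  lt : α < 2 * Real.pi
  mem_iff : ∀ x ∈ Metric.ball u r, x ∈ Γ ↔ ∃ ρ ∈ Ico 0 r, x = u + ρ • dir φ ∨ x = u + ρ • dir (φ + α)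

namespace IsPolyCorner

variable {Γ : Set Plane} {u : Plane} {r φ α : ℝ}

/-- Exchanging the roles of the two radii. -/
lemma swap (h : IsPolyCorner Γ u r φ α) : IsPolyCorner Γ u r (φ + α) (2 * Real.pi - α) where
  r_pos := h.r_pos
  pos := by linarith [h.lt]
  lt := by linarith [h.pos]
  mem_iff x hx := by
    rw [h.mem_iff x hx, show φ + α + (2 * Real.pi - α) = φ + 2 * Real.pi by ring, dir_add_two_pi]
    simp only [or_comm]

lemma mem_openSector_or (h : IsPolyCorner Γ u r φ α) {x : Plane} (hx : x ∈ Metric.ball u r)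
    (hΓ : x ∉ Γ) : x ∈ openSector u r φ α ∨ x ∈ openSector u r (φ + α) (2 * Real.pi - α) := by
  have hx' := hx
  rw [h.mem_iff x hx] at hΓ
  push Not at hΓ
  rw [Metric.mem_ball, dist_eq_norm] at hx
  obtain ⟨ψ, hψ, he⟩ := exists_dir φ (x - u)
  have hxe : x = u + ‖x - u‖ • dir ψ := by rw [← he]; abel
  have h0 := hΓ _ ⟨norm_nonneg (x - u), hx⟩
  have hpos : 0 < ‖x - u‖ := by
    refine (norm_nonneg _).lt_of_ne fun h => ?_
    rw [← h] at hxe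
    exact (hΓ 0 ⟨le_rfl, hx.trans_le' (norm_nonneg _)⟩).1 (by simpa using hxe)
  have h1 : φ < ψ := lt_of_le_of_ne hψ.1 fun h => h0.1 (by rw [h]; exact hxe)
  have h2 : ψ ≠ φ + α := fun h => h0.2 (by rw [← h]; exact hxe)
  rcases h2.lt_or_gt with h2 | h2
  · exact Or.inl ⟨_, ⟨hpos, hx⟩, ψ, ⟨h1, h2⟩, hxe⟩
  · exact Or.inr ⟨_, ⟨hpos, hx⟩, ψ, ⟨h2, by linarith [hψ.2]⟩, hxe⟩

lemma openSector_subset_ball (u : Plane) (r φ α : ℝ) :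
    openSector u r φ α ⊆ Metric.ball u r := by
  rintro _ ⟨ρ, hρ, ψ, hψ, rfl⟩
  rw [Metric.mem_ball, dist_eq_norm, add_sub_cancel_left, norm_smul_dir hρ.1.le]
  exact hρ.2

lemma disjoint (h : IsPolyCorner Γ u r φ α) : Disjoint (openSector u r φ α) Γ := by
  rw [Set.disjoint_left]
  intro x hx hΓ
  rw [h.mem_iff x (openSector_subset_ball _ _ _ _ hx)] at hΓ
  obtain ⟨ρ, hρ, ψ, hψ, rfl⟩ := hx
  have hl := h.lt
  have hp := h.pos
  obtain ⟨ρ', hρ', h' | h'⟩ := hΓ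
  · have := (smul_dir_inj (φ := φ) hρ.1 hρ'.1 ⟨hψ.1.le, by linarith [hψ.2]⟩
      ⟨le_rfl, by linarith⟩ (add_left_cancel h')).2
    linarith [hψ.1]
  · have := (smul_dir_inj (φ := φ) hρ.1 hρ'.1 ⟨hψ.1.le, by linarith [hψ.2]⟩
      ⟨by linarith, by linarith⟩ (add_left_cancel h')).2
    linarith [hψ.2]

lemma nonempty_openSector (h : IsPolyCorner Γ u r φ α) : (openSector u r φ α).Nonempty :=
  ⟨_, r / 2, ⟨by linarith [h.r_pos], by linarith [h.r_pos]⟩, φ + α / 2,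
    ⟨by linarith [h.pos], by linarith [h.pos]⟩, rfl⟩

/-- Both radii lie in the closure of the sector between them. -/
lemma sector_subset_closure (h : IsPolyCorner Γ u r φ α) :
    sector u r φ α ⊆ closure (openSector u r φ α) := by
  have e : closure (Ioo 0 r ×ˢ Ioo φ (φ + α)) = Icc 0 r ×ˢ Icc φ (φ + α) := by
    rw [closure_prod_eq, closure_Ioo h.r_pos.ne, closure_Ioo (by linarith [h.pos])]
  rintro x ⟨ρ, hρ, ψ, hψ, rfl⟩
  rw [openSector_eq_image]
  apply image_closure_subset_closure_image (continuous_polar u)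
  rw [e]
  exact ⟨(ρ, ψ), ⟨⟨hρ.1, hρ.2.le⟩, hψ⟩, rfl⟩

lemma inter_ball_subset_closure (h : IsPolyCorner Γ u r φ α) :
    Γ ∩ Metric.ball u r ⊆ closure (openSector u r φ α) := by
  rintro x ⟨hΓ, hx⟩
  apply h.sector_subset_closure
  obtain ⟨ρ, hρ, h' | h'⟩ := (h.mem_iff x hx).1 hΓ
  · exact ⟨ρ, hρ, φ, ⟨le_rfl, by linarith [h.pos]⟩, h'⟩
  · exact ⟨ρ, hρ, φ + α, ⟨by linarith [h.pos], le_rfl⟩, h'⟩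

lemma sector_eq (h : IsPolyCorner Γ u r φ α) :
    sector u r φ α = openSector u r φ α ∪ Γ ∩ Metric.ball u r := by
  apply subset_antisymm
  · rintro x ⟨ρ, hρ, ψ, hψ, hx⟩
    have hball : x ∈ Metric.ball u r := by
      rw [hx, Metric.mem_ball, dist_eq_norm, add_sub_cancel_left]
      have := norm_smul_dir hρ.1 ψ
      unfold dir at this
      rw [this]; exact hρ.2
    rcases hψ.1.lt_or_eq with h1 | h1
    · rcases hψ.2.lt_or_eq with h2 | h2
      · rcases hρ.1.lt_or_eq with h3 | h3
        · exact Or.inl ⟨ρ, ⟨h3, hρ.2⟩, ψ, ⟨h1, h2⟩, hx⟩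
        · refine Or.inr ⟨(h.mem_iff x hball).2 ⟨ρ, hρ, Or.inl ?_⟩, hball⟩
          rw [hx, ← h3, zero_smul, zero_smul]
      · exact Or.inr ⟨(h.mem_iff x hball).2 ⟨ρ, hρ, Or.inr (by rw [hx, h2]; rfl)⟩, hball⟩
    · exact Or.inr ⟨(h.mem_iff x hball).2 ⟨ρ, hρ, Or.inl (by rw [hx, h1]; rfl)⟩, hball⟩
  · rintro x (⟨ρ, hρ, ψ, hψ, hx⟩ | ⟨hΓ, hx⟩)
    · exact ⟨ρ, ⟨hρ.1.le, hρ.2⟩, ψ, ⟨hψ.1.le, hψ.2.le⟩, hx⟩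
    · obtain ⟨ρ, hρ, h' | h'⟩ := (h.mem_iff x hx).1 hΓ
      · exact ⟨ρ, hρ, φ, ⟨le_rfl, by linarith [h.pos]⟩, h'⟩
      · exact ⟨ρ, hρ, φ + α, ⟨by linarith [h.pos], le_rfl⟩, h'⟩

end IsPolyCorner

lemma mem_segment_smul_dir {u x : Plane} {ρ ψ r : ℝ} (hρ : 0 < ρ) (hr : r ≤ ρ)
    (hx : x ∈ Metric.ball u r) :
    x ∈ segment ℝ u (u + ρ • dir ψ) ↔ ∃ ρ' ∈ Ico 0 r, x = u + ρ' • dir ψ := by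
  rw [segment_eq_image']
  constructor
  · rintro ⟨t, ht, rfl⟩
    simp only [add_sub_cancel_left, smul_smul] at hx ⊢
    rw [Metric.mem_ball, dist_eq_norm, add_sub_cancel_left,
      norm_smul_dir (mul_nonneg ht.1 hρ.le)] at hx
    exact ⟨_, ⟨mul_nonneg ht.1 hρ.le, hx⟩, rfl⟩
  · rintro ⟨ρ', hρ', rfl⟩
    refine ⟨ρ' / ρ, ⟨div_nonneg hρ'.1 hρ.le, (div_le_one hρ).2 (hρ'.2.le.trans hr)⟩, ?_⟩
    simp only [add_sub_cancel_left, smul_smul]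
    rw [div_mul_cancel₀ _ hρ.ne']

/-- Every point of a simple closed polygonal line is a corner, possibly a straight one. -/
lemma IsSimpleLoop.exists_isPolyCorner {n : ℕ} {v : ℕ → Plane} (hv : IsSimpleLoop n v) {u : Plane}
    (hu : u ∈ pathSet n v) : ∃ r φ α, IsPolyCorner (pathSet n v) u r φ α := by
  obtain ⟨m, w, hw, hws, rfl, -⟩ := hv.exists_vertex_zero hu
  rw [← hws]
  obtain ⟨a, b, ha, hb, hab, r, hr, h⟩ := hw.exists_local
  obtain ⟨φ, -, ea⟩ := exists_dir 0 a
  obtain ⟨ψ, hψ, eb⟩ := exists_dir φ b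
  have ha' := norm_pos_iff.2 ha
  have hb' := norm_pos_iff.2 hb
  have hne : φ < ψ := by
    refine hψ.1.lt_of_ne ?_
    rintro rfl
    apply hab
    rw [ea, eb]
    exact (SameRay.sameRay_nonneg_smul_left _ ha'.le).nonneg_smul_right hb'.le
  set r' := min r (min ‖a‖ ‖b‖) with hr'
  have h1 : r' ≤ r := min_le_left _ _
  have h2 : r' ≤ ‖a‖ := (min_le_right _ _).trans (min_le_left _ _)
  have h3 : r' ≤ ‖b‖ := (min_le_right _ _).trans (min_le_right _ _)
  refine ⟨r', φ, ψ - φ, by positivity, by linarith, by linarith [hψ.2], fun x hx => ?_⟩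
  rw [h x (Metric.ball_subset_ball h1 hx), ea, eb, mem_segment_smul_dir ha' h2 hx,
    mem_segment_smul_dir hb' h3 hx, add_sub_cancel]
  constructor
  · rintro (⟨ρ, hρ, h⟩ | ⟨ρ, hρ, h⟩)
    · exact ⟨ρ, hρ, Or.inl h⟩
    · exact ⟨ρ, hρ, Or.inr h⟩
  · rintro ⟨ρ, hρ, h | h⟩
    · exact Or.inl ⟨ρ, hρ, h⟩
    · exact Or.inr ⟨ρ, hρ, h⟩

/-! ### Winding numbers -/

/-- The identification of the plane with `ℂ`. -/
noncomputable def toC : Plane →L[ℝ] ℂ :=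
  LinearMap.toContinuousLinearMap
    { toFun := fun p => ⟨p 0, p 1⟩
      map_add' := by intros; apply Complex.ext <;> simp
      map_smul' := by intros; apply Complex.ext <;> simp }

@[simp] lemma toC_re (p : Plane) : (toC p).re = p 0 := rfl
@[simp] lemma toC_im (p : Plane) : (toC p).im = p 1 := rfl

lemma toC_injective : Function.Injective toC := fun _ _ h =>
  plane_ext (congrArg Complex.re h) (congrArg Complex.im h)

/-- The angle in `(-π, π]` under which the segment from `a` to `b` is seen from `x`. -/
noncomputable def viewAngle (a b x : Plane) : ℝ :=
  ((toC b - toC x) / (toC a - toC x)).arg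

/-- `2π` times the winding number around `x` of a closed polygonal line. -/
noncomputable def winding (n : ℕ) (v : ℕ → Plane) (x : Plane) : ℝ :=
  ∑ i ∈ Finset.range n, viewAngle (v i) (v (i + 1)) x

/-- The quotient is a nonpositive real number only if `x` lies between `a` and `b`. -/
lemma div_mem_slitPlane {a b x : Plane} (hx : x ∉ segment ℝ a b) :
    (toC b - toC x) / (toC a - toC x) ∈ Complex.slitPlane := by
  have hax : toC a - toC x ≠ 0 := by
    rw [sub_ne_zero]
    intro h
    rw [← toC_injective h] at hx
    exact hx (left_mem_segment _ _ _)
  rw [Complex.mem_slitPlane_iff]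
  by_contra! h
  obtain ⟨hre, him⟩ := h
  set z := (toC b - toC x) / (toC a - toC x) with hz
  have hzr : z = ((z.re : ℝ) : ℂ) := Complex.ext rfl (by simp [him])
  have hzb : z * (toC a - toC x) = toC b - toC x := div_mul_cancel₀ _ hax
  set s := -z.re with hs
  have hs0 : 0 ≤ s := by linarith
  have h1 : (1 : ℝ) + s ≠ 0 := by positivity
  have hzr' : z = -(s : ℂ) := by rw [hzr, hs]; push_cast; ring
  apply hx
  refine ⟨s / (1 + s), 1 / (1 + s), by positivity, by positivity, by field_simp; ring, ?_⟩
  apply toC_injective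
  have h1' : (1 : ℂ) + s ≠ 0 := by exact_mod_cast h1
  rw [map_add, map_smul, map_smul, Complex.real_smul, Complex.real_smul]
  push_cast
  field_simp
  rw [hzr'] at hzb
  linear_combination -hzb

lemma continuousAt_viewAngle {a b x : Plane} (hx : x ∉ segment ℝ a b) :
    ContinuousAt (viewAngle a b) x := by
  have hax : toC a - toC x ≠ 0 := by
    rw [sub_ne_zero]
    intro h
    rw [← toC_injective h] at hx
    exact hx (left_mem_segment _ _ _)
  have h1 : ContinuousAt (fun x => (toC b - toC x) / (toC a - toC x)) x := by
    refine ContinuousAt.div ?_ ?_ hax <;> fun_prop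
  exact ContinuousAt.comp (f := fun x => (toC b - toC x) / (toC a - toC x))
    (Complex.continuousAt_arg (div_mem_slitPlane hx)) h1

lemma continuousOn_winding (n : ℕ) (v : ℕ → Plane) : ContinuousOn (winding n v) (pathSet n v)ᶜ := by
  intro x hx
  apply ContinuousAt.continuousWithinAt
  unfold winding
  refine tendsto_finsetSum _ fun i hi => continuousAt_viewAngle fun h => hx ?_
  exact mem_pathSet.2 ⟨i, Finset.mem_range.1 hi, h⟩

/-- The exponential of `I` times the sum of the angles is a telescoping product, up to a positive
factor. -/
lemma exists_winding_eq {n : ℕ} {v : ℕ → Plane} (hc : v n = v 0) {x : Plane}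
    (hx : x ∉ pathSet n v) : ∃ k : ℤ, winding n v x = k * (2 * Real.pi) := by
  have hne : ∀ i ≤ n, 0 < n → toC (v i) - toC x ≠ 0 := by
    intro i hi hn
    rw [sub_ne_zero]
    intro h
    have h := toC_injective h
    apply hx
    rcases hi.lt_or_eq with hi | rfl
    · exact mem_pathSet.2 ⟨i, hi, h ▸ left_mem_segment _ _ _⟩
    · exact mem_pathSet.2 ⟨0, hn, by rw [← h, hc]; exact left_mem_segment _ _ _⟩
  have key : ∀ m ≤ n, 0 < n → ∃ c : ℝ, 0 < c ∧
      toC (v m) - toC x = c * (toC (v 0) - toC x) *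
        Complex.exp ((∑ i ∈ Finset.range m, viewAngle (v i) (v (i + 1)) x : ℝ) * Complex.I) := by
    intro m
    induction m with
    | zero => intro _ _; exact ⟨1, one_pos, by simp⟩
    | succ m ih =>
      intro hm hn
      obtain ⟨c, hc0, hcm⟩ := ih (by omega) hn
      have h1 := hne m (by omega) hn
      have h2 := hne (m + 1) hm hn
      set z := (toC (v (m + 1)) - toC x) / (toC (v m) - toC x) with hz
      refine ⟨c * ‖z‖, mul_pos hc0 (norm_pos_iff.2 (div_ne_zero h2 h1)), ?_⟩
      have h3 : toC (v (m + 1)) - toC x = z * (toC (v m) - toC x) := (div_mul_cancel₀ _ h1).symm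
      have h4 : z = ‖z‖ * Complex.exp ((viewAngle (v m) (v (m + 1)) x : ℝ) * Complex.I) :=
        (Complex.norm_mul_exp_arg_mul_I z).symm
      rw [h3, hcm, Finset.sum_range_succ]
      nth_rw 1 [h4]
      push_cast
      rw [add_mul, Complex.exp_add]
      ring
  rcases Nat.eq_zero_or_pos n with rfl | hn
  · exact ⟨0, by simp [winding]⟩
  obtain ⟨c, hc0, h⟩ := key n le_rfl hn
  have h0 := hne 0 (by omega) hn
  rw [hc] at h
  change _ = _ * _ * Complex.exp ((winding n v x : ℝ) * Complex.I) at h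
  have h1 : (c : ℂ) * Complex.exp ((winding n v x : ℝ) * Complex.I) = 1 := by
    apply mul_right_cancel₀ h0
    rw [one_mul]; nth_rw 2 [h]; ring
  have hc1 : c = 1 := by
    have := congrArg norm h1
    rw [norm_mul, Complex.norm_exp_ofReal_mul_I, Complex.norm_real, Real.norm_of_nonneg hc0.le,
      mul_one, norm_one] at this
    exact this
  rw [hc1, Complex.ofReal_one, one_mul, Complex.exp_eq_one_iff] at h1
  obtain ⟨k, hk⟩ := h1
  refine ⟨k, ?_⟩
  have h2 : ((winding n v x : ℝ) : ℂ) = ((k * (2 * Real.pi) : ℝ) : ℂ) := by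
    apply mul_right_cancel₀ Complex.I_ne_zero
    rw [hk]; push_cast; ring
  exact_mod_cast h2

/-- The winding number vanishes far away, as all vertices lie on one side of the point. -/
lemma winding_eq_zero {n : ℕ} {v : ℕ → Plane} (hc : v n = v 0) {R : ℝ} {x : Plane}
    (hR : ∀ i ≤ n, ‖v i‖ < R) (hx : R ≤ ‖x‖) : winding n v x = 0 := by
  have hx0 : toC x ≠ 0 := by
    intro h
    have hx' : x = 0 := toC_injective (by rw [h, map_zero])
    have := (norm_nonneg _).trans_lt (hR 0 (by omega))
    rw [hx', norm_zero] at hx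
    linarith
  -- the argument of `v i - x`, relative to the direction from `x` to the origin
  set A : ℕ → ℝ := fun i => ((toC (v i) - toC x) / (-toC x)).arg with hA
  have hnx : 0 < Complex.normSq (toC x) := Complex.normSq_pos.2 hx0
  have hre : ∀ i ≤ n, 0 < ((toC (v i) - toC x) / (-toC x)).re := by
    intro i hi
    have h1 := (hR i hi).trans_le hx
    have h2 : (inner ℝ (v i) x : ℝ) < ‖x‖ ^ 2 := by
      have := real_inner_le_norm (v i) x
      nlinarith [norm_nonneg (v i), norm_nonneg x]
    rw [plane_inner, plane_norm_sq] at h2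
    rw [Complex.div_re, Complex.normSq_neg]
    simp only [Complex.sub_re, Complex.sub_im, Complex.neg_re, Complex.neg_im, toC_re, toC_im]
    rw [← add_div]
    apply div_pos _ hnx
    nlinarith
  have hlt : ∀ i ≤ n, |A i| < Real.pi / 2 := fun i hi =>
    Complex.abs_arg_lt_pi_div_two_iff.2 (Or.inl (hre i hi))
  have hz : ∀ i ≤ n, (toC (v i) - toC x) / (-toC x) ≠ 0 := fun i hi h => by
    have := hre i hi
    rw [h] at this
    simp at this
  have hterm : ∀ i < n, viewAngle (v i) (v (i + 1)) x = A (i + 1) - A i := by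
    intro i hi
    have h1 := abs_lt.1 (hlt i hi.le)
    have h2 := abs_lt.1 (hlt (i + 1) hi)
    have h3 : (((toC (v i) - toC x) / (-toC x))⁻¹).arg = -A i := by
      rw [Complex.arg_inv, if_neg]
      intro h
      change A i = _ at h
      linarith [Real.pi_pos]
    have h4 : (toC (v (i + 1)) - toC x) / (toC (v i) - toC x) =
        (toC (v (i + 1)) - toC x) / (-toC x) * ((toC (v i) - toC x) / (-toC x))⁻¹ := by
      have := hz i hi.le
      have h5 : toC (v i) - toC x ≠ 0 := fun h => this (by rw [h, zero_div])
      field_simp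
    unfold viewAngle
    rw [h4, Complex.arg_mul (hz _ hi) (inv_ne_zero (hz i hi.le)), h3]
    · rfl
    · rw [h3]
      change A (i + 1) + _ ∈ _
      constructor <;> linarith
  unfold winding
  rw [Finset.sum_congr rfl fun i hi => hterm i (Finset.mem_range.1 hi), Finset.sum_range_sub]
  simp only [hA, hc, sub_self]

open Filter Topology in
/-- The view angle of a segment jumps by `2π` across its midpoint. -/
lemma tendsto_viewAngle_midpoint {a d : Plane} (hd : d ≠ 0) :
    Tendsto (fun s : ℝ => viewAngle (a - d) (a + d) (a + s • !₂[-d 1, d 0])) (𝓝[>] 0) (𝓝 Real.pi) ∧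
    Tendsto (fun s : ℝ => viewAngle (a - d) (a + d) (a + s • !₂[-d 1, d 0])) (𝓝[<] 0)
      (𝓝 (-Real.pi)) := by
  have hd' : toC d ≠ 0 := fun h => hd (toC_injective (by rw [h, map_zero]))
  -- the quotient `(b - x) / (a - x)` for the given points, which tends to `-1` from both sides
  set f : ℝ → ℂ := fun s => -(1 - s * Complex.I) ^ 2 / (1 + s ^ 2) with hf
  have hN : toC !₂[-d 1, d 0] = Complex.I * toC d := by
    apply Complex.ext <;> simp
  have hpos : ∀ s : ℝ, (1 : ℝ) + s ^ 2 ≠ 0 := fun s => by positivity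
  have hpos' : ∀ s : ℝ, (1 : ℂ) + s ^ 2 ≠ 0 := fun s => by exact_mod_cast hpos s
  have hv : ∀ s : ℝ, viewAngle (a - d) (a + d) (a + s • !₂[-d 1, d 0]) = (f s).arg := by
    intro s
    unfold viewAngle
    congr 1
    simp only [map_add, map_sub, map_smul, hN, Complex.real_smul, hf]
    have h1 : toC a - toC d - (toC a + s * (Complex.I * toC d)) = -(1 + s * Complex.I) * toC d := by
      ring
    have h2 : toC a + toC d - (toC a + s * (Complex.I * toC d)) = (1 - s * Complex.I) * toC d := by
      ring
    have h3 : (1 + (s : ℂ) ^ 2) = (1 + s * Complex.I) * (1 - s * Complex.I) := by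
      linear_combination ((s : ℂ) ^ 2) * Complex.I_sq
    have h4 := hpos' s
    rw [h3] at h4 ⊢
    have h5 := left_ne_zero_of_mul h4
    have h6 := right_ne_zero_of_mul h4
    rw [h1, h2]
    field_simp
  have hfc : Continuous f := by
    refine Continuous.div (by fun_prop) (by fun_prop) hpos'
  have hf0 : f 0 = -1 := by simp [hf]
  have him : ∀ s : ℝ, (f s).im = 2 * s / (1 + s ^ 2) := by
    intro s
    have : f s = ((-(1 - s ^ 2) / (1 + s ^ 2) : ℝ) : ℂ) + ((2 * s / (1 + s ^ 2) : ℝ) : ℂ) * Complex.I := by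
      simp only [hf]
      push_cast
      have := hpos' s
      field_simp
      linear_combination (-(s : ℂ) ^ 2) * Complex.I_sq
    rw [this]
    simp only [Complex.add_im, Complex.ofReal_im, Complex.mul_im, Complex.ofReal_re, Complex.I_im,
      Complex.I_re]
    ring
  have hre : (f 0).re < 0 := by rw [hf0]; simp
  have him0 : (f 0).im = 0 := by rw [hf0]; simp
  simp only [hv]
  constructor
  · refine (Complex.tendsto_arg_nhdsWithin_im_nonneg_of_re_neg_of_im_zero hre him0).comp ?_
    refine tendsto_nhdsWithin_iff.2 ⟨hfc.continuousAt.tendsto.mono_left nhdsWithin_le_nhds, ?_⟩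
    filter_upwards [self_mem_nhdsWithin] with s hs
    have hs : 0 < s := hs
    change 0 ≤ (f s).im
    rw [him]; positivity
  · refine (Complex.tendsto_arg_nhdsWithin_im_neg_of_re_neg_of_im_zero hre him0).comp ?_
    refine tendsto_nhdsWithin_iff.2 ⟨hfc.continuousAt.tendsto.mono_left nhdsWithin_le_nhds, ?_⟩
    filter_upwards [self_mem_nhdsWithin] with s hs
    have hs : s < 0 := hs
    change (f s).im < 0
    rw [him]
    apply div_neg_of_neg_of_pos (by linarith) (by positivity)

open Filter Topology in
/-- The winding number cannot vanish on both sides of an edge: at the midpoint of the edge, the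
contribution of the edge jumps by `2π` while those of the other edges are continuous. -/
lemma IsSimpleLoop.exists_winding_ne_zero {n : ℕ} {v : ℕ → Plane} (hv : IsSimpleLoop n v) :
    ∃ x ∉ pathSet n v, winding n v x ≠ 0 := by
  by_contra! hcon
  obtain ⟨m, rfl⟩ := Nat.exists_eq_succ_of_ne_zero hv.pos.ne'
  have hne := hv.ne 0 hv.pos
  set d : Plane := (1 / 2 : ℝ) • (v 1 - v 0) with hd
  set a : Plane := (1 / 2 : ℝ) • (v 0 + v 1) with ha
  have hd0 : d ≠ 0 := smul_ne_zero (by norm_num) (sub_ne_zero.2 hne.symm)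
  have e0 : v 0 = a - d := by rw [ha, hd]; module
  have e1 : v 1 = a + d := by rw [ha, hd]; module
  set N : Plane := !₂[-d 1, d 0] with hN
  have haseg : a ∈ hoSeg (v 0) (v (0 + 1)) :=
    ⟨1 / 2, by norm_num, by rw [AffineMap.lineMap_apply_module', ha]; module⟩
  have hother : ∀ i ∈ Finset.range m, a ∉ segment ℝ (v (i + 1)) (v (i + 1 + 1)) := by
    intro i hi h
    rw [Finset.mem_range] at hi
    rw [segment_eq_hoSeg_union] at h
    rcases h with h | h
    · exact absurd (hv.eq_of_mem hv.pos (by omega) haseg h) (by omega)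
    · rcases (show i + 1 + 1 < m + 1 ∨ i + 1 + 1 = m + 1 by omega) with h' | h'
      · have h : a = v (i + 1 + 1) := h
        have h2 : a ∈ hoSeg (v (i + 1 + 1)) (v (i + 1 + 1 + 1)) := by
          rw [h]; exact left_mem_hoSeg _ _
        exact absurd (hv.eq_of_mem hv.pos h' haseg h2) (by omega)
      · have hcl : v (m + 1) = v 0 := hv.closed
        have h : a = v (i + 1 + 1) := h
        rw [h', hcl, e0] at h
        exact hd0 (sub_eq_self.1 h.symm)
  -- the normal line through the midpoint
  set g : ℝ → Plane := fun s => a + s • N with hg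
  have hgc : Continuous g := by fun_prop
  have hg0 : g 0 = a := by simp [hg]
  set rest : Plane → ℝ := fun x => ∑ i ∈ Finset.range m, viewAngle (v (i + 1)) (v (i + 1 + 1)) x
    with hrest
  have hrc : ContinuousAt rest a :=
    tendsto_finsetSum _ fun i hi => continuousAt_viewAngle (hother i hi)
  have hrg : Tendsto (fun s => rest (g s)) (𝓝 0) (𝓝 (rest a)) := by
    have : ContinuousAt rest (g 0) := by rw [hg0]; exact hrc
    have := this.comp hgc.continuousAt
    have h2 := this.tendsto
    simp only [Function.comp_apply, hg0] at h2
    exact h2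
  have hoff : ∀ᶠ s in 𝓝[≠] (0 : ℝ), g s ∉ pathSet (m + 1) v := by
    have h1 : ∀ᶠ s in 𝓝 (0 : ℝ), ∀ i ∈ Finset.range m, g s ∉ segment ℝ (v (i + 1)) (v (i + 1 + 1)) := by
      rw [Finset.eventually_all]
      intro i hi
      have hcl : IsClosed (segment ℝ (v (i + 1)) (v (i + 1 + 1))) := by
        rw [segment_eq_image_lineMap]
        exact (isCompact_Icc.image AffineMap.lineMap_continuous).isClosed
      refine hgc.continuousAt.eventually (hcl.isOpen_compl.mem_nhds ?_)
      rw [hg0]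
      exact hother i hi
    filter_upwards [h1.filter_mono nhdsWithin_le_nhds, self_mem_nhdsWithin] with s hs hs0 hmem
    obtain ⟨i, hi, hx⟩ := mem_pathSet.1 hmem
    rcases Nat.eq_zero_or_pos i with rfl | hi0
    · rw [zero_add, e0, e1, segment_eq_image'] at hx
      obtain ⟨t, -, ht⟩ := hx
      have h3 : (2 * t - 1) • d = s • N := by
        have : a - d + t • (a + d - (a - d)) = a + s • N := ht
        have h4 : a - d + t • (a + d - (a - d)) = a + (2 * t - 1) • d := by module
        rw [h4] at this
        exact add_left_cancel this
      have h5 : (s : ℝ) * ‖d‖ ^ 2 = 0 := by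
        have c0 := congrArg (fun p : Plane => p 0) h3
        have c1 := congrArg (fun p : Plane => p 1) h3
        simp [hN] at c0 c1
        rw [plane_norm_sq]
        linear_combination d 1 * c0 - d 0 * c1
      rcases mul_eq_zero.1 h5 with h6 | h6
      · exact hs0 h6
      · exact hd0 (by simpa using h6)
    · obtain ⟨j, rfl⟩ := Nat.exists_eq_succ_of_ne_zero hi0.ne'
      exact hs j (Finset.mem_range.2 (by omega)) hx
  have hval : ∀ᶠ s in 𝓝[≠] (0 : ℝ), viewAngle (a - d) (a + d) (g s) = -rest (g s) := by
    filter_upwards [hoff] with s hs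
    have := hcon _ hs
    unfold winding at this
    rw [Finset.sum_range_succ', zero_add, e0, e1] at this
    simp only [hrest]
    linarith
  obtain ⟨t1, t2⟩ := tendsto_viewAngle_midpoint (a := a) hd0
  have hgt : 𝓝[>] (0 : ℝ) ≤ 𝓝[≠] 0 := nhdsWithin_mono _ fun x hx => ne_of_gt hx
  have hlt : 𝓝[<] (0 : ℝ) ≤ 𝓝[≠] 0 := nhdsWithin_mono _ fun x hx => ne_of_lt hx
  have u1 := tendsto_nhds_unique (t1.congr' (hval.filter_mono hgt))
    (hrg.neg.mono_left nhdsWithin_le_nhds)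
  have u2 := tendsto_nhds_unique (t2.congr' (hval.filter_mono hlt))
    (hrg.neg.mono_left nhdsWithin_le_nhds)
  linarith [Real.pi_pos]

/-! ### The Jordan curve theorem for polygonal lines -/

/-- A continuous function with values in `2π ℤ` is constant on connected sets. -/
lemma winding_eq_of_isPreconnected {n : ℕ} {v : ℕ → Plane} (hc : v n = v 0) {C : Set Plane}
    (hC : IsPreconnected C) (hCΓ : C ⊆ (pathSet n v)ᶜ) {x y : Plane} (hx : x ∈ C) (hy : y ∈ C) :
    winding n v x = winding n v y := by
  wlog hlt : winding n v x < winding n v y generalizing x y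
  · rcases lt_trichotomy (winding n v x) (winding n v y) with h | h | h
    · exact absurd h hlt
    · exact h
    · exact (this hy hx h).symm
  exfalso
  have hI := (hC.image _ ((continuousOn_winding n v).mono hCΓ)).Icc_subset
    (mem_image_of_mem _ hx) (mem_image_of_mem _ hy)
  obtain ⟨k, hk⟩ := exists_winding_eq hc (hCΓ hx)
  obtain ⟨l, hl⟩ := exists_winding_eq hc (hCΓ hy)
  have hpi := Real.pi_pos
  have hkl : k < l := by
    rw [hk, hl] at hlt
    exact_mod_cast lt_of_mul_lt_mul_right hlt (by positivity)
  have hkl' : (k : ℝ) + 1 ≤ l := by exact_mod_cast hkl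
  obtain ⟨z, hz, hzv⟩ := hI (show winding n v x + Real.pi ∈ _ from ⟨by linarith, by
    rw [hk, hl]; nlinarith⟩)
  obtain ⟨m, hm⟩ := exists_winding_eq hc (hCΓ hz)
  rw [hzv, hk] at hm
  have h1 : (2 * k + 1 : ℝ) = 2 * m := by
    apply mul_right_cancel₀ hpi.ne'
    linarith
  have h2 : 2 * k + 1 = 2 * m := by exact_mod_cast h1
  omega

lemma isPreconnected_norm_ge (R : ℝ) : IsPreconnected {x : Plane | R ≤ ‖x‖} := by
  have : {x : Plane | R ≤ ‖x‖} =
      (fun p : ℝ × ℝ => (0 : Plane) + p.1 • dir p.2) '' (Ici (max R 0) ×ˢ univ) := by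
    ext x
    simp only [mem_ofPred_eq, mem_image, mem_prod, mem_Ici, mem_univ, and_true, zero_add,
      Prod.exists]
    constructor
    · intro h
      obtain ⟨ψ, -, hψ⟩ := exists_dir 0 x
      exact ⟨‖x‖, ψ, max_le h (norm_nonneg _), hψ.symm⟩
    · rintro ⟨ρ, ψ, hρ, rfl⟩
      rw [norm_smul_dir ((le_max_right _ _).trans hρ)]
      exact (le_max_left _ _).trans hρ
  rw [this]
  exact (isPreconnected_Ici.prod isPreconnected_univ).image _ (continuous_polar 0).continuousOn

section Component

variable {Γ : Set Plane}

lemma closure_component_inter {x : Plane} :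
    closure (connectedComponentIn Γᶜ x) ∩ Γᶜ ⊆ connectedComponentIn Γᶜ x := by
  rintro y ⟨hy, hyΓ⟩
  by_cases hx : x ∈ Γᶜ
  swap
  · rw [connectedComponentIn_eq_empty hx] at hy
    simp at hy
  have h1 : IsPreconnected (insert y (connectedComponentIn Γᶜ x)) :=
    isPreconnected_connectedComponentIn.subset_closure (subset_insert _ _)
      (insert_subset hy subset_closure)
  exact h1.subset_connectedComponentIn (mem_insert_of_mem _ (mem_connectedComponentIn hx))
    (insert_subset hyΓ (connectedComponentIn_subset _ _)) (mem_insert _ _)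

/-- A component of the complement that touches a corner contains one of the two sectors there. -/
lemma openSector_subset_component {x u : Plane} {r φ α : ℝ} (hc : IsPolyCorner Γ u r φ α)
    (hu : u ∈ closure (connectedComponentIn Γᶜ x)) :
    openSector u r φ α ⊆ connectedComponentIn Γᶜ x ∨
      openSector u r (φ + α) (2 * Real.pi - α) ⊆ connectedComponentIn Γᶜ x := by
  obtain ⟨y, hyb, hy⟩ := mem_closure_iff.1 hu _ Metric.isOpen_ball (Metric.mem_ball_self hc.r_pos)
  have hyΓ := connectedComponentIn_subset _ _ hy
  rw [connectedComponentIn_eq hy]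
  refine (hc.mem_openSector_or hyb hyΓ).imp (fun h => ?_) fun h => ?_
  · exact (isPreconnected_openSector _ _ _ _).subset_connectedComponentIn h
      hc.disjoint.subset_compl_right
  · exact (isPreconnected_openSector _ _ _ _).subset_connectedComponentIn h
      hc.swap.disjoint.subset_compl_right

/-- If all points of a connected closed set are corners, then each component of the
complement touches the whole set, as the set of touching points is open and closed. -/
lemma subset_closure_component (hΓc : IsClosed Γ) (hΓp : IsPreconnected Γ) (hne : Γ.Nonempty)
    (hcor : ∀ u ∈ Γ, ∃ r φ α, IsPolyCorner Γ u r φ α) {x : Plane} (hx : x ∉ Γ) :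
    Γ ⊆ closure (connectedComponentIn Γᶜ x) := by
  set C := connectedComponentIn Γᶜ x with hC
  have hxC : x ∈ C := mem_connectedComponentIn hx
  have hCo : IsOpen C := hΓc.isOpen_compl.connectedComponentIn
  have hmeet : (Γ ∩ closure C).Nonempty := by
    by_contra hemp
    rw [not_nonempty_iff_eq_empty] at hemp
    have hcl : IsClosed C := by
      apply isClosed_of_closure_subset
      intro y hy
      refine closure_component_inter ⟨hy, fun hyΓ => ?_⟩
      have : y ∈ Γ ∩ closure C := ⟨hyΓ, hy⟩
      rw [hemp] at this
      exact this
    have huniv : C = univ := IsClopen.eq_univ ⟨hcl, hCo⟩ ⟨x, hxC⟩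
    obtain ⟨y, hy⟩ := hne
    exact connectedComponentIn_subset _ _ (huniv ▸ mem_univ y : y ∈ C) hy
  choose! r φ α h using hcor
  have hsub : ∀ u ∈ Γ ∩ closure C, Γ ∩ Metric.ball u (r u) ⊆ closure C := by
    rintro u ⟨hu, huC⟩
    rcases openSector_subset_component (h u hu) huC with hs | hs
    · exact (h u hu).inter_ball_subset_closure.trans (closure_mono hs)
    · exact (h u hu).swap.inter_ball_subset_closure.trans (closure_mono hs)
  by_contra hnot
  rw [not_subset] at hnot
  obtain ⟨y, hy, hyC⟩ := hnot
  have ho1 : IsOpen (⋃ u ∈ Γ ∩ closure C, Metric.ball u (r u)) :=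
    isOpen_biUnion fun _ _ => Metric.isOpen_ball
  obtain ⟨z, hz, hz1, hz2⟩ := hΓp _ _ ho1 (isClosed_closure (s := C)).isOpen_compl (by
      intro u hu
      by_cases huC : u ∈ closure C
      · exact Or.inl (mem_biUnion (⟨hu, huC⟩ : u ∈ Γ ∩ closure C)
          (Metric.mem_ball_self (h u hu).r_pos))
      · exact Or.inr huC)
    (by
      obtain ⟨u, hu, huC⟩ := hmeet
      exact ⟨u, hu, mem_biUnion (⟨hu, huC⟩ : u ∈ Γ ∩ closure C)
        (Metric.mem_ball_self (h u hu).r_pos)⟩) ⟨y, hy, hyC⟩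
  simp only [mem_iUnion] at hz1
  obtain ⟨u, hu, hzu⟩ := hz1
  exact hz2 (hsub u hu ⟨hz, hzu⟩)

end Component

/-- The conclusion of the Jordan curve theorem, phrased for the closed region `P` enclosed by a
curve: the curve is the boundary of `P`. -/
structure IsJordanRegion (P : Set Plane) : Prop where
  isCompact : IsCompact P
  nonempty : (interior P).Nonempty
  isPreconnected_interior : IsPreconnected (interior P)
  isPreconnected_compl : IsPreconnected Pᶜ
  closure_interior : closure (interior P) = P

/-- The Jordan curve theorem for polygonal lines. -/
theorem IsSimpleLoop.isJordanRegion {n : ℕ} {v : ℕ → Plane} (hv : IsSimpleLoop n v) :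
    IsJordanRegion (enclosedRegion (pathSet n v)) ∧
      frontier (enclosedRegion (pathSet n v)) = pathSet n v := by
  set Γ := pathSet n v with hΓ
  have hcomp : IsCompact Γ := isCompact_pathSet n v
  have hcl : IsClosed Γ := hcomp.isClosed
  have hpre : IsPreconnected Γ := isPreconnected_pathSet n v
  have hvm : ∀ i ≤ n, v i ∈ Γ := by
    intro i hi
    rcases hi.lt_or_eq with hi | rfl
    · exact mem_pathSet.2 ⟨i, hi, left_mem_segment _ _ _⟩
    · rw [hv.closed]; exact mem_pathSet.2 ⟨0, hv.pos, left_mem_segment _ _ _⟩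
  have hne : Γ.Nonempty := ⟨_, hvm 0 hv.pos.le⟩
  obtain ⟨R, hR⟩ := hcomp.isBounded.subset_ball 0
  have hRn : ∀ y ∈ Γ, ‖y‖ < R := fun y hy => by simpa using hR hy
  have hR0 : 0 < R := (norm_nonneg _).trans_lt (hRn _ (hvm 0 hv.pos.le))
  set F : Set Plane := {x | R ≤ ‖x‖} with hF
  have hFΓ : F ⊆ Γᶜ := fun x (hx : R ≤ ‖x‖) hxΓ => (hRn x hxΓ).not_ge hx
  have hinf : R • dir 0 ∈ F := by
    change R ≤ ‖R • dir 0‖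
    rw [norm_smul_dir hR0.le]
  -- the unbounded component
  set U := connectedComponentIn Γᶜ (R • dir 0) with hU
  have hFU : F ⊆ U := (isPreconnected_norm_ge R).subset_connectedComponentIn hinf hFΓ
  obtain ⟨x₀, hx₀, hw⟩ := hv.exists_winding_ne_zero
  -- the component of a point with nonzero winding number
  set B := connectedComponentIn Γᶜ x₀ with hB
  have hx₀B : x₀ ∈ B := mem_connectedComponentIn hx₀
  have hx₀U : x₀ ∉ U := by
    intro h
    apply hw
    rw [winding_eq_of_isPreconnected hv.closed isPreconnected_connectedComponentIn
      (connectedComponentIn_subset _ _) h (hFU hinf)]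
    exact winding_eq_zero hv.closed (fun i hi => hRn _ (hvm i hi)) hinf
  have hBU : Disjoint B U := by
    rw [Set.disjoint_left]
    intro y hyB hyU
    rw [hB, connectedComponentIn_eq hyB, ← connectedComponentIn_eq hyU] at hx₀B
    exact hx₀U hx₀B
  have htouch : ∀ x ∉ Γ, Γ ⊆ closure (connectedComponentIn Γᶜ x) := fun x hx =>
    subset_closure_component hcl hpre hne (fun u hu => hv.exists_isPolyCorner hu) hx
  have hBo : IsOpen B := hcl.isOpen_compl.connectedComponentIn
  have hUo : IsOpen U := hcl.isOpen_compl.connectedComponentIn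
  -- three components would have to share the two sectors at a vertex
  have hcover : Γᶜ ⊆ B ∪ U := by
    intro x hx
    have hu := hvm 0 hv.pos.le
    obtain ⟨r, φ, α, hc⟩ := hv.exists_isPolyCorner hu
    obtain ⟨y, hy⟩ := hc.nonempty_openSector
    obtain ⟨z, hz⟩ := hc.swap.nonempty_openSector
    -- two components containing a common point agree
    have key : ∀ x x' y, y ∈ connectedComponentIn Γᶜ x → y ∈ connectedComponentIn Γᶜ x' → x ∈ Γᶜ →
        x ∈ connectedComponentIn Γᶜ x' := by
      intro x x' y h h' hx
      rw [connectedComponentIn_eq h', ← connectedComponentIn_eq h]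
      exact mem_connectedComponentIn hx
    rcases openSector_subset_component hc (htouch x hx hu) with h1 | h1 <;>
    rcases openSector_subset_component hc (htouch x₀ hx₀ hu) with h2 | h2 <;>
    rcases openSector_subset_component hc (htouch _ (hFΓ hinf) hu) with h3 | h3
    · exact Or.inl (key x x₀ y (h1 hy) (h2 hy) hx)
    · exact Or.inl (key x x₀ y (h1 hy) (h2 hy) hx)
    · exact Or.inr (key x _ y (h1 hy) (h3 hy) hx)
    · exact absurd (key x₀ _ z (h2 hz) (h3 hz) hx₀) hx₀U
    · exact absurd (key x₀ _ y (h2 hy) (h3 hy) hx₀) hx₀U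
    · exact Or.inr (key x _ z (h1 hz) (h3 hz) hx)
    · exact Or.inl (key x x₀ z (h1 hz) (h2 hz) hx)
    · exact Or.inl (key x x₀ z (h1 hz) (h2 hz) hx)
  have hBb : Bornology.IsBounded B := by
    refine (Metric.isBounded_ball (x := (0 : Plane)) (r := R)).subset fun x hx => ?_
    rw [mem_ball_zero_iff]
    by_contra h
    exact Set.disjoint_left.1 hBU hx (hFU (not_lt.1 h))
  have hUb : ¬ Bornology.IsBounded U := by
    intro h
    obtain ⟨M, hM⟩ := h.subset_ball 0
    have h1 : (max R M) • dir 0 ∈ F := by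
      change R ≤ ‖_‖
      rw [norm_smul_dir (hR0.le.trans (le_max_left _ _))]
      exact le_max_left _ _
    have h2 := hM (hFU h1)
    rw [mem_ball_zero_iff, norm_smul_dir (hR0.le.trans (le_max_left _ _))] at h2
    exact (le_max_right R M).not_gt h2
  have hreg : enclosedRegion Γ = Γ ∪ B := by
    unfold enclosedRegion
    congr 1
    ext x
    constructor
    · rintro ⟨hx, hb⟩
      rcases hcover hx with h | h
      · exact h
      · rw [← connectedComponentIn_eq h] at hb
        exact absurd hb hUb
    · intro h
      refine ⟨connectedComponentIn_subset _ _ h, ?_⟩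
      rw [← connectedComponentIn_eq h]
      exact hBb
  have hBΓ : B ⊆ Γᶜ := connectedComponentIn_subset _ _
  have hUΓ : U ⊆ Γᶜ := connectedComponentIn_subset _ _
  have hcompl : (Γ ∪ B)ᶜ = U := by
    ext x
    constructor
    · intro hx
      rw [mem_compl_iff, mem_union, not_or] at hx
      exact (hcover hx.1).resolve_left hx.2
    · rintro hx (h | h)
      · exact hUΓ hx h
      · exact Set.disjoint_left.1 hBU h hx
  have hclosed : IsClosed (Γ ∪ B) := by
    rw [← isOpen_compl_iff, hcompl]; exact hUo
  have hΓU : Γ ⊆ closure U := htouch _ (hFΓ hinf)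
  have hint : interior (Γ ∪ B) = B := by
    apply subset_antisymm
    · intro x hx
      rcases interior_subset hx with h | h
      · obtain ⟨y, hy, hyU⟩ := mem_closure_iff.1 (hΓU h) _ isOpen_interior hx
        rw [← hcompl] at hyU
        exact absurd (interior_subset hy) hyU
      · exact h
    · exact interior_maximal subset_union_right hBo
  have hclB : closure B = Γ ∪ B := by
    apply subset_antisymm
    · exact closure_minimal subset_union_right hclosed
    · exact union_subset (htouch x₀ hx₀) subset_closure
  rw [hreg]
  refine ⟨⟨?_, ?_, ?_, ?_, ?_⟩, ?_⟩
  · exact Metric.isCompact_of_isClosed_isBounded hclosed (hcomp.isBounded.union hBb)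
  · rw [hint]; exact ⟨x₀, hx₀B⟩
  · rw [hint]; exact isPreconnected_connectedComponentIn
  · rw [hcompl]; exact isPreconnected_connectedComponentIn
  · rw [hint, hclB]
  · rw [frontier, hclosed.closure_eq, hint, union_sdiff_right]
    exact sdiff_eq_left.2 (Set.disjoint_left.2 fun x hx hxB => hBΓ hxB hx)

lemma IsPolygon.exists_loop {P : Set Plane} (hP : IsPolygon P) :
    ∃ n v, IsSimpleLoop n v ∧ frontier P = pathSet n v := by
  obtain ⟨n, v, hv, rfl⟩ := isPolygon_iff.1 hP
  exact ⟨n, v, hv, hv.isJordanRegion.2⟩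

lemma IsPolygon.isJordanRegion {P : Set Plane} (hP : IsPolygon P) : IsJordanRegion P := by
  obtain ⟨n, v, hv, rfl⟩ := isPolygon_iff.1 hP
  exact hv.isJordanRegion.1

/-- Every simple closed polygonal line is the boundary of a polygon. -/
lemma IsSimpleLoop.exists_isPolygon {n : ℕ} {v : ℕ → Plane} (hv : IsSimpleLoop n v) :
    ∃ P, IsPolygon P ∧ frontier P = pathSet n v :=
  ⟨_, isPolygon_iff.2 ⟨n, v, hv, rfl⟩, hv.isJordanRegion.2⟩

namespace IsJordanRegion

variable {P : Set Plane}

lemma isClosed (h : IsJordanRegion P) : IsClosed P := h.isCompact.isClosed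

lemma frontier_subset (h : IsJordanRegion P) : frontier P ⊆ P := h.isClosed.frontier_subset

lemma mem_frontier (h : IsJordanRegion P) {x : Plane} :
    x ∈ frontier P ↔ x ∈ P ∧ x ∉ interior P := by
  rw [h.isClosed.frontier_eq]; rfl

lemma compl_frontier (h : IsJordanRegion P) : (frontier P)ᶜ = interior P ∪ Pᶜ := by
  ext x
  rw [mem_compl_iff, h.mem_frontier, mem_union, mem_compl_iff]
  have : x ∈ interior P → x ∈ P := fun h => interior_subset h
  tauto

lemma not_isBounded_compl (h : IsJordanRegion P) : ¬ Bornology.IsBounded Pᶜ := by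
  intro hb
  have := h.isCompact.isBounded.union hb
  rw [union_compl_self] at this
  obtain ⟨M, hM⟩ := this.subset_ball 0
  have h1 := hM (mem_univ ((max 0 M) • dir 0))
  rw [mem_ball_zero_iff, norm_smul_dir (le_max_left _ _)] at h1
  exact (le_max_right 0 M).not_gt h1

/-- A connected set avoiding the boundary lies inside or outside. -/
lemma subset_or_subset (h : IsJordanRegion P) {C : Set Plane} (hC : IsPreconnected C)
    (hd : Disjoint C (frontier P)) : C ⊆ interior P ∨ C ⊆ Pᶜ := by
  refine hC.subset_or_subset isOpen_interior h.isClosed.isOpen_compl ?_ ?_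
  · exact disjoint_compl_right.mono_left interior_subset
  · rw [← h.compl_frontier]; exact hd.subset_compl_right

end IsJordanRegion

/-! ### Cutting polygons along chords -/

/-- The chord from `p` to `q`, whose interior lies in the interior of the polygon `P`, cuts `P`
into the polygons `Q₁` and `Q₂`. -/
structure IsChordCut (P : Set Plane) (p q : Plane) (Q₁ Q₂ : Set Plane) : Prop where
  left_mem : p ∈ frontier P
  right_mem : q ∈ frontier P
  ne : p ≠ q
  openSegment_subset : openSegment ℝ p q ⊆ interior P
  isPolygon₁ : IsPolygon Q₁
  isPolygon₂ : IsPolygon Q₂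
  union_eq : P = Q₁ ∪ Q₂
  inter_eq : segment ℝ p q = Q₁ ∩ Q₂
  interior_eq : interior P = interior Q₁ ∪ interior Q₂ ∪ openSegment ℝ p q
  frontier_subset₁ : frontier Q₁ ⊆ frontier P ∪ openSegment ℝ p q
  frontier_subset₂ : frontier Q₂ ⊆ frontier P ∪ openSegment ℝ p q
  subset_frontier₁ : segment ℝ p q ⊆ frontier Q₁
  subset_frontier₂ : segment ℝ p q ⊆ frontier Q₂

lemma segment_eq_pair_union {p q : Plane} : segment ℝ p q = {p, q} ∪ openSegment ℝ p q := by
  rw [← insert_endpoints_openSegment]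
  ext x; simp only [mem_insert_iff, mem_union, mem_singleton_iff]; tauto

lemma convex_halfDisc (m N : Plane) (r : ℝ) :
    Convex ℝ (Metric.ball m r ∩ {x : Plane | 0 < inner ℝ (x - m) N}) := by
  refine (convex_ball m r).inter fun x hx y hy a b ha hb hab => ?_
  have h1 : 0 < inner ℝ (x - m) N := hx
  have h2 : 0 < inner ℝ (y - m) N := hy
  change 0 < inner ℝ (a • x + b • y - m) N
  have : a • x + b • y - m = a • (x - m) + b • (y - m) := by
    have : m = (a + b) • m := by rw [hab, one_smul]
    nth_rw 1 [this]; module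
  rw [this, inner_add_left, inner_smul_left, inner_smul_left]
  simp only [conj_trivial]
  rcases ha.lt_or_eq with ha | rfl
  · have := mul_pos ha h1
    have := mul_nonneg hb h2.le
    linarith
  · have : b = 1 := by linarith
    rw [this]; simpa using h2

/-- Where the boundary is a straight line, one of the half discs lies inside, the other outside. -/
lemma IsJordanRegion.halfDisc {P : Set Plane} (h : IsJordanRegion P) {m N : Plane} {r : ℝ}
    (hr : 0 < r) (hm : m ∈ frontier P)
    (hl : ∀ x ∈ Metric.ball m r, x ∈ frontier P ↔ inner ℝ (x - m) N = 0) :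
    (Metric.ball m r ∩ {x | 0 < inner ℝ (x - m) N} ⊆ interior P ∧
      Metric.ball m r ∩ {x | 0 < inner ℝ (x - m) (-N)} ⊆ Pᶜ) ∨
    (Metric.ball m r ∩ {x | 0 < inner ℝ (x - m) N} ⊆ Pᶜ ∧
      Metric.ball m r ∩ {x | 0 < inner ℝ (x - m) (-N)} ⊆ interior P) := by
  have hmem : ∀ x ∈ Metric.ball m r, x ∉ frontier P → 0 < inner ℝ (x - m) N ∨
      0 < inner ℝ (x - m) (-N) := by
    intro x hx hxf
    rw [hl x hx] at hxf
    rw [inner_neg_right]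
    rcases lt_or_gt_of_ne hxf with h | h
    · right; linarith
    · left; exact h
  have hd1 : Disjoint (Metric.ball m r ∩ {x | 0 < inner ℝ (x - m) N}) (frontier P) := by
    rw [Set.disjoint_left]
    rintro x ⟨hx, hx0⟩ hxf
    rw [hl x hx] at hxf
    have hx0 : 0 < inner ℝ (x - m) N := hx0
    linarith
  have hd2 : Disjoint (Metric.ball m r ∩ {x | 0 < inner ℝ (x - m) (-N)}) (frontier P) := by
    rw [Set.disjoint_left]
    rintro x ⟨hx, hx0⟩ hxf
    rw [hl x hx] at hxf
    have hx0 : 0 < inner ℝ (x - m) (-N) := hx0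
    rw [inner_neg_right] at hx0
    linarith
  have s1 := h.subset_or_subset (convex_halfDisc m N r).isPreconnected hd1
  have s2 := h.subset_or_subset (convex_halfDisc m (-N) r).isPreconnected hd2
  have hmi : m ∈ closure (interior P) := by
    rw [h.closure_interior]; exact h.frontier_subset hm
  have hmo : m ∈ closure Pᶜ := by
    rw [closure_compl]; exact (h.mem_frontier.1 hm).2
  obtain ⟨y, hyb, hyi⟩ := mem_closure_iff.1 hmi _ Metric.isOpen_ball (Metric.mem_ball_self hr)
  obtain ⟨z, hzb, hzo⟩ := mem_closure_iff.1 hmo _ Metric.isOpen_ball (Metric.mem_ball_self hr)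
  have hy := hmem y hyb fun hf => (h.mem_frontier.1 hf).2 hyi
  have hz := hmem z hzb fun hf => hzo (h.frontier_subset hf)
  have hdis : ∀ x, x ∈ interior P → x ∈ Pᶜ → False := fun x h1 h2 => h2 (interior_subset h1)
  rcases s1 with s1 | s1 <;> rcases s2 with s2 | s2
  · rcases hz with hz | hz
    · exact absurd (s1 ⟨hzb, hz⟩) fun h => hdis z h hzo
    · exact absurd (s2 ⟨hzb, hz⟩) fun h => hdis z h hzo
  · exact Or.inl ⟨s1, s2⟩
  · exact Or.inr ⟨s1, s2⟩
  · rcases hy with hy | hy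
    · exact absurd (s1 ⟨hyb, hy⟩) fun h => hdis y hyi h
    · exact absurd (s2 ⟨hyb, hy⟩) fun h => hdis y hyi h

/-- A normal vector of the line through two points; near the inner points of the segment the line
agrees with the segment. -/
lemma exists_normal {p q : Plane} (hpq : p ≠ q) : ∃ N : Plane, N ≠ 0 ∧
    ∀ m ∈ openSegment ℝ p q, ∃ r > 0, ∀ x ∈ Metric.ball m r,
      x ∈ segment ℝ p q ↔ inner ℝ (x - m) N = 0 := by
  set d := q - p with hd
  have hd0 : 0 < d 0 ^ 2 + d 1 ^ 2 := by
    rw [← plane_norm_sq]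
    have : 0 < ‖d‖ := norm_pos_iff.2 (sub_ne_zero.2 hpq.symm)
    positivity
  set N : Plane := !₂[-d 1, d 0] with hN
  have hinner : ∀ y : Plane, inner ℝ y N = -(y 0 * d 1) + y 1 * d 0 := by
    intro y; rw [plane_inner]; simp [hN]
  refine ⟨N, fun h => ?_, ?_⟩
  · have h0 := congrArg (fun p : Plane => p 0) h
    have h1 := congrArg (fun p : Plane => p 1) h
    simp [hN] at h0 h1
    rw [h0, h1] at hd0
    simp at hd0
  rintro m hm
  rw [openSegment_eq_image'] at hm
  obtain ⟨s, ⟨hs0, hs1⟩, rfl⟩ := hm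
  simp only [← hd]
  have hdn : 0 < ‖d‖ := norm_pos_iff.2 (sub_ne_zero.2 hpq.symm)
  refine ⟨min s (1 - s) * ‖d‖, mul_pos (lt_min hs0 (by linarith)) hdn, fun x hx => ?_⟩
  rw [segment_eq_image']
  simp only [← hd]
  constructor
  · rintro ⟨t, ht, rfl⟩
    have : p + t • d - (p + s • d) = (t - s) • d := by module
    rw [this, hinner]
    simp only [PiLp.smul_apply, smul_eq_mul]
    ring
  · intro h
    set y := x - (p + s • d) with hy
    set τ : ℝ := (y 0 * d 0 + y 1 * d 1) / (d 0 ^ 2 + d 1 ^ 2) with hτ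
    have hyτ : y = τ • d := by
      rw [hinner] at h
      apply plane_ext
      · simp only [PiLp.smul_apply, smul_eq_mul, hτ]
        field_simp
        linear_combination (-d 1) * h
      · simp only [PiLp.smul_apply, smul_eq_mul, hτ]
        field_simp
        linear_combination (d 0) * h
    rw [Metric.mem_ball, dist_eq_norm, ← hy, hyτ, norm_smul, Real.norm_eq_abs] at hx
    have hτs := lt_of_mul_lt_mul_right hx hdn.le
    have h1 := (hτs.trans_le (min_le_left _ _))
    have h2 := (hτs.trans_le (min_le_right _ _))
    rw [abs_lt] at h1 h2
    refine ⟨s + τ, ⟨by linarith, by linarith⟩, ?_⟩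
    have : x = y + (p + s • d) := by rw [hy]; abel
    rw [this, hyτ]
    module

/-- A chord cuts a polygon into two polygons. -/
theorem IsPolygon.exists_chordCut {P : Set Plane} (hP : IsPolygon P) {p q : Plane}
    (hp : p ∈ frontier P) (hq : q ∈ frontier P) (hpq : p ≠ q)
    (hs : openSegment ℝ p q ⊆ interior P) : ∃ Q₁ Q₂, IsChordCut P p q Q₁ Q₂ := by
  obtain ⟨n, v, hv, hΓ⟩ := hP.exists_loop
  have hJ := hP.isJordanRegion
  have hsd : Disjoint (openSegment ℝ p q) (frontier P) :=
    Set.disjoint_left.2 fun x hx hf => (hJ.mem_frontier.1 hf).2 (hs hx)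
  have hp' := hp
  have hq' := hq
  have hsd' := hsd
  rw [hΓ] at hp' hq' hsd'
  obtain ⟨A, hA, hAi, hA'⟩ := hv.exists_arcs hp' hq' hpq hsd'
  rw [← hΓ] at hA
  have hAc := fun i => (hA' i).1
  have hAne := fun i => (hA' i).2.1
  have hex : ∀ i, ∃ Q, IsPolygon Q ∧ frontier Q = A i ∪ segment ℝ p q := by
    intro i
    obtain ⟨m, w, hw, hws⟩ := (hA' i).2.2
    rw [← hws]
    exact hw.exists_isPolygon
  choose Q hQ hQf using hex
  have hQJ := fun i => (hQ i).isJordanRegion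
  have hAf : ∀ i, A i ⊆ frontier P := by
    intro i; rw [hA]; fin_cases i
    · exact subset_union_left
    · exact subset_union_right
  have hpA : ∀ i, {p, q} ⊆ A i := by
    intro i; rw [← hAi]; fin_cases i
    · exact inter_subset_left
    · exact inter_subset_right
  have hsegP : segment ℝ p q ⊆ P := by
    rw [segment_eq_pair_union]
    refine union_subset ?_ (hs.trans interior_subset)
    exact ((hpA 0).trans (hAf 0)).trans hJ.frontier_subset
  have hQfP : ∀ i, frontier (Q i) ⊆ P := fun i => by
    rw [hQf]; exact union_subset ((hAf i).trans hJ.frontier_subset) hsegP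
  -- the outer component is outside of both pieces
  have hout : ∀ i, Pᶜ ⊆ (Q i)ᶜ := by
    intro i
    refine ((hQJ i).subset_or_subset hJ.isPreconnected_compl ?_).resolve_left fun h => ?_
    · exact disjoint_compl_left.mono_right (hQfP i)
    · exact hJ.not_isBounded_compl ((hQJ i).isCompact.isBounded.subset (h.trans interior_subset))
  have hQP : ∀ i, Q i ⊆ P := fun i => compl_subset_compl.1 (hout i)
  -- the open arc of one piece is outside of the other piece
  have hij : ∀ i j : Fin 2, i ≠ j → A i ∩ A j = {p, q} := by
    intro i j h
    fin_cases i <;> fin_cases j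
    · exact absurd rfl h
    · exact hAi
    · rw [inter_comm]; exact hAi
    · exact absurd rfl h
  have harc : ∀ i j, i ≠ j → ∀ x ∈ A j, x ≠ p → x ≠ q → x ∈ (Q i)ᶜ := by
    intro i j h x hx hxp hxq
    have hxf : x ∉ frontier (Q i) := by
      rw [hQf, segment_eq_pair_union]
      have hpq' : x ∉ ({p, q} : Set Plane) := by simp [hxp, hxq]
      rintro (h1 | h1 | h1)
      · exact hpq' (hij i j h ▸ ⟨h1, hx⟩)
      · exact hpq' h1
      · exact Set.disjoint_left.1 hsd h1 (hAf j hx)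
    have hxc : x ∈ closure Pᶜ := by
      rw [closure_compl]; exact (hJ.mem_frontier.1 (hAf j hx)).2
    have := closure_mono (hout i) hxc
    rw [closure_compl] at this
    intro hxQ
    exact hxf ((hQJ i).mem_frontier.2 ⟨hxQ, this⟩)
  -- `interior (Q j)` is connected and avoids `∂ (Q i)`, and close to the open arc it is outside
  have hdisj : ∀ i j, i ≠ j → interior (Q j) ⊆ (Q i)ᶜ := by
    intro i j h
    have hd : Disjoint (interior (Q j)) (frontier (Q i)) := by
      rw [Set.disjoint_left]
      intro x hx hf
      have hxj : x ∉ frontier (Q j) := fun hf => ((hQJ j).mem_frontier.1 hf).2 hx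
      rw [hQf, mem_union, not_or] at hxj
      rw [hQf] at hf
      rcases hf with hf | hf
      · refine harc j i h.symm x hf ?_ ?_ (interior_subset hx)
        · rintro rfl; exact hxj.2 (left_mem_segment _ _ _)
        · rintro rfl; exact hxj.2 (right_mem_segment _ _ _)
      · exact hxj.2 hf
    refine ((hQJ i).subset_or_subset (hQJ j).isPreconnected_interior hd).resolve_left fun hsub => ?_
    obtain ⟨x, hx, hxp, hxq⟩ := hAne j
    have hxQ : x ∈ closure (interior (Q j)) := by
      rw [(hQJ j).closure_interior]
      exact (hQJ j).frontier_subset (by rw [hQf]; exact Or.inl hx)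
    obtain ⟨y, hy, hyj⟩ := mem_closure_iff.1 hxQ _ (hQJ i).isClosed.isOpen_compl
      (harc i j h x hx hxp hxq)
    exact hy (interior_subset (hsub hyj))
  have h01 := hdisj 0 1 (by decide)
  have h10 := hdisj 1 0 (by decide)
  have hIP : ∀ i, interior (Q i) ⊆ interior P := fun i => interior_mono (hQP i)
  have hnotf : ∀ i x, x ∈ interior P → x ∉ openSegment ℝ p q → x ∉ frontier (Q i) := by
    intro i x hx hxo hf
    rw [hQf, segment_eq_pair_union] at hf
    have h1 : x ∉ frontier P := fun h => (hJ.mem_frontier.1 h).2 hx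
    rcases hf with hf | hf | hf
    · exact h1 (hAf i hf)
    · exact h1 (hAf i (hpA i hf))
    · exact hxo hf
  obtain ⟨N, hN0, hN⟩ := exists_normal hpq
  -- near the chord there is nothing but the two pieces
  have hnear : ∀ m ∈ openSegment ℝ p q, ∃ r > 0, ∀ x ∈ Metric.ball m r,
      x ∉ segment ℝ p q → x ∈ interior (Q 0) ∪ interior (Q 1) := by
    intro m hm
    obtain ⟨r₁, hr₁, h1⟩ := hN m hm
    obtain ⟨r₂, hr₂, h2⟩ := Metric.isOpen_iff.1 isOpen_interior m (hs hm)
    set r := min r₁ r₂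
    have hr : 0 < r := lt_min hr₁ hr₂
    have hfr : ∀ i, ∀ x ∈ Metric.ball m r, x ∈ frontier (Q i) ↔ inner ℝ (x - m) N = 0 := by
      intro i x hx
      rw [← h1 x (Metric.ball_subset_ball (min_le_left _ _) hx), hQf]
      refine ⟨fun h => h.resolve_left fun hA => ?_, Or.inr⟩
      exact (hJ.mem_frontier.1 (hAf i hA)).2 (h2 (Metric.ball_subset_ball (min_le_right _ _) hx))
    have hmf : ∀ i, m ∈ frontier (Q i) := fun i => by
      rw [hQf]; exact Or.inr (openSegment_subset_segment _ _ _ hm)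
    have hne : ∀ N' : Plane, N' ≠ 0 →
        (Metric.ball m r ∩ {x | 0 < inner ℝ (x - m) N'}).Nonempty := by
      intro N' hN'
      have hn : 0 < ‖N'‖ := norm_pos_iff.2 hN'
      refine ⟨m + (r / 2 / ‖N'‖) • N', ?_, ?_⟩
      · rw [Metric.mem_ball, dist_eq_norm, add_sub_cancel_left, norm_smul, Real.norm_eq_abs,
          abs_of_pos (by positivity), div_mul_cancel₀ _ hn.ne']
        linarith
      · change 0 < inner ℝ (m + (r / 2 / ‖N'‖) • N' - m) N'
        rw [add_sub_cancel_left, inner_smul_left, real_inner_self_eq_norm_sq]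
        simp only [conj_trivial]
        positivity
    obtain ⟨y, hy⟩ := hne N hN0
    obtain ⟨z, hz⟩ := hne (-N) (neg_ne_zero.2 hN0)
    have hfin : ∀ i j : Fin 2, Metric.ball m r ∩ {x | 0 < inner ℝ (x - m) N} ⊆ interior (Q i) →
        Metric.ball m r ∩ {x | 0 < inner ℝ (x - m) (-N)} ⊆ interior (Q j) → ∀ x ∈ Metric.ball m r,
        x ∉ segment ℝ p q → x ∈ interior (Q i) ∪ interior (Q j) := by
      intro i j hi hj x hx hxs
      rw [h1 x (Metric.ball_subset_ball (min_le_left _ _) hx)] at hxs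
      rcases lt_or_gt_of_ne hxs with h | h
      · refine Or.inr (hj ⟨hx, ?_⟩)
        change 0 < inner ℝ (x - m) (-N)
        rw [inner_neg_right]; linarith
      · exact Or.inl (hi ⟨hx, h⟩)
    refine ⟨r, hr, ?_⟩
    rcases (hQJ 0).halfDisc hr (hmf 0) (hfr 0) with ⟨a, b⟩ | ⟨a, b⟩ <;>
    rcases (hQJ 1).halfDisc hr (hmf 1) (hfr 1) with ⟨c, d⟩ | ⟨c, d⟩
    · exact absurd (interior_subset (a hy)) (h01 (c hy))
    · exact hfin 0 1 a d
    · intro x hx hxs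
      rw [union_comm]
      exact hfin 1 0 c b x hx hxs
    · exact absurd (interior_subset (b hz)) (h01 (d hz))
  have hcover : interior P ⊆ interior (Q 0) ∪ interior (Q 1) ∪ openSegment ℝ p q := by
    intro x₀ hx₀
    by_contra hx₀n
    rw [mem_union, mem_union, not_or, not_or] at hx₀n
    -- the points of the interior missed by both pieces form a clopen subset
    set W := interior P ∩ (Q 0)ᶜ ∩ (Q 1)ᶜ with hW
    have hWo : IsOpen W :=
      (isOpen_interior.inter (hQJ 0).isClosed.isOpen_compl).inter (hQJ 1).isClosed.isOpen_compl
    have hmemW : ∀ x ∈ interior P, x ∉ openSegment ℝ p q → x ∉ interior (Q 0) →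
        x ∉ interior (Q 1) → x ∈ W := by
      intro x hx hxo h0 h1
      exact ⟨⟨hx, fun h => hnotf 0 x hx hxo ((hQJ 0).mem_frontier.2 ⟨h, h0⟩)⟩,
        fun h => hnotf 1 x hx hxo ((hQJ 1).mem_frontier.2 ⟨h, h1⟩)⟩
    choose! r hr hball using hnear
    set V := interior (Q 0) ∪ interior (Q 1) ∪ ⋃ m ∈ openSegment ℝ p q, Metric.ball m (r m) with hV
    have hVo : IsOpen V := (isOpen_interior.union isOpen_interior).union
      (isOpen_biUnion fun _ _ => Metric.isOpen_ball)
    obtain ⟨z, hzP, hzW, hzV⟩ := hJ.isPreconnected_interior W V hWo hVo (by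
        intro x hx
        by_cases hxo : x ∈ openSegment ℝ p q
        · exact Or.inr (Or.inr (mem_biUnion hxo (Metric.mem_ball_self (hr x hxo))))
        by_cases h0 : x ∈ interior (Q 0)
        · exact Or.inr (Or.inl (Or.inl h0))
        by_cases h1 : x ∈ interior (Q 1)
        · exact Or.inr (Or.inl (Or.inr h1))
        exact Or.inl (hmemW x hx hxo h0 h1))
      ⟨x₀, hx₀, hmemW x₀ hx₀ hx₀n.2 hx₀n.1.1 hx₀n.1.2⟩
      (by
        obtain ⟨y, hy⟩ := (hQJ 0).nonempty
        exact ⟨y, hIP 0 hy, Or.inl (Or.inl hy)⟩)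
    have hz : z ∈ interior (Q 0) ∪ interior (Q 1) := by
      rcases hzV with h | h
      · exact h
      · simp only [mem_iUnion] at h
        obtain ⟨m, hm, hzm⟩ := h
        refine hball m hm z hzm fun hzs => hzW.1.2 ((hQJ 0).frontier_subset ?_)
        rw [hQf]; exact Or.inr hzs
    rcases hz with h | h
    · exact hzW.1.2 (interior_subset h)
    · exact hzW.2 (interior_subset h)
  have hfs : ∀ i, frontier (Q i) ⊆ frontier P ∪ openSegment ℝ p q := by
    intro i
    rw [hQf, segment_eq_pair_union]
    refine union_subset ((hAf i).trans subset_union_left) (union_subset ?_ subset_union_right)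
    exact ((hpA i).trans (hAf i)).trans subset_union_left
  have hsf : ∀ i, segment ℝ p q ⊆ frontier (Q i) := fun i => by
    rw [hQf]; exact subset_union_right
  refine ⟨Q 0, Q 1, hp, hq, hpq, hs, hQ 0, hQ 1, ?_, ?_, ?_, hfs 0, hfs 1, hsf 0, hsf 1⟩
  · apply subset_antisymm
    · rw [← hJ.closure_interior]
      refine closure_minimal (hcover.trans ?_) ((hQJ 0).isClosed.union (hQJ 1).isClosed)
      refine union_subset (union_subset_union interior_subset interior_subset) ?_
      exact (openSegment_subset_segment _ _ _).trans
        ((hsf 0).trans ((hQJ 0).frontier_subset.trans subset_union_left))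
    · exact union_subset (hQP 0) (hQP 1)
  · apply subset_antisymm
    · exact subset_inter ((hsf 0).trans (hQJ 0).frontier_subset)
        ((hsf 1).trans (hQJ 1).frontier_subset)
    · rintro x ⟨h0, h1⟩
      have f0 : x ∈ frontier (Q 0) := (hQJ 0).mem_frontier.2 ⟨h0, fun h => h10 h h1⟩
      have f1 : x ∈ frontier (Q 1) := (hQJ 1).mem_frontier.2 ⟨h1, fun h => h01 h h0⟩
      rw [hQf] at f0 f1
      rcases f0 with f0 | f0
      · rcases f1 with f1 | f1
        · have : x ∈ A 0 ∩ A 1 := ⟨f0, f1⟩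
          rw [hAi] at this
          rw [segment_eq_pair_union]; exact Or.inl this
        · exact f1
      · exact f0
  · apply subset_antisymm hcover
    exact union_subset (union_subset (hIP 0) (hIP 1)) hs

/-! ### Concave vertices and convexity -/

lemma sector_eq_dir (v : Plane) (r φ α : ℝ) :
    sector v r φ α = {x | ∃ ρ ∈ Ico (0 : ℝ) r, ∃ ψ ∈ Icc φ (φ + α), x = v + ρ • dir ψ} := rfl

lemma HasInteriorAngle.exists_openSector {P : Set Plane} {v : Plane} {α : ℝ}
    (h : HasInteriorAngle P v α) : ∃ r > 0, ∃ φ, openSector v r φ α ⊆ interior P := by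
  obtain ⟨h0, h1, r, hr, φ, he⟩ := h
  refine ⟨r, hr, φ, interior_maximal ?_ (isOpen_openSector _ _ _ h0 h1.le)⟩
  rintro x ⟨ρ, hρ, ψ, hψ, rfl⟩
  have : v + ρ • dir ψ ∈ P ∩ Metric.ball v r := by
    rw [he]; exact ⟨ρ, ⟨hρ.1.le, hρ.2⟩, ψ, ⟨hψ.1.le, hψ.2.le⟩, rfl⟩
  exact this.1

/-- At a concave vertex one of any two opposite directions points into the interior. -/
lemma exists_interior_direction {P : Set Plane} {v : Plane} (hv : v ∈ concaveVertices P)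
    {e : Plane} (he : e ≠ 0) : ∃ s : ℝ, (s = 1 ∨ s = -1) ∧ ∃ r > 0, ∀ t ∈ Ioo (0 : ℝ) r,
      v + t • s • e ∈ interior P := by
  obtain ⟨α, hα, h⟩ := hv
  obtain ⟨r, hr, φ, hs⟩ := h.exists_openSector
  have hα2 := h.2.1
  obtain ⟨ψ, hψ, hed⟩ := exists_dir φ e
  have hn : 0 < ‖e‖ := norm_pos_iff.2 he
  have key : ∀ s : ℝ, ∀ ψ' ∈ Ioo φ (φ + α), s • e = ‖e‖ • dir ψ' → ∃ r > 0, ∀ t ∈ Ioo (0 : ℝ) r,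
      v + t • s • e ∈ interior P := by
    intro s ψ' hψ' h
    refine ⟨r / ‖e‖, by positivity, fun t ht => hs ⟨t * ‖e‖, ⟨mul_pos ht.1 hn, ?_⟩, ψ', hψ', ?_⟩⟩
    · rw [← lt_div_iff₀ hn]; exact ht.2
    · rw [h, smul_smul]
  have hneg : ∀ ψ', dir ψ' = - dir ψ → (-1 : ℝ) • e = ‖e‖ • dir ψ' := by
    intro ψ' h
    rw [h, smul_neg, neg_one_smul, ← hed]
  rcases hψ.1.lt_or_eq with h1 | h1
  · rcases lt_or_ge ψ (φ + α) with h2 | h2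
    · exact ⟨1, Or.inl rfl, key 1 ψ ⟨h1, h2⟩ (by rw [one_smul]; exact hed)⟩
    · refine ⟨-1, Or.inr rfl, key (-1) (ψ - Real.pi) ⟨by linarith, by linarith [hψ.2]⟩ (hneg _ ?_)⟩
      rw [← neg_eq_iff_eq_neg, ← dir_add_pi, sub_add_cancel]
  · refine ⟨-1, Or.inr rfl, key (-1) (ψ + Real.pi) ⟨by linarith [Real.pi_pos], by linarith⟩
      (hneg _ (dir_add_pi _))⟩

lemma mem_of_mem_concaveVertices {P : Set Plane} {v : Plane} (hv : v ∈ concaveVertices P) :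
    v ∈ P := by
  obtain ⟨α, hα, h0, h1, r, hr, φ, he⟩ := hv
  have : v ∈ P ∩ Metric.ball v r := by
    rw [he]; exact ⟨0, ⟨le_rfl, hr⟩, φ, ⟨le_rfl, by linarith⟩, by simp⟩
  exact this.1

lemma notMem_interior_of_mem_concaveVertices {P : Set Plane} {v : Plane}
    (hv : v ∈ concaveVertices P) : v ∉ interior P := by
  obtain ⟨α, hα, h0, h1, r, hr, φ, he⟩ := hv
  intro hvi
  obtain ⟨r', hr', hb⟩ := Metric.isOpen_iff.1 isOpen_interior v hvi
  set ρ := min r r' / 2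
  have hm : 0 < min r r' := lt_min hr hr'
  have hρ : 0 < ρ := by positivity
  have hρm : ρ < min r r' := half_lt_self hm
  set x := v + ρ • dir (φ + (α + 2 * Real.pi) / 2) with hx
  have hd : dist x v = ρ := by
    rw [dist_eq_norm, hx, add_sub_cancel_left, norm_smul_dir hρ.le]
  have hxP : x ∈ P ∩ Metric.ball v r :=
    ⟨interior_subset (hb (by rw [Metric.mem_ball, hd]; exact hρm.trans_le (min_le_right _ _))),
      by rw [Metric.mem_ball, hd]; exact hρm.trans_le (min_le_left _ _)⟩
  rw [he, sector_eq_dir] at hxP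
  obtain ⟨ρ', hρ', ψ, hψ, hxe⟩ := hxP
  have := (smul_dir_inj (φ := φ) hρ hρ'.1 ⟨by linarith, by linarith⟩
    ⟨hψ.1, by linarith [hψ.2]⟩ (add_left_cancel hxe)).2
  linarith [hψ.2]

/-- Near a concave vertex a set does not lie in a half plane. -/
lemma not_halfPlane_of_mem_concaveVertices {P : Set Plane} {v : Plane}
    (hv : v ∈ concaveVertices P) {N : Plane} (hN : N ≠ 0) {r : ℝ} (hr : 0 < r)
    (h : ∀ x ∈ P, x ∈ Metric.ball v r → 0 ≤ inner ℝ (x - v) N) : False := by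
  -- one of the directions along the boundary of the half plane points into the interior
  set e : Plane := !₂[-N 1, N 0] with he
  have he0 : e ≠ 0 := by
    intro h0
    apply hN
    have c0 := congrArg (fun p : Plane => p 0) h0
    have c1 := congrArg (fun p : Plane => p 1) h0
    simp [he] at c0 c1
    exact plane_ext c1 c0
  have hen : inner ℝ e N = 0 := by
    rw [plane_inner]; simp [he]; ring
  obtain ⟨s, hs, r₁, hr₁, hint⟩ := exists_interior_direction hv he0
  have hn : 0 < ‖s • e‖ := by
    rw [norm_pos_iff]
    refine smul_ne_zero ?_ he0
    rcases hs with rfl | rfl <;> norm_num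
  set t := min r₁ (r / ‖s • e‖) / 2 with ht
  have hm : 0 < min r₁ (r / ‖s • e‖) := lt_min hr₁ (by positivity)
  have ht0 : 0 < t := half_pos hm
  have htm : t < min r₁ (r / ‖s • e‖) := half_lt_self hm
  have hxi := hint t ⟨ht0, htm.trans_le (min_le_left _ _)⟩
  set x := v + t • s • e with hx
  have hxb : x ∈ Metric.ball v r := by
    rw [Metric.mem_ball, dist_eq_norm, hx, add_sub_cancel_left, norm_smul, Real.norm_eq_abs,
      abs_of_pos ht0, ← lt_div_iff₀ hn]
    exact htm.trans_le (min_le_right _ _)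
  obtain ⟨ε, hε, hb⟩ := Metric.isOpen_iff.1 (isOpen_interior.inter Metric.isOpen_ball) x ⟨hxi, hxb⟩
  have hNn : 0 < ‖N‖ := norm_pos_iff.2 hN
  have hy := hb (show x - (ε / 2 / ‖N‖) • N ∈ Metric.ball x ε by
    rw [Metric.mem_ball, dist_eq_norm, sub_sub_cancel_left, norm_neg, norm_smul, Real.norm_eq_abs,
      abs_of_pos (by positivity), div_mul_cancel₀ _ hNn.ne']
    linarith)
  have h0 := h _ (interior_subset hy.1) hy.2
  have : x - (ε / 2 / ‖N‖) • N - v = (t * s) • e - (ε / 2 / ‖N‖) • N := by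
    rw [hx, smul_smul]; abel
  rw [this, inner_sub_left, inner_smul_left, inner_smul_left, hen, mul_zero, zero_sub,
    real_inner_self_eq_norm_sq] at h0
  simp only [conj_trivial] at h0
  have : 0 < ε / 2 / ‖N‖ * ‖N‖ ^ 2 := by positivity
  linarith

/-- Near a concave vertex a set does not agree with a convex set. -/
lemma not_convex_of_mem_concaveVertices {P K : Set Plane} {v : Plane}
    (hv : v ∈ concaveVertices P) (hK : Convex ℝ K) (hKc : K ⊆ closure (interior K)) {r : ℝ}
    (hr : 0 < r) (h : ∀ x ∈ Metric.ball v r, x ∈ P ↔ x ∈ K) : False := by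
  have hvi : v ∉ interior K := by
    intro hvi
    apply notMem_interior_of_mem_concaveVertices hv
    rw [mem_interior_iff_mem_nhds] at hvi ⊢
    filter_upwards [hvi, Metric.ball_mem_nhds v hr] with x hx hxb
    exact (h x hxb).2 hx
  obtain ⟨f, hf⟩ := geometric_hahn_banach_open_point hK.interior isOpen_interior hvi
  have hvK := (h v (Metric.mem_ball_self hr)).1 (mem_of_mem_concaveVertices hv)
  have hle : ∀ x ∈ K, f x ≤ f v := by
    intro x hx
    refine closure_minimal (fun y hy => (hf y hy).le) ?_ (hKc hx)
    exact isClosed_le f.continuous continuous_const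
  set N := (InnerProductSpace.toDual ℝ Plane).symm (-f) with hN
  have hNf : ∀ x, inner ℝ x N = -f x := by
    intro x
    rw [real_inner_comm, hN, InnerProductSpace.toDual_symm_apply]; rfl
  have hN0 : N ≠ 0 := by
    intro h0
    obtain ⟨y, hy⟩ : (interior K).Nonempty := closure_nonempty_iff.1 ⟨v, hKc hvK⟩
    have h1 := hf y hy
    have h2 := hNf y
    have h3 := hNf v
    rw [h0, inner_zero_right] at h2 h3
    linarith
  refine not_halfPlane_of_mem_concaveVertices hv hN0 hr fun x hx hxb => ?_
  rw [inner_sub_left, hNf, hNf]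
  linarith [hle x ((h x hxb).1 hx)]

/-- Every boundary point of a polygon has an interior angle. -/
lemma IsPolygon.exists_corner {P : Set Plane} (hP : IsPolygon P) {v : Plane}
    (hv : v ∈ frontier P) : ∃ r φ α, IsPolyCorner (frontier P) v r φ α ∧
      P ∩ Metric.ball v r = sector v r φ α ∧ openSector v r (φ + α) (2 * Real.pi - α) ⊆ Pᶜ := by
  obtain ⟨n, w, hw, hΓ⟩ := hP.exists_loop
  have hJ := hP.isJordanRegion
  obtain ⟨r, φ, α, hc⟩ := hw.exists_isPolyCorner (hΓ ▸ hv)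
  rw [← hΓ] at hc
  have hmi : v ∈ closure (interior P) := by
    rw [hJ.closure_interior]; exact hJ.frontier_subset hv
  have hmo : v ∈ closure Pᶜ := by
    rw [closure_compl]; exact (hJ.mem_frontier.1 hv).2
  obtain ⟨y, hyb, hyi⟩ := mem_closure_iff.1 hmi _ Metric.isOpen_ball
    (Metric.mem_ball_self hc.r_pos)
  obtain ⟨z, hzb, hzo⟩ := mem_closure_iff.1 hmo _ Metric.isOpen_ball
    (Metric.mem_ball_self hc.r_pos)
  have hy := fun {φ α} (hc : IsPolyCorner (frontier P) v r φ α) =>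
    hc.mem_openSector_or hyb fun hf => (hJ.mem_frontier.1 hf).2 hyi
  have hz := fun {φ α} (hc : IsPolyCorner (frontier P) v r φ α) =>
    hc.mem_openSector_or hzb fun hf => hzo (hJ.frontier_subset hf)
  have key : ∀ {φ α}, IsPolyCorner (frontier P) v r φ α → openSector v r φ α ⊆ interior P →
      openSector v r (φ + α) (2 * Real.pi - α) ⊆ Pᶜ →
      P ∩ Metric.ball v r = sector v r φ α := by
    intro φ α hc h1 h2
    rw [hc.sector_eq]
    apply subset_antisymm
    · rintro x ⟨hx, hxb⟩
      by_cases hxf : x ∈ frontier P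
      · exact Or.inr ⟨hxf, hxb⟩
      · rcases hc.mem_openSector_or hxb hxf with h | h
        · exact Or.inl h
        · exact absurd hx (h2 h)
    · rintro x (hx | ⟨hx, hxb⟩)
      · exact ⟨interior_subset (h1 hx), IsPolyCorner.openSector_subset_ball _ _ _ _ hx⟩
      · exact ⟨hJ.frontier_subset hx, hxb⟩
  have hzP : z ∉ interior P := fun h => hzo (interior_subset h)
  have hyP : y ∉ Pᶜ := fun h => h (interior_subset hyi)
  have s1 := hJ.subset_or_subset (isPreconnected_openSector v r φ α) hc.disjoint
  have s2 := hJ.subset_or_subset (isPreconnected_openSector v r _ _) hc.swap.disjoint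
  have hsw : openSector v r (φ + α + (2 * Real.pi - α)) (2 * Real.pi - (2 * Real.pi - α)) =
      openSector v r φ α := by
    rw [show φ + α + (2 * Real.pi - α) = φ + 2 * Real.pi by ring,
      show 2 * Real.pi - (2 * Real.pi - α) = α by ring]
    ext x
    constructor
    · rintro ⟨ρ, hρ, ψ, hψ, rfl⟩
      refine ⟨ρ, hρ, ψ - 2 * Real.pi, ⟨by linarith [hψ.1], by linarith [hψ.2]⟩, ?_⟩
      rw [← dir_add_two_pi (ψ - 2 * Real.pi), sub_add_cancel]
    · rintro ⟨ρ, hρ, ψ, hψ, rfl⟩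
      refine ⟨ρ, hρ, ψ + 2 * Real.pi, ⟨by linarith [hψ.1], by linarith [hψ.2]⟩, ?_⟩
      rw [dir_add_two_pi]
  rcases s1 with s1 | s1 <;> rcases s2 with s2 | s2
  · rcases hz hc with h | h
    · exact absurd (s1 h) hzP
    · exact absurd (s2 h) hzP
  · exact ⟨r, φ, α, hc, key hc s1 s2, s2⟩
  · rw [← hsw] at s1
    exact ⟨r, φ + α, 2 * Real.pi - α, hc.swap, key hc.swap s2 s1, s1⟩
  · rcases hy hc with h | h
    · exact absurd (s1 h) hyP
    · exact absurd (s2 h) hyP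

/-- Concave vertices of a subset of a polygon that lie on the boundary of the polygon are concave
vertices of the polygon. -/
lemma IsPolygon.mem_concaveVertices_of_subset {P K : Set Plane} (hP : IsPolygon P) (hKP : K ⊆ P)
    {v : Plane} (hv : v ∈ concaveVertices K) (hvP : v ∈ frontier P) : v ∈ concaveVertices P := by
  obtain ⟨r, φ, α, hc, hs, -⟩ := hP.exists_corner hvP
  refine ⟨α, ?_, hc.pos, hc.lt, r, hc.r_pos, φ, hs⟩
  by_contra hα
  push Not at hα
  refine not_halfPlane_of_mem_concaveVertices hv (dir_ne_zero (φ + α / 2)) hc.r_pos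
    fun x hx hxb => ?_
  have : x ∈ P ∩ Metric.ball v r := ⟨hKP hx, hxb⟩
  rw [hs, sector_eq_dir] at this
  obtain ⟨ρ, hρ, ψ, hψ, rfl⟩ := this
  rw [add_sub_cancel_left, inner_smul_left, inner_dir_dir]
  refine mul_nonneg hρ.1 (Real.cos_nonneg_of_mem_Icc ⟨?_, ?_⟩)
  · linarith [hψ.1]
  · linarith [hψ.2]

/-- Concave vertices are among the vertices of the polygonal line, since a polygon lies on one side of
an edge near its inner points. -/
lemma IsPolygon.finite_concaveVertices {P : Set Plane} (hP : IsPolygon P) :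
    (concaveVertices P).Finite := by
  obtain ⟨n, w, hw, hΓ⟩ := hP.exists_loop
  have hJ := hP.isJordanRegion
  refine ((Finset.range n).image w).finite_toSet.subset fun u hu => ?_
  have huf : u ∈ frontier P := hJ.mem_frontier.2
    ⟨mem_of_mem_concaveVertices hu, notMem_interior_of_mem_concaveVertices hu⟩
  by_contra hnot
  have hnv : ∀ i < n, u ≠ w i := by
    intro i hi h
    apply hnot
    rw [Finset.mem_coe, Finset.mem_image]
    exact ⟨i, Finset.mem_range.2 hi, h.symm⟩
  have huΓ := huf
  rw [hΓ, hw.pathSet_eq] at huΓ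
  simp only [mem_iUnion] at huΓ
  obtain ⟨i, hi, hui⟩ := huΓ
  have huo : u ∈ openSegment ℝ (w i) (w (i + 1)) := by
    rw [hoSeg_eq_union_openSegment] at hui
    exact hui.resolve_left (hnv i hi)
  obtain ⟨N, hN0, hN⟩ := exists_normal (hw.ne i hi)
  obtain ⟨r₁, hr₁, h1⟩ := hN u huo
  have hrest : IsClosed (⋃ j ∈ (Finset.range n).erase i, segment ℝ (w j) (w (j + 1))) := by
    refine (Finset.isCompact_biUnion _ fun i _ => ?_).isClosed
    rw [segment_eq_image_lineMap]
    exact isCompact_Icc.image AffineMap.lineMap_continuous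
  have hur : u ∉ ⋃ j ∈ (Finset.range n).erase i, segment ℝ (w j) (w (j + 1)) := by
    simp only [mem_iUnion, Finset.mem_erase, Finset.mem_range, not_exists, and_imp]
    intro j hji hj h
    rw [segment_eq_hoSeg_union] at h
    rcases h with h | h
    · exact hji (hw.eq_of_mem hj hi h hui)
    · have h : u = w (j + 1) := h
      rw [← hw.vertex_mod hj] at h
      exact hnv _ (Nat.mod_lt _ hw.pos) h
  obtain ⟨r₂, hr₂, h2⟩ := Metric.isOpen_iff.1 hrest.isOpen_compl u hur
  have hr : 0 < min r₁ r₂ := lt_min hr₁ hr₂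
  have hl : ∀ x ∈ Metric.ball u (min r₁ r₂), x ∈ frontier P ↔ inner ℝ (x - u) N = 0 := by
    intro x hx
    rw [← h1 x (Metric.ball_subset_ball (min_le_left _ _) hx), hΓ, mem_pathSet]
    constructor
    · rintro ⟨j, hj, hxj⟩
      by_cases hji : j = i
      · rw [← hji]; exact hxj
      · refine absurd ?_ (h2 (Metric.ball_subset_ball (min_le_right _ _) hx))
        simp only [mem_iUnion, Finset.mem_erase, Finset.mem_range]
        exact ⟨j, ⟨hji, hj⟩, hxj⟩
    · intro h; exact ⟨i, hi, h⟩
  rcases hJ.halfDisc hr huf hl with ⟨-, h⟩ | ⟨h, -⟩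
  · refine not_halfPlane_of_mem_concaveVertices hu hN0 hr fun x hx hxb => ?_
    by_contra hneg
    refine h ⟨hxb, ?_⟩ hx
    change 0 < inner ℝ (x - u) (-N)
    rw [inner_neg_right]; linarith
  · refine not_halfPlane_of_mem_concaveVertices hu (neg_ne_zero.2 hN0) hr fun x hx hxb => ?_
    by_contra hneg
    rw [inner_neg_right] at hneg
    refine h ⟨hxb, ?_⟩ hx
    change 0 < inner ℝ (x - u) N
    linarith

/-- The segment `[x, z]` is covered by `[x, y] ∪ [y, z]` if `y` is on the line through `x` and `z`. -/
lemma mem_segment_union_of_collinear {x y z : Plane} {t : ℝ} (ht : t ∈ Icc (0 : ℝ) 1) {s : ℝ}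
    (hy : y = x + s • (z - x)) :
    x + t • (z - x) ∈ segment ℝ x y ∪ segment ℝ y z := by
  rcases le_total t s with h | h
  · left
    rcases ht.1.lt_or_eq with h0 | h0
    · rw [segment_eq_image']
      have hs : 0 < s := h0.trans_le h
      refine ⟨t / s, ⟨by positivity, (div_le_one hs).2 h⟩, ?_⟩
      simp only [hy, add_sub_cancel_left, smul_smul, div_mul_cancel₀ _ hs.ne']
    · rw [← h0, zero_smul, add_zero]; exact left_mem_segment _ _ _
  · right
    rcases ht.2.lt_or_eq with h1 | h1
    · rw [segment_eq_image']
      have hs : 0 < 1 - s := by linarith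
      refine ⟨(t - s) / (1 - s), ⟨div_nonneg (by linarith) hs.le,
        (div_le_one hs).2 (by linarith)⟩, ?_⟩
      have h2 : z - (x + s • (z - x)) = (1 - s) • (z - x) := by module
      simp only [hy, h2, smul_smul, div_mul_cancel₀ _ hs.ne']
      module
    · rw [h1, one_smul, add_sub_cancel]; exact right_mem_segment _ _ _

/-- The triangle argument: if two sides of a triangle lie in the interior of a polygon, the third
side `[x, z]` is in the interior as well, or else there is a concave vertex: the boundary point
within the triangle which is highest above `[x, z]` and, among these, closest to the side at `x`. -/
lemma IsPolygon.exists_concave_of_triangle {P : Set Plane} (hP : IsPolygon P) {x y z e N : Plane}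
    {h : ℝ} (he : e = z - x) (hN : N = !₂[-e 1, e 0] ∨ N = !₂[e 1, -e 0])
    (hh : h = inner ℝ (y - x) N) (hh0 : 0 < h)
    (hxy : segment ℝ x y ⊆ interior P) (hyz : segment ℝ y z ⊆ interior P)
    (hxz : ¬ segment ℝ x z ⊆ interior P) : (concaveVertices P).Nonempty := by
  have hJ := hP.isJordanRegion
  have hnf : ∀ w ∈ interior P, w ∉ frontier P := fun w hw hf => (hJ.mem_frontier.1 hf).2 hw
  have heN : inner ℝ e N = 0 := by
    rcases hN with rfl | rfl <;> rw [plane_inner] <;> simp <;> ring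
  have hNn : ‖N‖ = ‖e‖ := by
    rcases hN with rfl | rfl <;> rw [plane_norm, plane_norm] <;> simp [add_comm]
  have hN0 : N ≠ 0 := by
    rintro rfl
    rw [inner_zero_right] at hh; linarith
  have he0 : e ≠ 0 := by
    rw [← norm_ne_zero_iff, ← hNn, norm_ne_zero_iff]; exact hN0
  have hen : 0 < ‖e‖ ^ 2 := by have := norm_pos_iff.2 he0; positivity
  -- the triangle, in coordinates
  set w : ℝ × ℝ → Plane := fun c => x + c.1 • e + c.2 • (y - x) with hw
  have hwc : Continuous w := by fun_prop
  set D : Set (ℝ × ℝ) := {c | 0 ≤ c.1 ∧ 0 ≤ c.2 ∧ c.1 + c.2 ≤ 1} with hD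
  have hDc : IsCompact D := by
    refine (isCompact_Icc.prod isCompact_Icc : IsCompact (Icc (0 : ℝ) 1 ×ˢ Icc (0 : ℝ) 1)).of_isClosed_subset
      ?_ ?_
    · exact (isClosed_le continuous_const continuous_fst).inter
        ((isClosed_le continuous_const continuous_snd).inter
          (isClosed_le (continuous_fst.add continuous_snd) continuous_const))
    · rintro ⟨a, b⟩ ⟨h1, h2, h3⟩
      simp only at h1 h2 h3
      exact ⟨⟨h1, by linarith⟩, ⟨h2, by linarith⟩⟩
  set G : Set Plane := w '' D ∩ frontier P with hG
  have hGc : IsCompact G := (hDc.image hwc).inter_right isClosed_frontier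
  have hwN : ∀ c, inner ℝ (w c - x) N = c.2 * h := by
    intro c
    have : w c - x = c.1 • e + c.2 • (y - x) := by simp only [hw]; abel
    rw [this, inner_add_left, inner_smul_left, inner_smul_left, heN, hh]; simp
  have hGne : G.Nonempty := by
    by_contra hemp
    rw [not_nonempty_iff_eq_empty] at hemp
    apply hxz
    have hpre : IsPreconnected (segment ℝ x z) := (convex_segment _ _).isPreconnected
    have hsub : segment ℝ x z ⊆ w '' D := by
      rw [segment_eq_image']
      rintro _ ⟨t, ht, rfl⟩
      exact ⟨(t, 0), ⟨ht.1, le_rfl, by simpa using ht.2⟩, by simp [hw, he]⟩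
    refine (hJ.subset_or_subset hpre ?_).resolve_right fun hout => ?_
    · rw [Set.disjoint_left]
      intro u hu hf
      have : u ∈ G := ⟨hsub hu, hf⟩
      rw [hemp] at this; exact this
    · exact hout (left_mem_segment _ _ _) (interior_subset (hxy (left_mem_segment _ _ _)))
  -- `u` is the highest boundary point in the triangle, and the leftmost one at this height
  obtain ⟨u₁, hu₁, hmax₁⟩ := hGc.exists_isMaxOn hGne
    (f := fun u => inner ℝ (u - x) N) (by fun_prop)
  set G' : Set Plane := G ∩ {u | inner ℝ (u - x) N = inner ℝ (u₁ - x) N} with hG'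
  have hG'c : IsCompact G' := hGc.inter_right (isClosed_eq (by fun_prop) continuous_const)
  obtain ⟨u, ⟨huG, hu1⟩, hmin⟩ := hG'c.exists_isMinOn ⟨u₁, hu₁, rfl⟩
    (f := fun u => inner ℝ (u - x) e) (by fun_prop)
  have hu1 : inner ℝ (u - x) N = inner ℝ (u₁ - x) N := hu1
  have huN : ∀ u' ∈ G, inner ℝ (u' - x) N ≤ inner ℝ (u - x) N := fun u' hu' => by
    rw [hu1]; exact hmax₁ hu'
  have hue : ∀ u' ∈ G, inner ℝ (u' - x) N = inner ℝ (u - x) N →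
      inner ℝ (u - x) e ≤ inner ℝ (u' - x) e := fun u' hu' h => hmin ⟨hu', h.trans hu1⟩
  obtain ⟨⟨⟨A, η⟩, ⟨hA, hη, hAη⟩, hwu⟩, huf⟩ := huG
  simp only at hA hη hAη
  have hA0 : 0 < A := by
    refine hA.lt_of_ne fun h0 => hnf u (hxy ?_) huf
    rw [← hwu, segment_eq_image']
    exact ⟨η, ⟨hη, by linarith⟩, by simp [hw, ← h0]⟩
  have hA1 : A + η < 1 := by
    refine hAη.lt_of_ne fun h1 => hnf u (hyz ?_) huf
    rw [← hwu, segment_eq_image']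
    refine ⟨A, ⟨hA, by linarith⟩, ?_⟩
    have : η = 1 - A := by linarith
    simp only [hw, this, he]
    module
  -- directions pointing upwards (weakly) stay in the triangle for a while
  have hstay : ∀ d : Plane, 0 ≤ inner ℝ d N → ∃ r > 0, ∀ ρ ∈ Ioo (0 : ℝ) r, u + ρ • d ∈ w '' D := by
    intro d hd
    set b := inner ℝ d N / h with hb
    have hb0 : 0 ≤ b := div_nonneg hd hh0.le
    set a := (inner ℝ d e - b * inner ℝ (y - x) e) / ‖e‖ ^ 2 with ha
    have hdec : d = a • e + b • (y - x) := by
      have k1 : inner ℝ (a • e + b • (y - x)) N = inner ℝ d N := by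
        rw [inner_add_left, inner_smul_left, inner_smul_left, heN, ← hh, hb]
        simp only [conj_trivial]
        field_simp
        ring
      have k2 : inner ℝ (a • e + b • (y - x)) e = inner ℝ d e := by
        rw [inner_add_left, inner_smul_left, inner_smul_left, real_inner_self_eq_norm_sq, ha]
        simp only [conj_trivial]
        field_simp
        ring
      have k3 : ∀ p q : Plane, inner ℝ p N = inner ℝ q N → inner ℝ p e = inner ℝ q e → p = q := by
        intro p q h1 h2
        rw [plane_norm_sq] at hen
        have hN' : N 0 = -e 1 ∧ N 1 = e 0 ∨ N 0 = e 1 ∧ N 1 = -e 0 := by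
          rcases hN with rfl | rfl <;> simp
        rw [plane_inner, plane_inner] at h1 h2
        have h1' : -(p 0 * e 1) + p 1 * e 0 = -(q 0 * e 1) + q 1 * e 0 := by
          rcases hN' with ⟨e1, e2⟩ | ⟨e1, e2⟩ <;> rw [e1, e2] at h1 <;> linarith
        apply plane_ext
        · apply mul_right_cancel₀ hen.ne'
          linear_combination e 0 * h2 - e 1 * h1'
        · apply mul_right_cancel₀ hen.ne'
          linear_combination e 1 * h2 + e 0 * h1'
      exact (k3 _ _ k1 k2).symm
    have hM : 0 < |a| + b + 1 := by positivity
    refine ⟨min A (1 - A - η) / (|a| + b + 1), div_pos (lt_min hA0 (by linarith)) hM,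
      fun ρ hρ => ⟨(A + ρ * a, η + ρ * b), ⟨?_, ?_, ?_⟩, ?_⟩⟩
    all_goals
      have h1 := (lt_div_iff₀ hM).1 hρ.2
      have h2 := h1.trans_le (min_le_left _ _)
      have h3 := h1.trans_le (min_le_right _ _)
      have h4 := mul_le_mul_of_nonneg_left (le_abs_self a) hρ.1.le
      have h5 := mul_le_mul_of_nonneg_left (neg_abs_le a) hρ.1.le
      have h6 := mul_nonneg hρ.1.le hb0
      have h7 := hρ.1
    · change 0 ≤ A + ρ * a
      nlinarith
    · change 0 ≤ η + ρ * b
      nlinarith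
    · change A + ρ * a + (η + ρ * b) ≤ 1
      nlinarith
    · rw [← hwu]
      have h8 : ρ • d = ρ • (a • e + b • (y - x)) := by rw [← hdec]
      rw [h8]
      simp only [hw]
      module
  -- the part of the triangle above `u` is inside
  have habove : ∀ c ∈ D, inner ℝ (u - x) N < inner ℝ (w c - x) N → w c ∈ interior P := by
    intro c hc hlt
    have hyw : y = w (0, 1) := by simp [hw]
    have hyD : ((0, 1) : ℝ × ℝ) ∈ D := ⟨le_rfl, zero_le_one, by simp⟩
    have hpre : IsPreconnected (segment ℝ (w c) y) := (convex_segment _ _).isPreconnected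
    have huw : inner ℝ (u - x) N = η * h := by rw [← hwu, hwN]
    refine (hJ.subset_or_subset hpre ?_).resolve_right (fun hout => ?_) (left_mem_segment _ _ _)
    · rw [Set.disjoint_left]
      rintro q hq hqf
      rw [segment_eq_image'] at hq
      obtain ⟨t, ht, rfl⟩ := hq
      have hqw : w c + t • (y - w c) = w ((1 - t) * c.1, (1 - t) * c.2 + t) := by
        simp only [hw]; module
      simp only [hqw] at hqf
      have hle := huN _ ⟨mem_image_of_mem w (show ((1 - t) * c.1, (1 - t) * c.2 + t) ∈ D from
        ⟨mul_nonneg (by linarith [ht.2]) hc.1, by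
          have := mul_nonneg (sub_nonneg.2 ht.2) hc.2.1
          linarith [ht.1], by
          have := mul_le_mul_of_nonneg_left hc.2.2 (sub_nonneg.2 ht.2)
          change (1 - t) * c.1 + ((1 - t) * c.2 + t) ≤ 1
          linarith⟩), hqf⟩
      rw [hwN, huw] at hle
      rw [hwN, huw] at hlt
      have h1 : (1 - t) * c.2 + t ≤ η := le_of_mul_le_mul_right hle hh0
      have h2 : η < c.2 := lt_of_mul_lt_mul_right hlt hh0.le
      have h3 : c.2 ≤ 1 := by linarith [hc.1, hc.2.2]
      nlinarith [ht.1, ht.2, mul_nonneg ht.1 (sub_nonneg.2 h3)]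
    · exact hout (right_mem_segment _ _ _) (interior_subset (hxy (right_mem_segment _ _ _)))
  obtain ⟨r, φ, α, hc, hs, ho⟩ := hP.exists_corner huf
  have hr := hc.r_pos
  have hin : ∀ ρ (d : Plane), inner ℝ (u + ρ • d - x) N = inner ℝ (u - x) N + ρ * inner ℝ d N := by
    intro ρ d
    rw [add_sub_right_comm, inner_add_left, inner_smul_left]; simp
  have hin' : ∀ ρ (d : Plane), inner ℝ (u + ρ • d - x) e = inner ℝ (u - x) e + ρ * inner ℝ d e := by
    intro ρ d
    rw [add_sub_right_comm, inner_add_left, inner_smul_left]; simp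
  -- by the choice of `u`, the edges at `u` do not point upwards, nor horizontally to the left
  have hray : ∀ ψ, (∀ ρ ∈ Ico 0 r, u + ρ • dir ψ ∈ frontier P) → inner ℝ (dir ψ) N ≤ 0 ∧
      (inner ℝ (dir ψ) N = 0 → 0 ≤ inner ℝ (dir ψ) e) := by
    intro ψ hψ
    have key : 0 ≤ inner ℝ (dir ψ) N → ∃ ρ > (0 : ℝ), u + ρ • dir ψ ∈ G := by
      intro h0
      obtain ⟨r', hr', hst⟩ := hstay _ h0
      have hm : 0 < min r r' := lt_min hr hr'
      have hm' := half_lt_self hm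
      exact ⟨min r r' / 2, half_pos hm, hst _ ⟨half_pos hm, hm'.trans_le (min_le_right _ _)⟩,
        hψ _ ⟨(half_pos hm).le, hm'.trans_le (min_le_left _ _)⟩⟩
    constructor
    · by_contra! hpos
      obtain ⟨ρ, hρ, hm⟩ := key hpos.le
      have := huN _ hm
      rw [hin] at this
      have := mul_pos hρ hpos
      linarith
    · intro h0
      by_contra! hneg
      obtain ⟨ρ, hρ, hm⟩ := key h0.ge
      have := hue _ hm (by rw [hin, h0]; ring)
      rw [hin'] at this
      have := mul_neg_of_pos_of_neg hρ hneg
      linarith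
  have hball : ∀ ρ ∈ Ico 0 r, ∀ ψ, u + ρ • dir ψ ∈ Metric.ball u r := by
    intro ρ hρ ψ
    rw [Metric.mem_ball, dist_eq_norm, add_sub_cancel_left, norm_smul_dir hρ.1]; exact hρ.2
  obtain ⟨a1, a2⟩ := hray φ fun ρ hρ => (hc.mem_iff _ (hball ρ hρ _)).2 ⟨ρ, hρ, Or.inl rfl⟩
  obtain ⟨b1, b2⟩ := hray (φ + α) fun ρ hρ => (hc.mem_iff _ (hball ρ hρ _)).2 ⟨ρ, hρ, Or.inr rfl⟩
  refine ⟨u, α, ?_, hc.pos, hc.lt, r, hr, φ, hs⟩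
  by_contra! hα
  have hαp := hc.pos
  -- the direction opposite to the bisector points outside
  have hopp : inner ℝ (dir (φ + α / 2 + Real.pi)) N ≤ 0 := by
    by_contra! hpos
    obtain ⟨r', hr', hst⟩ := hstay _ hpos.le
    have hm : 0 < min r r' := lt_min hr hr'
    have hm' := half_lt_self hm
    set ρ := min r r' / 2 with hρ
    have hρ0 : 0 < ρ := half_pos hm
    obtain ⟨c, hcD, hcw⟩ := hst ρ ⟨hρ0, hm'.trans_le (min_le_right _ _)⟩
    have h1 : w c ∈ interior P := by
      refine habove c hcD ?_
      rw [hcw, hin]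
      have := mul_pos hρ0 hpos
      linarith
    rw [hcw] at h1
    exact ho ⟨ρ, ⟨hρ0, hm'.trans_le (min_le_left _ _)⟩, _,
      ⟨by linarith [hc.lt], by linarith [hc.lt]⟩, rfl⟩ (interior_subset h1)
  rw [dir_add_pi, inner_neg_left] at hopp
  have hsum : dir φ + dir (φ + α) = (2 * Real.cos (α / 2)) • dir (φ + α / 2) := by
    have e1 : φ = φ + α / 2 - α / 2 := by ring
    have e2 : φ + α = φ + α / 2 + α / 2 := by ring
    apply plane_ext
    · simp only [PiLp.add_apply, PiLp.smul_apply, dir_zero', smul_eq_mul]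
      rw [e2, Real.cos_add (φ + α / 2)]
      nth_rw 1 [e1]
      rw [Real.cos_sub]; ring
    · simp only [PiLp.add_apply, PiLp.smul_apply, dir_one', smul_eq_mul]
      rw [e2, Real.sin_add (φ + α / 2)]
      nth_rw 1 [e1]
      rw [Real.sin_sub]; ring
  have hcos : 0 ≤ Real.cos (α / 2) :=
    Real.cos_nonneg_of_mem_Icc ⟨by linarith [Real.pi_pos], by linarith⟩
  have h3 : 0 ≤ inner ℝ (dir φ) N + inner ℝ (dir (φ + α)) N := by
    rw [← inner_add_left, hsum, inner_smul_left]
    simp only [conj_trivial]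
    have : 0 ≤ inner ℝ (dir (φ + α / 2)) N := by linarith
    positivity
  -- so both edges are horizontal and point to the right, although they are different
  have hφ0 : inner ℝ (dir φ) N = 0 := by linarith
  have hα0 : inner ℝ (dir (φ + α)) N = 0 := by linarith
  have hdet : ∀ ψ, inner ℝ (dir ψ) N = 0 → 0 ≤ inner ℝ (dir ψ) e → dir ψ = (1 / ‖e‖) • e := by
    intro ψ h1 h2
    have hne : 0 < ‖e‖ := norm_pos_iff.2 he0
    have h4 : dir ψ = (inner ℝ (dir ψ) e / ‖e‖ ^ 2) • e := by
      have hN' : N 0 = -e 1 ∧ N 1 = e 0 ∨ N 0 = e 1 ∧ N 1 = -e 0 := by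
        rcases hN with rfl | rfl <;> simp
      rw [plane_inner] at h1 ⊢
      have h1' : -(dir ψ 0 * e 1) + dir ψ 1 * e 0 = 0 := by
        rcases hN' with ⟨e1, e2⟩ | ⟨e1, e2⟩ <;> rw [e1, e2] at h1 <;> linarith
      rw [plane_norm_sq] at hen ⊢
      apply plane_ext
      · simp only [PiLp.smul_apply, smul_eq_mul]
        field_simp
        linear_combination (-e 1) * h1'
      · simp only [PiLp.smul_apply, smul_eq_mul]
        field_simp
        linear_combination (e 0) * h1'
    have h5 := congrArg norm h4
    rw [norm_dir, norm_smul, Real.norm_of_nonneg (by positivity)] at h5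
    rw [h4]
    congr 1
    field_simp at h5 ⊢
    linarith
  have := dir_inj (φ := φ) ⟨le_rfl, by linarith [Real.pi_pos]⟩ ⟨by linarith, by linarith [hc.lt]⟩
    ((hdet φ hφ0 (a2 hφ0)).trans (hdet _ hα0 (b2 hα0)).symm)
  linarith

/-- A polygon without concave vertices is convex. -/
theorem IsPolygon.convex {P : Set Plane} (hP : IsPolygon P) (hc : concaveVertices P = ∅) :
    Convex ℝ P := by
  have hJ := hP.isJordanRegion
  -- visibility within the interior is transitive
  have key : ∀ x y z, segment ℝ x y ⊆ interior P → segment ℝ y z ⊆ interior P →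
      segment ℝ x z ⊆ interior P := by
    intro x y z hxy hyz
    by_contra hxz
    have hno : ¬ (concaveVertices P).Nonempty := by rw [hc]; exact not_nonempty_empty
    rcases lt_trichotomy (inner ℝ (y - x) !₂[-(z - x) 1, (z - x) 0]) 0 with h | h | h
    · refine hno (hP.exists_concave_of_triangle rfl (Or.inr rfl) rfl ?_ hxy hyz hxz)
      rw [plane_inner] at h ⊢
      simp at h ⊢
      linarith
    · apply hxz
      rw [segment_eq_image']
      rintro _ ⟨t, ht, rfl⟩
      rcases eq_or_ne x z with rfl | hne
      · simp only [sub_self, smul_zero, add_zero]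
        exact hxy (left_mem_segment _ _ _)
      have hd : 0 < (z - x) 0 ^ 2 + (z - x) 1 ^ 2 := by
        rw [← plane_norm_sq]
        have := norm_pos_iff.2 (sub_ne_zero.2 hne.symm)
        positivity
      have hy : y = x + (((y - x) 0 * (z - x) 0 + (y - x) 1 * (z - x) 1) /
          ((z - x) 0 ^ 2 + (z - x) 1 ^ 2)) • (z - x) := by
        rw [← sub_eq_iff_eq_add']
        rw [plane_inner] at h
        have h' : -((y - x) 0 * (z - x) 1) + (y - x) 1 * (z - x) 0 = 0 := by
          rw [← h]; simp; ring
        generalize y - x = a at *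
        generalize z - x = b at *
        apply plane_ext
        · simp only [PiLp.smul_apply, smul_eq_mul]
          field_simp
          linear_combination (-b 1) * h'
        · simp only [PiLp.smul_apply, smul_eq_mul]
          field_simp
          linear_combination (b 0) * h'
      exact (mem_segment_union_of_collinear ht hy).elim (fun h => hxy h) fun h => hyz h
    · exact hno (hP.exists_concave_of_triangle rfl (Or.inl rfl) rfl h hxy hyz hxz)
  have hconv : Convex ℝ (interior P) := by
    rw [convex_iff_segment_subset]
    intro x hx y hy
    -- the points visible from `x` form a clopen subset of the interior
    have hloc : ∀ z ∈ interior P, ∃ r > 0, Metric.ball z r ⊆ interior P ∧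
        ∀ z' ∈ Metric.ball z r, segment ℝ x z ⊆ interior P ↔ segment ℝ x z' ⊆ interior P := by
      intro z hz
      obtain ⟨r, hr, hb⟩ := Metric.isOpen_iff.1 isOpen_interior z hz
      refine ⟨r, hr, hb, fun z' hz' => ?_⟩
      have hzz : segment ℝ z z' ⊆ interior P :=
        ((convex_ball z r).segment_subset (Metric.mem_ball_self hr) hz').trans hb
      exact ⟨fun h => key x z z' h hzz, fun h => key x z' z h (segment_symm ℝ z z' ▸ hzz)⟩
    by_contra hxy
    obtain ⟨z, -, hz1, hz2⟩ := hJ.isPreconnected_interior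
      {z | z ∈ interior P ∧ segment ℝ x z ⊆ interior P}
      {z | z ∈ interior P ∧ ¬ segment ℝ x z ⊆ interior P}
      (by
        rw [Metric.isOpen_iff]
        rintro z ⟨hz, hxz⟩
        obtain ⟨r, hr, hb, h⟩ := hloc z hz
        exact ⟨r, hr, fun z' hz' => ⟨hb hz', (h z' hz').1 hxz⟩⟩)
      (by
        rw [Metric.isOpen_iff]
        rintro z ⟨hz, hxz⟩
        obtain ⟨r, hr, hb, h⟩ := hloc z hz
        exact ⟨r, hr, fun z' hz' => ⟨hb hz', fun h' => hxz ((h z' hz').2 h')⟩⟩)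
      (fun z hz => by
        by_cases h : segment ℝ x z ⊆ interior P
        · exact Or.inl ⟨hz, h⟩
        · exact Or.inr ⟨hz, h⟩)
      ⟨x, hx, hx, by rw [segment_same]; exact singleton_subset_iff.2 hx⟩ ⟨y, hy, hy, hxy⟩
    exact hz2.2 hz1.2
  rw [← hJ.closure_interior]
  exact hconv.closure

/-! ### Cutting off pockets -/

namespace IsChordCut

variable {P : Set Plane} {p q : Plane} {Q₁ Q₂ : Set Plane}

lemma swap (h : IsChordCut P p q Q₁ Q₂) : IsChordCut P p q Q₂ Q₁ where
  left_mem := h.left_mem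
  right_mem := h.right_mem
  ne := h.ne
  openSegment_subset := h.openSegment_subset
  isPolygon₁ := h.isPolygon₂
  isPolygon₂ := h.isPolygon₁
  union_eq := by rw [union_comm]; exact h.union_eq
  inter_eq := by rw [inter_comm]; exact h.inter_eq
  interior_eq := by rw [union_comm (interior Q₂)]; exact h.interior_eq
  frontier_subset₁ := h.frontier_subset₂
  frontier_subset₂ := h.frontier_subset₁
  subset_frontier₁ := h.subset_frontier₂
  subset_frontier₂ := h.subset_frontier₁

lemma subset₁ (h : IsChordCut P p q Q₁ Q₂) : Q₁ ⊆ P := by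
  rw [h.union_eq]; exact subset_union_left

lemma segment_subset₁ (h : IsChordCut P p q Q₁ Q₂) : segment ℝ p q ⊆ Q₁ := by
  rw [h.inter_eq]; exact inter_subset_left

lemma disjoint_interior (h : IsChordCut P p q Q₁ Q₂) : Disjoint (interior Q₁) Q₂ := by
  rw [Set.disjoint_left]
  intro x h1 h2
  have : x ∈ segment ℝ p q := by rw [h.inter_eq]; exact ⟨interior_subset h1, h2⟩
  exact (h.isPolygon₁.isJordanRegion.mem_frontier.1 (h.subset_frontier₁ this)).2 h1

lemma inducesPartition (h : IsChordCut P p q Q₁ Q₂) : InducesPartition P p q Q₁ Q₂ :=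
  ⟨h.left_mem, h.right_mem, h.segment_subset₁.trans h.subset₁, h.isPolygon₁, h.isPolygon₂,
    h.union_eq, h.inter_eq⟩

/-- A connected subset of the interior which avoids the chord lies in one of the pieces. -/
lemma subset_or_subset (h : IsChordCut P p q Q₁ Q₂) {C : Set Plane} (hC : IsPreconnected C)
    (hCP : C ⊆ interior P) (hd : Disjoint C (openSegment ℝ p q)) :
    C ⊆ interior Q₁ ∨ C ⊆ interior Q₂ := by
  refine hC.subset_or_subset isOpen_interior isOpen_interior
    (h.disjoint_interior.mono_right interior_subset) fun x hx => ?_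
  have := hCP hx
  rw [h.interior_eq] at this
  exact this.resolve_right fun hs => Set.disjoint_left.1 hd hx hs

end IsChordCut

/-- A chord `[p, q]` together with the part `R` of a polygon that it cuts off. -/
structure Pocket where
  /-- The first end point of the chord. -/
  p : Plane
  /-- The second end point of the chord. -/
  q : Plane
  /-- The region that is cut off. -/
  R : Set Plane

/-- `k` is a pocket of `P` outside of the core `K`, cut off by a chord in direction `e` on the
boundary of `K`, whose diameter is controlled by the length of the chord. -/
structure IsPocket (ϑ : ℝ) (e : Plane) (P K : Set Plane) (k : Pocket) : Prop where
  left_mem : k.p ∈ frontier P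
  right_mem : k.q ∈ frontier P
  ne : k.p ≠ k.q
  openSegment_subset : openSegment ℝ k.p k.q ⊆ interior P
  isPolygon : IsPolygon k.R
  subset : k.R ⊆ P
  segment_subset : segment ℝ k.p k.q ⊆ k.R
  segment_subset_frontier : segment ℝ k.p k.q ⊆ frontier K
  disjoint : Disjoint (interior k.R) K
  direction : ∃ c : ℝ, k.q - k.p = c • e
  dist_le : ∀ x ∈ k.R, ∀ y ∈ k.R, ϑ * dist x y ≤ dist k.p k.q

/-- The polygon `P` is the union of the polygon `K` and of the finitely many pockets in `F`. -/
structure IsCore (ϑ : ℝ) (e : Plane) (P K : Set Plane) (F : Set Pocket) : Prop where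
  isPolygon : IsPolygon K
  finite : F.Finite
  isPocket : ∀ k ∈ F, IsPocket ϑ e P K k
  union_eq : P = K ∪ ⋃ k ∈ F, k.R
  frontier_subset : frontier K ⊆ frontier P ∪ ⋃ k ∈ F, openSegment ℝ k.p k.q

section Core

variable {ϑ : ℝ} {e : Plane} {P K : Set Plane} {F : Set Pocket}

lemma IsCore.subset (h : IsCore ϑ e P K F) : K ⊆ P := by
  rw [h.union_eq]; exact subset_union_left

/-- A chord in direction `e` is open in its line. -/
lemma IsPocket.exists_add_mem {k : Pocket} (h : IsPocket ϑ e P K k) {x : Plane}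
    (hx : x ∈ openSegment ℝ k.p k.q) : ∃ r > 0, ∀ t : ℝ, |t| < r →
      x + t • e ∈ openSegment ℝ k.p k.q := by
  obtain ⟨c, hc⟩ := h.direction
  have hc0 : c ≠ 0 := by
    rintro rfl
    rw [zero_smul, sub_eq_zero] at hc
    exact h.ne hc.symm
  have hcp : 0 < |c| := abs_pos.2 hc0
  rw [openSegment_eq_image'] at hx ⊢
  obtain ⟨s, hs, rfl⟩ := hx
  refine ⟨min s (1 - s) * |c|, mul_pos (lt_min hs.1 (by linarith [hs.2])) hcp, fun t ht => ?_⟩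
  have h1 : |t / c| < min s (1 - s) := by
    rw [abs_div, div_lt_iff₀ hcp]; exact ht
  have h2 := abs_lt.1 (h1.trans_le (min_le_left _ _))
  have h3 := abs_lt.1 (h1.trans_le (min_le_right _ _))
  refine ⟨s + t / c, ⟨by linarith, by linarith⟩, ?_⟩
  simp only [hc]
  have : t • e = (t / c) • c • e := by rw [smul_smul, div_mul_cancel₀ _ hc0]
  rw [this]
  module

/-- The pieces into which a chord through the core `K` cuts `K` and `P`; each pocket goes with
one of the pieces. -/
structure IsCoreCut (P K : Set Plane) (F : Set Pocket) (p q : Plane) (R₁ R₂ K₁ K₂ : Set Plane) :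
    Prop where
  cutP : IsChordCut P p q R₁ R₂
  cutK : IsChordCut K p q K₁ K₂
  subset₁ : K₁ ⊆ R₁
  subset₂ : K₂ ⊆ R₂
  inter₁ : K ∩ R₁ = K₁
  inter₂ : K ∩ R₂ = K₂
  pocket : ∀ k ∈ F, (k.R ⊆ R₁ ∧ segment ℝ k.p k.q ⊆ K₁) ∨ (k.R ⊆ R₂ ∧ segment ℝ k.p k.q ⊆ K₂)

lemma IsCoreCut.swap {p q : Plane} {R₁ R₂ K₁ K₂ : Set Plane}
    (h : IsCoreCut P K F p q R₁ R₂ K₁ K₂) : IsCoreCut P K F p q R₂ R₁ K₂ K₁ :=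
  ⟨h.cutP.swap, h.cutK.swap, h.subset₂, h.subset₁, h.inter₂, h.inter₁,
    fun k hk => (h.pocket k hk).symm⟩

lemma IsCoreCut.eq_union {p q : Plane} {R₁ R₂ K₁ K₂ : Set Plane}
    (h : IsCoreCut P K F p q R₁ R₂ K₁ K₂) (hcore : IsCore ϑ e P K F) :
    R₁ = K₁ ∪ ⋃ k ∈ {k ∈ F | k.R ⊆ R₁ ∧ segment ℝ k.p k.q ⊆ K₁}, k.R := by
  apply subset_antisymm
  · intro x hx
    have hxP := h.cutP.subset₁ hx
    rw [hcore.union_eq] at hxP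
    rcases hxP with hxK | hxR
    · left; rw [← h.inter₁]; exact ⟨hxK, hx⟩
    · simp only [mem_iUnion] at hxR
      obtain ⟨k, hk, hxk⟩ := hxR
      rcases h.pocket k hk with h1 | h1
      · right
        exact mem_biUnion (show k ∈ {k ∈ F | k.R ⊆ R₁ ∧ segment ℝ k.p k.q ⊆ K₁} from ⟨hk, h1⟩) hxk
      · left
        apply h.cutK.segment_subset₁
        rw [h.cutP.inter_eq]
        exact ⟨hx, h1.1 hxk⟩
  · exact union_subset h.subset₁ (iUnion₂_subset fun k hk => hk.2.1)

/-- A chord through the core with end points on the boundary of `P` cuts both the core and `P`, and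
no pocket is cut. -/
lemma IsCore.exists_coreCut (hP : IsPolygon P) (hcore : IsCore ϑ e P K F) {p q : Plane}
    (hp : p ∈ frontier P) (hq : q ∈ frontier P) (hpK : p ∈ K) (hqK : q ∈ K) (hpq : p ≠ q)
    (hs : openSegment ℝ p q ⊆ interior K) :
    ∃ R₁ R₂ K₁ K₂, IsCoreCut P K F p q R₁ R₂ K₁ K₂ := by
  have hJ := hP.isJordanRegion
  have hKJ := hcore.isPolygon.isJordanRegion
  have hKP := hcore.subset
  have hint : interior K ⊆ interior P := interior_mono hKP
  have hfr : ∀ x ∈ frontier P, x ∈ K → x ∈ frontier K := fun x hx hxK =>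
    hKJ.mem_frontier.2 ⟨hxK, fun h => (hJ.mem_frontier.1 hx).2 (hint h)⟩
  obtain ⟨R₁, R₂, hR⟩ := hP.exists_chordCut hp hq hpq (hs.trans hint)
  obtain ⟨K₁, K₂, hK⟩ := hcore.isPolygon.exists_chordCut (hfr p hp hpK) (hfr q hq hqK) hpq hs
  -- it suffices to assign the pieces of `K` to the pieces of `P`
  suffices key : ∀ K₁ K₂, IsChordCut K p q K₁ K₂ → interior K₁ ⊆ interior R₁ →
      interior K₂ ⊆ interior R₂ → IsCoreCut P K F p q R₁ R₂ K₁ K₂ by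
    have hside : ∀ {K₁ K₂}, IsChordCut K p q K₁ K₂ →
        interior K₁ ⊆ interior R₁ ∨ interior K₁ ⊆ interior R₂ := by
      intro K₁ K₂ hK
      refine hR.subset_or_subset hK.isPolygon₁.isJordanRegion.isPreconnected_interior
        ((interior_mono hK.subset₁).trans hint) ?_
      refine (hK.disjoint_interior).mono_right ?_
      exact (openSegment_subset_segment _ _ _).trans hK.swap.segment_subset₁
    have hnot : ∀ {R₁ R₂}, IsChordCut P p q R₁ R₂ → interior K₁ ⊆ interior R₁ →
        interior K₂ ⊆ interior R₁ → False := by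
      intro R₁ R₂ hR h1 h2
      have hm : AffineMap.lineMap p q (1 / 2 : ℝ) ∈ openSegment ℝ p q := by
        rw [openSegment_eq_image_lineMap]; exact ⟨1 / 2, by norm_num, rfl⟩
      have hJ2 := hR.isPolygon₂.isJordanRegion
      have hmc : AffineMap.lineMap p q (1 / 2 : ℝ) ∈ closure (interior R₂) := by
        rw [hJ2.closure_interior]
        exact hR.swap.segment_subset₁ (openSegment_subset_segment _ _ _ hm)
      obtain ⟨y, hyK, hyR⟩ := mem_closure_iff.1 hmc _ isOpen_interior (hs hm)
      rw [hK.interior_eq] at hyK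
      have hd := Set.disjoint_left.1 hR.swap.disjoint_interior hyR
      rcases hyK with (h | h) | h
      · exact hd (interior_subset (h1 h))
      · exact hd (interior_subset (h2 h))
      · exact hd (hR.segment_subset₁ (openSegment_subset_segment _ _ _ h))
    rcases hside hK with h1 | h1 <;> rcases hside hK.swap with h2 | h2
    · exact (hnot hR h1 h2).elim
    · exact ⟨R₁, R₂, K₁, K₂, key _ _ hK h1 h2⟩
    · exact ⟨R₁, R₂, K₂, K₁, key _ _ hK.swap h2 h1⟩
    · exact (hnot hR.swap h1 h2).elim
  intro K₁ K₂ hK h1 h2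
  have hcl : ∀ {A B : Set Plane}, IsPolygon A → IsPolygon B → interior A ⊆ interior B →
      A ⊆ B := by
    intro A B hA hB h
    rw [← hA.isJordanRegion.closure_interior, ← hB.isJordanRegion.closure_interior]
    exact closure_mono h
  have s1 := hcl hK.isPolygon₁ hR.isPolygon₁ h1
  have s2 := hcl hK.isPolygon₂ hR.isPolygon₂ h2
  have i1 : K ∩ R₁ = K₁ := by
    apply subset_antisymm
    · rintro x ⟨hxK, hxR⟩
      rw [hK.union_eq] at hxK
      rcases hxK with h | h
      · exact h
      · apply hK.segment_subset₁; rw [hR.inter_eq]; exact ⟨hxR, s2 h⟩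
    · exact subset_inter hK.subset₁ s1
  have i2 : K ∩ R₂ = K₂ := by
    apply subset_antisymm
    · rintro x ⟨hxK, hxR⟩
      rw [hK.union_eq] at hxK
      rcases hxK with h | h
      · apply hK.swap.segment_subset₁; rw [hR.inter_eq]; exact ⟨s1 h, hxR⟩
      · exact h
    · exact subset_inter hK.swap.subset₁ s2
  -- a pocket together with its open chord is connected within the interior of `P`
  refine ⟨hR, hK, s1, s2, i1, i2, fun k hk => ?_⟩
  have hk' := hcore.isPocket k hk
  have hRJ := hk'.isPolygon.isJordanRegion
  have hsk : openSegment ℝ k.p k.q ⊆ k.R :=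
    (openSegment_subset_segment _ _ _).trans hk'.segment_subset
  have hpre : IsPreconnected (interior k.R ∪ openSegment ℝ k.p k.q) := by
    refine hRJ.isPreconnected_interior.subset_closure subset_union_left ?_
    rw [hRJ.closure_interior]
    exact union_subset interior_subset hsk
  have hsegK : segment ℝ k.p k.q ⊆ K := hk'.segment_subset_frontier.trans hKJ.frontier_subset
  have hfin : ∀ {Ri Ki : Set Plane}, IsPolygon Ri → K ∩ Ri = Ki →
      interior k.R ∪ openSegment ℝ k.p k.q ⊆ interior Ri →
      k.R ⊆ Ri ∧ segment ℝ k.p k.q ⊆ Ki := by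
    intro Ri Ki hRi hKi hsub
    have : k.R ⊆ Ri := hcl hk'.isPolygon hRi (subset_union_left.trans hsub)
    refine ⟨this, ?_⟩
    rw [← hKi]
    exact subset_inter hsegK (hk'.segment_subset.trans this)
  refine (hR.subset_or_subset hpre ?_ ?_).imp (hfin hR.isPolygon₁ i1) (hfin hR.isPolygon₂ i2)
  · exact union_subset (interior_mono hk'.subset) hk'.openSegment_subset
  · rw [disjoint_union_left]
    constructor
    · exact hk'.disjoint.mono_right (hs.trans interior_subset)
    · rw [Set.disjoint_left]
      intro x hx hx'
      exact (hKJ.mem_frontier.1 (hk'.segment_subset_frontier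
        (openSegment_subset_segment _ _ _ hx))).2 (hs hx')

/-- If one of the pieces is small compared to the chord, it becomes a new pocket. -/
lemma IsCoreCut.isCore {p q : Plane} {R₁ R₂ K₁ K₂ : Set Plane}
    (h : IsCoreCut P K F p q R₁ R₂ K₁ K₂) (hcore : IsCore ϑ e P K F)
    (hdir : ∃ c : ℝ, q - p = c • e) (hd : ∀ x ∈ R₁, ∀ y ∈ R₁, ϑ * dist x y ≤ dist p q) :
    IsCore ϑ e P K₂ (insert ⟨p, q, R₁⟩ {k ∈ F | k.R ⊆ R₂ ∧ segment ℝ k.p k.q ⊆ K₂}) where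
  isPolygon := h.cutK.isPolygon₂
  finite := (hcore.finite.subset (sep_subset _ _)).insert _
  isPocket := by
    rintro k (rfl | ⟨hk, -, hk2⟩)
    · exact ⟨h.cutP.left_mem, h.cutP.right_mem, h.cutP.ne, h.cutP.openSegment_subset,
        h.cutP.isPolygon₁, h.cutP.subset₁, h.cutP.segment_subset₁, h.cutK.subset_frontier₂,
        h.cutP.disjoint_interior.mono_right h.subset₂, hdir, hd⟩
    · have hk' := hcore.isPocket k hk
      refine ⟨hk'.left_mem, hk'.right_mem, hk'.ne, hk'.openSegment_subset, hk'.isPolygon,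
        hk'.subset, hk'.segment_subset, fun x hx => ?_,
        hk'.disjoint.mono_right h.cutK.swap.subset₁, hk'.direction, hk'.dist_le⟩
      refine h.cutK.isPolygon₂.isJordanRegion.mem_frontier.2 ⟨hk2 hx, fun hx' => ?_⟩
      exact (hcore.isPolygon.isJordanRegion.mem_frontier.1 (hk'.segment_subset_frontier hx)).2
        (interior_mono h.cutK.swap.subset₁ hx')
  union_eq := by
    rw [biUnion_insert, h.cutP.union_eq]
    nth_rw 1 [h.swap.eq_union hcore]
    rw [← union_assoc, union_comm R₁, union_assoc]
  frontier_subset := by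
    intro x hx
    rw [biUnion_insert]
    have hends : x ∈ segment ℝ p q → x ∈ frontier P ∪ (openSegment ℝ p q ∪
        ⋃ k ∈ {k ∈ F | k.R ⊆ R₂ ∧ segment ℝ k.p k.q ⊆ K₂}, openSegment ℝ k.p k.q) := by
      intro hx
      rw [segment_eq_pair_union] at hx
      rcases hx with (rfl | rfl) | hx
      · exact Or.inl h.cutP.left_mem
      · exact Or.inl h.cutP.right_mem
      · exact Or.inr (Or.inl hx)
    rcases h.cutK.frontier_subset₂ hx with hxK | hxo
    · rcases hcore.frontier_subset hxK with hxP | hxk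
      · exact Or.inl hxP
      · simp only [mem_iUnion] at hxk
        obtain ⟨k, hk, hxk⟩ := hxk
        rcases h.pocket k hk with h1 | h1
        · apply hends
          rw [h.cutK.inter_eq]
          exact ⟨h1.2 (openSegment_subset_segment _ _ _ hxk),
            h.cutK.isPolygon₂.isJordanRegion.frontier_subset hx⟩
        · exact Or.inr (Or.inr (mem_biUnion
            (show k ∈ {k ∈ F | k.R ⊆ R₂ ∧ segment ℝ k.p k.q ⊆ K₂} from ⟨hk, h1⟩) hxk))
    · exact Or.inr (Or.inl hxo)

/-- Euclidean distances are at most intrinsic distances. -/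
lemma dist_le_of_intrinsicDiam_le {R : Set Plane} {p q : Plane} (hϑ : 0 < ϑ)
    (h : ENNReal.ofReal ϑ * intrinsicDiam R ≤ edist p q) :
    ∀ x ∈ R, ∀ y ∈ R, ϑ * dist x y ≤ dist p q := by
  intro x hx y hy
  have h1 : edist x y ≤ intrinsicDiam R := by
    refine le_trans ?_ (le_iSup₂_of_le x hx (le_iSup₂_of_le y hy le_rfl))
    refine le_iInf₂ fun γ hγ => ?_
    rw [← hγ.2.2.1, ← hγ.2.2.2]
    exact eVariationOn.edist_le γ (by simp) (by simp)
  have h2 := (mul_le_mul_right h1 (ENNReal.ofReal ϑ)).trans h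
  rw [edist_dist, edist_dist, ← ENNReal.ofReal_mul hϑ.le] at h2
  exact (ENNReal.ofReal_le_ofReal_iff dist_nonneg).1 h2

/-- The directions `± e` at concave vertices of `P` which point into the interior of `K`. -/
def openDirections (e : Plane) (P K : Set Plane) : Set (Plane × ℝ) :=
  {d | d.1 ∈ concaveVertices P ∧ (d.2 = 1 ∨ d.2 = -1) ∧
    ∃ r > 0, ∀ t ∈ Ioo (0 : ℝ) r, d.1 + t • d.2 • e ∈ interior K}

lemma finite_openDirections (hP : IsPolygon P) (e : Plane) (K : Set Plane) :
    (openDirections e P K).Finite := by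
  refine (hP.finite_concaveVertices.prod (Set.toFinite {(1 : ℝ), -1})).subset ?_
  rintro ⟨v, s⟩ ⟨h1, h2, -⟩
  exact ⟨h1, h2⟩

/-- A core with a concave vertex can be made smaller by cutting off another pocket. -/
lemma IsCore.exists_smaller (hϑ : 0 < ϑ) (he : ‖e‖ = 1) (hP : IsPolygon P)
    (hsc : IsSemiconvex ϑ P) (hcore : IsCore ϑ e P K F) (hne : (concaveVertices K).Nonempty) :
    ∃ K' F', IsCore ϑ e P K' F' ∧
      (openDirections e P K').ncard < (openDirections e P K).ncard := by
  obtain ⟨v, hv⟩ := hne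
  have he0 : e ≠ 0 := by rw [← norm_ne_zero_iff, he]; norm_num
  have hKJ := hcore.isPolygon.isJordanRegion
  have hKP := hcore.subset
  have hvK : v ∈ frontier K := hKJ.mem_frontier.2
    ⟨mem_of_mem_concaveVertices hv, notMem_interior_of_mem_concaveVertices hv⟩
  obtain ⟨s, hs, r, hr, hint⟩ := exists_interior_direction hv he0
  have hs2 : |s| = 1 := by rcases hs with rfl | rfl <;> simp
  have hd : ‖s • e‖ = 1 := by rw [norm_smul, he, Real.norm_eq_abs, hs2, mul_one]
  have hpocket : ∀ k ∈ F, ∀ x ∈ openSegment ℝ k.p k.q, x ∉ interior K := by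
    intro k hk x hx hxi
    exact (hKJ.mem_frontier.1 ((hcore.isPocket k hk).segment_subset_frontier
      (openSegment_subset_segment _ _ _ hx))).2 hxi
  -- otherwise `v` is an inner point of the chord of a pocket, and the direction `s • e` along this
  -- chord stays on the boundary of the core
  have hvP : v ∈ frontier P := by
    refine (hcore.frontier_subset hvK).resolve_right fun h => ?_
    simp only [mem_iUnion] at h
    obtain ⟨k, hk, hvk⟩ := h
    obtain ⟨r', hr', hadd⟩ := (hcore.isPocket k hk).exists_add_mem hvk
    have hm : 0 < min r r' := lt_min hr hr'
    have hm' := half_lt_self hm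
    refine hpocket k hk _ (hadd (min r r' / 2 * s) ?_) ?_
    · rw [abs_mul, hs2, mul_one, abs_of_pos (half_pos hm)]
      exact hm'.trans_le (min_le_right _ _)
    · rw [← smul_smul]
      exact hint _ ⟨half_pos hm, hm'.trans_le (min_le_left _ _)⟩
  have hvc : v ∈ concaveVertices P := hP.mem_concaveVertices_of_subset hKP hv hvP
  -- the first point at which the ray leaves the interior of the core
  set T : Set ℝ := {t | r / 2 ≤ t ∧ v + t • s • e ∉ interior K} with hT
  have hTc : IsClosed T := by
    refine isClosed_Ici.inter ?_
    exact (isOpen_interior.preimage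
      (show Continuous fun t : ℝ => v + t • s • e by fun_prop)).isClosed_compl
  have hTne : T.Nonempty := by
    obtain ⟨M, hM⟩ := hKJ.isCompact.isBounded.subset_ball v
    refine ⟨max (r / 2) M, le_max_left _ _, fun h => ?_⟩
    have := hM (interior_subset h)
    rw [Metric.mem_ball, dist_eq_norm, add_sub_cancel_left, norm_smul, hd, mul_one,
      Real.norm_of_nonneg ((half_pos hr).le.trans (le_max_left _ _))] at this
    exact (le_max_right _ _).not_gt this
  have hTb : BddBelow T := ⟨r / 2, fun t ht => ht.1⟩
  set τ := sInf T with hτ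
  have hτT : τ ∈ T := hTc.csInf_mem hTne hTb
  have hτ0 : 0 < τ := (half_pos hr).trans_le hτT.1
  have hbefore : ∀ t ∈ Ioo 0 τ, v + t • s • e ∈ interior K := by
    intro t ht
    by_cases h : t < r
    · exact hint t ⟨ht.1, h⟩
    · by_contra hn
      exact (csInf_le hTb (show t ∈ T from ⟨by linarith, hn⟩)).not_gt ht.2
  set w := v + τ • s • e with hw
  have hvw : v ≠ w := by
    intro h
    have : τ • s • e = 0 := by rw [hw] at h; simpa using h.symm
    rw [← norm_eq_zero, norm_smul, hd, mul_one, norm_eq_zero] at this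
    exact hτ0.ne' this
  have hos : openSegment ℝ v w ⊆ interior K := by
    rw [openSegment_eq_image']
    rintro _ ⟨t, ht, rfl⟩
    simp only [hw, add_sub_cancel_left, smul_smul]
    rw [← mul_assoc, ← smul_smul]
    exact hbefore _ ⟨mul_pos ht.1 hτ0, mul_lt_of_lt_one_left hτ0 ht.2⟩
  have hwK : w ∈ frontier K := by
    refine hKJ.mem_frontier.2 ⟨?_, hτT.2⟩
    have : w ∈ closure (openSegment ℝ v w) := by
      rw [closure_openSegment]; exact right_mem_segment _ _ _
    exact closure_minimal (hos.trans interior_subset) hKJ.isClosed this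
  have hwP : w ∈ frontier P := by
    refine (hcore.frontier_subset hwK).resolve_right fun h => ?_
    simp only [mem_iUnion] at h
    obtain ⟨k, hk, hwk⟩ := h
    obtain ⟨r', hr', hadd⟩ := (hcore.isPocket k hk).exists_add_mem hwk
    have hm : 0 < min τ r' := lt_min hτ0 hr'
    have hm' := half_lt_self hm
    refine hpocket k hk _ (hadd (-(min τ r' / 2 * s)) ?_) ?_
    · rw [abs_neg, abs_mul, hs2, mul_one, abs_of_pos (half_pos hm)]
      exact hm'.trans_le (min_le_right _ _)
    · have : w + (-(min τ r' / 2 * s)) • e = v + (τ - min τ r' / 2) • s • e := by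
        rw [hw]; module
      rw [this]
      exact hbefore _ ⟨by linarith [min_le_left τ r'], by linarith⟩
  obtain ⟨R₁, R₂, K₁, K₂, hcut⟩ := hcore.exists_coreCut hP hvP hwP (hKJ.frontier_subset hvK)
    (hKJ.frontier_subset hwK) hvw hos
  have hdir : ∃ c : ℝ, w - v = c • e := ⟨τ * s, by rw [hw, add_sub_cancel_left, smul_smul]⟩
  -- the direction `s • e` at `v` now points along the boundary of the core
  have hmeas : ∀ {R₁ R₂ K₁ K₂ : Set Plane}, IsCoreCut P K F v w R₁ R₂ K₁ K₂ →
      (openDirections e P K₂).ncard < (openDirections e P K).ncard := by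
    intro R₁ R₂ K₁ K₂ hcut
    refine ncard_lt_ncard ⟨?_, fun hsub => ?_⟩ (finite_openDirections hP e K)
    · rintro d ⟨h1, h2, r, hr, h3⟩
      exact ⟨h1, h2, r, hr, fun t ht => interior_mono hcut.cutK.swap.subset₁ (h3 t ht)⟩
    · have : ((v, s) : Plane × ℝ) ∈ openDirections e P K := ⟨hvc, hs, r, hr, hint⟩
      obtain ⟨-, -, r', hr', h3⟩ := hsub this
      have hm : 0 < min τ r' := lt_min hτ0 hr'
      have hm' := half_lt_self hm
      have hin := h3 _ ⟨half_pos hm, hm'.trans_le (min_le_right _ _)⟩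
      refine (hcut.cutK.isPolygon₂.isJordanRegion.mem_frontier.1
        (hcut.cutK.subset_frontier₂ ?_)).2 hin
      rw [segment_eq_image']
      refine ⟨min τ r' / 2 / τ, ⟨by positivity, (div_le_one hτ0).2
        (hm'.le.trans (min_le_left _ _))⟩, ?_⟩
      simp only [hw, add_sub_cancel_left]
      rw [smul_smul (min τ r' / 2 / τ), div_mul_cancel₀ _ hτ0.ne']
  have hmin := hsc v hvc w hwP R₁ R₂ hcut.cutP.inducesPartition
  rcases le_total (intrinsicDiam R₁) (intrinsicDiam R₂) with hle | hle
  · rw [min_eq_left hle] at hmin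
    exact ⟨_, _, hcut.isCore hcore hdir (dist_le_of_intrinsicDiam_le hϑ hmin), hmeas hcut⟩
  · rw [min_eq_right hle] at hmin
    exact ⟨_, _, hcut.swap.isCore hcore hdir (dist_le_of_intrinsicDiam_le hϑ hmin),
      hmeas hcut.swap⟩

/-- A semiconvex polygon has a convex core. -/
theorem exists_convex_core (hϑ : 0 < ϑ) (he : ‖e‖ = 1) (hP : IsPolygon P)
    (hsc : IsSemiconvex ϑ P) : ∃ K F, IsCore ϑ e P K F ∧ Convex ℝ K := by
  have key : ∀ (n : ℕ) (K : Set Plane) (F : Set Pocket), IsCore ϑ e P K F →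
      (openDirections e P K).ncard = n → ∃ K F, IsCore ϑ e P K F ∧ Convex ℝ K := by
    intro n
    induction n using Nat.strong_induction_on with
    | _ n ih =>
      intro K F hcore hn
      rcases (concaveVertices K).eq_empty_or_nonempty with h | h
      · exact ⟨K, F, hcore, hcore.isPolygon.convex h⟩
      · obtain ⟨K', F', hcore', hlt⟩ := hcore.exists_smaller hϑ he hP hsc h
        exact ih _ (hn ▸ hlt) K' F' hcore' rfl
  refine key _ P ∅ ⟨hP, finite_empty, ?_, ?_, ?_⟩ rfl
  · simp
  · simp
  · simp

end Core

/-! ### Slicing a convex polygon -/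

/-- `f` and `e` form an orthonormal basis of the plane. The coordinates of `x` with respect to it
are `inner ℝ x f` (thought of as horizontal) and `inner ℝ x e` (thought of as vertical). -/
structure IsFrame (f e : Plane) : Prop where
  norm_eq_one : ‖e‖ = 1
  eq_or_eq : f = !₂[e 1, -e 0] ∨ f = !₂[-e 1, e 0]

namespace IsFrame

variable {e f : Plane}

lemma neg (h : IsFrame f e) : IsFrame (-f) e := by
  refine ⟨h.norm_eq_one, ?_⟩
  rcases h.eq_or_eq with rfl | rfl
  · right; apply plane_ext <;> simp
  · left; apply plane_ext <;> simp

lemma sq_add_sq (h : IsFrame f e) : e 0 ^ 2 + e 1 ^ 2 = 1 := by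
  rw [← plane_norm_sq, h.norm_eq_one, one_pow]

lemma inner_eq (h : IsFrame f e) (x y : Plane) :
    inner ℝ x y = inner ℝ x f * inner ℝ y f + inner ℝ x e * inner ℝ y e := by
  have h1 := h.sq_add_sq
  rcases h.eq_or_eq with rfl | rfl <;>
  · simp only [plane_inner]
    simp
    linear_combination (-(x 0 * y 0) - x 1 * y 1) * h1

lemma inner_e_f (h : IsFrame f e) : inner ℝ e f = 0 := by
  rcases h.eq_or_eq with rfl | rfl <;> rw [plane_inner] <;> simp <;> ring

lemma inner_e_e (h : IsFrame f e) : inner ℝ e e = 1 := by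
  rw [real_inner_self_eq_norm_sq, h.norm_eq_one, one_pow]

lemma norm_sq_eq (h : IsFrame f e) (x : Plane) :
    ‖x‖ ^ 2 = inner ℝ x f ^ 2 + inner ℝ x e ^ 2 := by
  rw [← real_inner_self_eq_norm_sq, h.inner_eq]; ring

lemma norm_f (h : IsFrame f e) : ‖f‖ = 1 := by
  have h1 := h.sq_add_sq
  rw [plane_norm]
  rcases h.eq_or_eq with rfl | rfl <;> simp <;> linarith

lemma ext (h : IsFrame f e) {x y : Plane} (h1 : inner ℝ x f = inner ℝ y f)
    (h2 : inner ℝ x e = inner ℝ y e) : x = y := by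
  rw [← sub_eq_zero, ← norm_eq_zero, ← sq_eq_zero_iff, h.norm_sq_eq, inner_sub_left,
    inner_sub_left, h1, h2]
  ring

lemma dist_le (h : IsFrame f e) (x y : Plane) :
    dist x y ≤ |inner ℝ x f - inner ℝ y f| + |inner ℝ x e - inner ℝ y e| := by
  rw [dist_eq_norm, ← inner_sub_left, ← inner_sub_left]
  apply le_of_sq_le_sq _ (by positivity)
  rw [h.norm_sq_eq, ← sq_abs (inner ℝ (x - y) f), ← sq_abs (inner ℝ (x - y) e)]
  nlinarith [abs_nonneg (inner ℝ (x - y) f), abs_nonneg (inner ℝ (x - y) e)]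

lemma dist_eq (h : IsFrame f e) {x y : Plane} (hxy : inner ℝ x f = inner ℝ y f) :
    dist x y = |inner ℝ x e - inner ℝ y e| := by
  rw [dist_eq_norm, ← inner_sub_left, ← abs_norm (x - y)]
  apply (sq_eq_sq_iff_abs_eq_abs _ _).1
  rw [h.norm_sq_eq, inner_sub_left x y f, hxy]; ring

lemma abs_inner_f_le (h : IsFrame f e) (x y : Plane) :
    |inner ℝ x f - inner ℝ y f| ≤ dist x y := by
  rw [← inner_sub_left, dist_eq_norm]
  have := abs_real_inner_le_norm (x - y) f
  rwa [h.norm_f, mul_one] at this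

end IsFrame

section Slice

variable {e f : Plane} {K : Set Plane}

/-- A vertical chord of a convex set which contains a boundary point in its interior lies on a
vertical supporting line. -/
lemma forall_le_or_of_mem_frontier (hf : IsFrame f e) (hJ : IsJordanRegion K)
    (hK : Convex ℝ K) {p q m : Plane} (hp : p ∈ K) (hq : q ∈ K) (hpq : p ≠ q)
    (hpqf : inner ℝ p f = inner ℝ q f) (hm : m ∈ openSegment ℝ p q) (hmf : m ∈ frontier K) :
    (∀ x ∈ K, inner ℝ x f ≤ inner ℝ m f) ∨ (∀ x ∈ K, inner ℝ m f ≤ inner ℝ x f) := by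
  -- a supporting functional at `m` is constant along the chord
  obtain ⟨g, hg⟩ := geometric_hahn_banach_open_point hK.interior isOpen_interior
    (hJ.mem_frontier.1 hmf).2
  have hle : ∀ x ∈ K, g x ≤ g m := by
    intro x hx
    rw [← hJ.closure_interior] at hx
    refine closure_minimal (fun y hy => (hg y hy).le) ?_ hx
    exact isClosed_le g.continuous continuous_const
  set N := (InnerProductSpace.toDual ℝ Plane).symm g with hN
  have hNg : ∀ x, g x = inner ℝ x N := by
    intro x
    rw [real_inner_comm, hN, InnerProductSpace.toDual_symm_apply]
  obtain ⟨a, b, ha, hb, hab, rfl⟩ := hm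
  have hgp := hle p hp
  have hgq := hle q hq
  have hgm : g (a • p + b • q) = a * g p + b * g q := by simp
  have hgpq : g p = g q := by
    rw [hgm] at hgp hgq
    have e1 : a = 1 - b := by linarith
    rw [e1] at hgp hgq
    have h1 : 0 ≤ b * (g q - g p) := by nlinarith
    have h2 : 0 ≤ (1 - b) * (g p - g q) := by nlinarith
    have h1' := nonneg_of_mul_nonneg_right h1 hb
    have h2' := nonneg_of_mul_nonneg_right h2 (by linarith)
    linarith
  have hNe : inner ℝ N e = 0 := by
    rw [hNg, hNg, hf.inner_eq p, hf.inner_eq q, hpqf] at hgpq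
    have h1 : (inner ℝ p e - inner ℝ q e) * inner ℝ N e = 0 := by linarith
    rcases mul_eq_zero.1 h1 with h | h
    · exact absurd (hf.ext hpqf (by linarith)) hpq
    · exact h
  have hgf : ∀ x, g x = inner ℝ N f * inner ℝ x f := by
    intro x; rw [hNg, hf.inner_eq, hNe]; ring
  have hN0 : inner ℝ N f ≠ 0 := by
    intro h
    obtain ⟨y, hy⟩ := hJ.nonempty
    have := hg y hy
    rw [hgf, hgf, h] at this
    simp at this
  rcases lt_or_gt_of_ne hN0 with h | h
  · right
    intro x hx
    have := hle x hx
    rw [hgf, hgf] at this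
    nlinarith
  · left
    intro x hx
    have := hle x hx
    rw [hgf, hgf] at this
    exact le_of_mul_le_mul_left this h

/-- A vertical line meeting a compact convex set meets it in a vertical segment. -/
lemma exists_section (hf : IsFrame f e) (hc : IsCompact K) (hK : Convex ℝ K) {c : ℝ}
    (hne : ∃ x ∈ K, inner ℝ x f = c) :
    ∃ p ∈ K, ∃ q ∈ K, inner ℝ p f = c ∧ inner ℝ q f = c ∧
      (∀ x ∈ K, inner ℝ x f = c → inner ℝ p e ≤ inner ℝ x e ∧ inner ℝ x e ≤ inner ℝ q e) ∧
      K ∩ {x | inner ℝ x f = c} = segment ℝ p q := by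
  have hcS : IsCompact (K ∩ {x | inner ℝ x f = c}) :=
    hc.inter_right (isClosed_eq (by fun_prop) continuous_const)
  have hne' : (K ∩ {x | inner ℝ x f = c}).Nonempty := hne
  obtain ⟨p, ⟨hpK, hp⟩, hpm⟩ := hcS.exists_isMinOn hne' (f := fun x => inner ℝ x e) (by fun_prop)
  obtain ⟨q, ⟨hqK, hq⟩, hqm⟩ := hcS.exists_isMaxOn hne' (f := fun x => inner ℝ x e) (by fun_prop)
  have hp : inner ℝ p f = c := hp
  have hq : inner ℝ q f = c := hq
  refine ⟨p, hpK, q, hqK, hp, hq, fun x hx hxc => ⟨hpm ⟨hx, hxc⟩, hqm ⟨hx, hxc⟩⟩, ?_⟩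
  apply subset_antisymm
  · rintro x ⟨hx, hxc⟩
    have hxc : inner ℝ x f = c := hxc
    have h1 : inner ℝ p e ≤ inner ℝ x e := hpm ⟨hx, hxc⟩
    have h2 : inner ℝ x e ≤ inner ℝ q e := hqm ⟨hx, hxc⟩
    rcases h1.lt_or_eq with h3 | h3
    · rw [segment_eq_image']
      have h4 : 0 < inner ℝ q e - inner ℝ p e := by linarith
      refine ⟨(inner ℝ x e - inner ℝ p e) / (inner ℝ q e - inner ℝ p e),
        ⟨div_nonneg (by linarith) h4.le, (div_le_one h4).2 (by linarith)⟩, ?_⟩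
      apply hf.ext
      · rw [inner_add_left, inner_smul_left, inner_sub_left, hp, hq, hxc]; simp
      · rw [inner_add_left, inner_smul_left, inner_sub_left]
        simp only [conj_trivial]
        field_simp
        ring
    · rw [hf.ext (hxc.trans hp.symm) h3.symm]
      exact left_mem_segment _ _ _
  · intro x hx
    refine ⟨hK.segment_subset hpK hqK hx, ?_⟩
    obtain ⟨a, b, ha, hb, hab, rfl⟩ := hx
    change inner ℝ _ f = c
    rw [inner_add_left, inner_smul_left, inner_smul_left, hp, hq]
    simp only [conj_trivial]
    rw [← add_mul, hab, one_mul]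

/-- If the chord is a vertical slice of the polygon, the pieces lie on the two sides of the slice. -/
lemma IsChordCut.eq_slices {p q : Plane} {K₁ K₂ : Set Plane} (h : IsChordCut K p q K₁ K₂) {c : ℝ}
    (hs : K ∩ {x | inner ℝ x f = c} = segment ℝ p q) (hl : ∃ x ∈ K, inner ℝ x f < c)
    (hr : ∃ x ∈ K, c < inner ℝ x f) :
    (K₁ = K ∩ {x | inner ℝ x f ≤ c} ∧ K₂ = K ∩ {x | c ≤ inner ℝ x f}) ∨
    (K₂ = K ∩ {x | inner ℝ x f ≤ c} ∧ K₁ = K ∩ {x | c ≤ inner ℝ x f}) := by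
  have hside : ∀ {K₁ K₂}, IsChordCut K p q K₁ K₂ →
      (∀ x ∈ K₁, inner ℝ x f ≤ c) ∨ (∀ x ∈ K₁, c ≤ inner ℝ x f) := by
    intro K₁ K₂ h
    have hJ := h.isPolygon₁.isJordanRegion
    have hcl : closure (interior K₁) = K₁ := hJ.closure_interior
    have hor : interior K₁ ⊆ {x | inner ℝ x f < c} ∨ interior K₁ ⊆ {x | c < inner ℝ x f} := by
      refine hJ.isPreconnected_interior.subset_or_subset
        (isOpen_lt (by fun_prop) continuous_const) (isOpen_lt continuous_const (by fun_prop))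
        ?_ ?_
      · rw [Set.disjoint_left]
        intro x (h1 : inner ℝ x f < c) (h2 : c < inner ℝ x f)
        linarith
      · intro x hx
        rcases lt_trichotomy (inner ℝ x f) c with h1 | h1 | h1
        · exact Or.inl h1
        · have : x ∈ segment ℝ p q := by
            rw [← hs]; exact ⟨h.subset₁ (interior_subset hx), h1⟩
          exact absurd hx (hJ.mem_frontier.1 (h.subset_frontier₁ this)).2
        · exact Or.inr h1
    refine hor.imp (fun h1 x hx => ?_) fun h1 x hx => ?_
    · rw [← hcl] at hx
      exact closure_minimal (t := {x | inner ℝ x f ≤ c})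
        (fun y hy => le_of_lt (show inner ℝ y f < c from h1 hy))
        (isClosed_le (by fun_prop) continuous_const) hx
    · rw [← hcl] at hx
      exact closure_minimal (t := {x | c ≤ inner ℝ x f})
        (fun y hy => le_of_lt (show c < inner ℝ y f from h1 hy))
        (isClosed_le continuous_const (by fun_prop)) hx
  have key : ∀ {K₁ K₂}, IsChordCut K p q K₁ K₂ → (∀ x ∈ K₁, inner ℝ x f ≤ c) →
      (∀ x ∈ K₂, c ≤ inner ℝ x f) →
      K₁ = K ∩ {x | inner ℝ x f ≤ c} ∧ K₂ = K ∩ {x | c ≤ inner ℝ x f} := by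
    intro K₁ K₂ h h1 h2
    constructor
    · apply subset_antisymm
      · exact fun x hx => ⟨h.subset₁ hx, h1 x hx⟩
      · rintro x ⟨hx, hxc⟩
        rw [h.union_eq] at hx
        rcases hx with hx | hx
        · exact hx
        · apply h.segment_subset₁
          rw [← hs]
          exact ⟨h.swap.subset₁ hx, le_antisymm hxc (h2 x hx)⟩
    · apply subset_antisymm
      · exact fun x hx => ⟨h.swap.subset₁ hx, h2 x hx⟩
      · rintro x ⟨hx, hxc⟩
        rw [h.union_eq] at hx
        rcases hx with hx | hx
        · apply h.swap.segment_subset₁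
          rw [← hs]
          exact ⟨h.subset₁ hx, le_antisymm (h1 x hx) hxc⟩
        · exact hx
  obtain ⟨x, hx, hxc⟩ := hl
  obtain ⟨y, hy, hyc⟩ := hr
  rcases hside h with h1 | h1 <;> rcases hside h.swap with h2 | h2
  · rw [h.union_eq] at hy
    rcases hy with hy | hy
    · exact absurd hyc (h1 y hy).not_gt
    · exact absurd hyc (h2 y hy).not_gt
  · exact Or.inl (key h h1 h2)
  · exact Or.inr (key h.swap h2 h1)
  · rw [h.union_eq] at hx
    rcases hx with hx | hx
    · exact absurd hxc (h1 x hx).not_gt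
    · exact absurd hxc (h2 x hx).not_gt

end Slice

section Pockets

variable {ϑ : ℝ} {e f : Plane} {P K : Set Plane} {F : Set Pocket}

lemma IsPocket.inner_eq (hf : IsFrame f e) {k : Pocket} (h : IsPocket ϑ e P K k) :
    inner ℝ k.p f = inner ℝ k.q f := by
  obtain ⟨c, hc⟩ := h.direction
  have : inner ℝ (k.q - k.p) f = 0 := by
    rw [hc, inner_smul_left, hf.inner_e_f, mul_zero]
  rw [inner_sub_left] at this
  linarith

lemma IsPocket.inner_eq_of_mem (hf : IsFrame f e) {k : Pocket} (h : IsPocket ϑ e P K k)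
    {x : Plane} (hx : x ∈ segment ℝ k.p k.q) : inner ℝ x f = inner ℝ k.p f := by
  obtain ⟨a, b, ha, hb, hab, rfl⟩ := hx
  rw [inner_add_left, inner_smul_left, inner_smul_left, ← h.inner_eq hf]
  simp only [conj_trivial]
  rw [← add_mul, hab, one_mul]

/-- The chords of the pockets of a convex core lie at its left and right end. -/
lemma IsCore.pocket_at_end (hf : IsFrame f e) (hcore : IsCore ϑ e P K F) (hK : Convex ℝ K)
    {k : Pocket} (hk : k ∈ F) :
    (∀ x ∈ K, inner ℝ x f ≤ inner ℝ k.p f) ∨ (∀ x ∈ K, inner ℝ k.p f ≤ inner ℝ x f) := by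
  have hk' := hcore.isPocket k hk
  have hJ := hcore.isPolygon.isJordanRegion
  have hm : AffineMap.lineMap k.p k.q (1 / 2 : ℝ) ∈ openSegment ℝ k.p k.q := by
    rw [openSegment_eq_image_lineMap]; exact ⟨1 / 2, by norm_num, rfl⟩
  have hms := openSegment_subset_segment ℝ _ _ hm
  rw [← hk'.inner_eq_of_mem hf hms]
  exact forall_le_or_of_mem_frontier hf hJ hK
    (hJ.frontier_subset (hk'.segment_subset_frontier (left_mem_segment _ _ _)))
    (hJ.frontier_subset (hk'.segment_subset_frontier (right_mem_segment _ _ _)))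
    hk'.ne (hk'.inner_eq hf) hm (hk'.segment_subset_frontier hms)

/-- A vertical slice strictly between the ends of a convex core cuts `P` along the slice. -/
lemma IsCore.exists_slice (hf : IsFrame f e) (hP : IsPolygon P) (hcore : IsCore ϑ e P K F)
    (hK : Convex ℝ K) {c : ℝ} (hl : ∃ x ∈ K, inner ℝ x f < c) (hr : ∃ x ∈ K, c < inner ℝ x f)
    (hne : ∃ a ∈ K, ∃ b ∈ K, inner ℝ a f = c ∧ inner ℝ b f = c ∧ a ≠ b) :
    ∃ p q R₁ R₂ K₁ K₂, IsCoreCut P K F p q R₁ R₂ K₁ K₂ ∧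
      K ∩ {x | inner ℝ x f = c} = segment ℝ p q ∧
      K₁ = K ∩ {x | inner ℝ x f ≤ c} ∧ K₂ = K ∩ {x | c ≤ inner ℝ x f} := by
  have hJ := hcore.isPolygon.isJordanRegion
  obtain ⟨a, ha, b, hb, hac, hbc, hab⟩ := hne
  obtain ⟨p, hp, q, hq, hpc, hqc, hext, hs⟩ := exists_section hf hJ.isCompact hK ⟨a, ha, hac⟩
  have hpq : p ≠ q := by
    rintro rfl
    obtain ⟨h1, h2⟩ := hext a ha hac
    obtain ⟨h3, h4⟩ := hext b hb hbc
    exact hab (hf.ext (hac.trans hbc.symm) (by linarith))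
  have hmem : ∀ x ∈ segment ℝ p q, inner ℝ x f = c := fun x hx => by
    rw [← hs] at hx; exact hx.2
  have hos : openSegment ℝ p q ⊆ interior K := by
    intro m hm
    have hms := openSegment_subset_segment ℝ _ _ hm
    by_contra hmi
    have hmf : m ∈ frontier K := hJ.mem_frontier.2 ⟨hK.segment_subset hp hq hms, hmi⟩
    obtain ⟨x, hx, hxc⟩ := hl
    obtain ⟨y, hy, hyc⟩ := hr
    rcases forall_le_or_of_mem_frontier hf hJ hK hp hq hpq (hpc.trans hqc.symm) hm hmf with h | h
    · have := h y hy
      rw [hmem m hms] at this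
      linarith
    · have := h x hx
      rw [hmem m hms] at this
      linarith
  -- the end points of the slice are on the boundary of `P`
  have hbd : ∀ s : ℝ, s ≠ 0 → ∀ x ∈ K, inner ℝ x f = c →
      (∀ y ∈ K, inner ℝ y f = c → s * inner ℝ y e ≤ s * inner ℝ x e) → x ∈ frontier P := by
    intro s hs0 x hx hxc hxs
    have hxf : x ∈ frontier K := by
      refine hJ.mem_frontier.2 ⟨hx, fun hxi => ?_⟩
      obtain ⟨r, hr, hball⟩ := Metric.isOpen_iff.1 isOpen_interior x hxi
      have hsa : 0 < |s| := abs_pos.2 hs0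
      have hy := hball (show x + (r / 2 / |s| * s) • e ∈ Metric.ball x r by
        rw [Metric.mem_ball, dist_eq_norm, add_sub_cancel_left, norm_smul, hf.norm_eq_one, mul_one,
          Real.norm_eq_abs, abs_mul, abs_of_pos (by positivity), div_mul_cancel₀ _ hsa.ne']
        linarith)
      have := hxs _ (interior_subset hy) (by
        rw [inner_add_left, inner_smul_left, hf.inner_e_f, mul_zero, add_zero, hxc])
      rw [inner_add_left, inner_smul_left, hf.inner_e_e] at this
      simp only [conj_trivial, mul_one] at this
      have h2 : 0 < r / 2 / |s| * (s * s) := by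
        have := mul_self_pos.2 hs0
        positivity
      nlinarith
    refine (hcore.frontier_subset hxf).resolve_right fun h => ?_
    simp only [mem_iUnion] at h
    obtain ⟨k, hk, hxk⟩ := h
    have e1 := (hcore.isPocket k hk).inner_eq_of_mem hf (openSegment_subset_segment _ _ _ hxk)
    obtain ⟨y, hy, hyc⟩ := hl
    obtain ⟨z, hz, hzc⟩ := hr
    rcases hcore.pocket_at_end hf hK hk with h | h
    · have := h z hz
      linarith
    · have := h y hy
      linarith
  have hpP : p ∈ frontier P := hbd (-1) (by norm_num) p hp hpc fun y hy hyc => by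
    linarith [(hext y hy hyc).1]
  have hqP : q ∈ frontier P := hbd 1 (by norm_num) q hq hqc fun y hy hyc => by
    linarith [(hext y hy hyc).2]
  obtain ⟨R₁, R₂, K₁, K₂, hcut⟩ := hcore.exists_coreCut hP hpP hqP hp hq hpq hos
  rcases hcut.cutK.eq_slices hs hl hr with ⟨h1, h2⟩ | ⟨h1, h2⟩
  · exact ⟨p, q, R₁, R₂, K₁, K₂, hcut, hs, h1, h2⟩
  · exact ⟨p, q, R₂, R₁, K₂, K₁, hcut.swap, hs, h1, h2⟩

end Pockets

/-! ### Choosing the cut at one end of the core -/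

lemma maxWidth_le {A : Set Plane} {D : ℝ} (h : ∀ x ∈ A, ∀ y ∈ A, dist x y ≤ D) :
    maxWidth A ≤ ENNReal.ofReal D := by
  refine iSup₂_le fun u hu => iSup₂_le fun x hx => iSup₂_le fun y hy => ?_
  refine ENNReal.ofReal_le_ofReal ?_
  have h1 := abs_real_inner_le_norm (x - y) u
  rw [mem_sphere_zero_iff_norm.1 hu, mul_one, ← dist_eq_norm] at h1
  exact h1.trans (h x hx y hy)

lemma le_minWidth {A : Set Plane} {D : ℝ}
    (h : ∀ u : Plane, ‖u‖ = 1 → ∃ x ∈ A, ∃ y ∈ A, D ≤ |inner ℝ (x - y) u|) :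
    ENNReal.ofReal D ≤ minWidth A := by
  refine le_iInf₂ fun u hu => ?_
  obtain ⟨x, hx, y, hy, hxy⟩ := h u (mem_sphere_zero_iff_norm.1 hu)
  exact le_iSup₂_of_le x hx (le_iSup₂_of_le y hy (ENNReal.ofReal_le_ofReal hxy))

/-- Let the convex set `K` be much longer than high and let its left end contain a vertical segment.
The lengths of the vertical slices of `K` at distance `H` from the left end exceed `ϑ H / 8` for
small `H`, but not for `H = 16 w / ϑ`. For the largest `H = 2 ^ (-j) * 16 w / ϑ` where they do, the
slice at distance `2 * H` is short, and by convexity so are the slices to the left of it. -/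
lemma IsFrame.exists_scale {ϑ : ℝ} {e f : Plane} {K : Set Plane}
    (hf : IsFrame f e) (hϑ₀ : 0 < ϑ) (hϑ₁ : ϑ < 1)
    (hK : Convex ℝ K) {w xl xr : ℝ} (hw : 0 < w)
    (hwY : ∀ x ∈ K, ∀ y ∈ K, |inner ℝ x e - inner ℝ y e| ≤ w)
    (hxl : ∀ x ∈ K, xl ≤ inner ℝ x f) {z : Plane} (hz : z ∈ K)
    (hzr : inner ℝ z f = xr) (hM : 32 * w ≤ ϑ * (xr - xl)) {a₀ b₀ : Plane} (ha₀ : a₀ ∈ K)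
    (hb₀ : b₀ ∈ K) (hab₀ : a₀ ≠ b₀) (ha₀l : inner ℝ a₀ f = xl) (hb₀l : inner ℝ b₀ f = xl) :
    ∃ H, 0 < H ∧ H ≤ (xr - xl) / 4 ∧
      (∃ a ∈ K, ∃ b ∈ K, inner ℝ a f = xl + H ∧ inner ℝ b f = xl + H ∧
        ϑ / 8 * H ≤ inner ℝ b e - inner ℝ a e) ∧
      (∀ a ∈ K, ∀ b ∈ K, inner ℝ a f = xl → inner ℝ b f = xl →
        |inner ℝ a e - inner ℝ b e| ≤ ϑ * (H / 2)) ∧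
      ∀ a ∈ K, ∀ b ∈ K, inner ℝ a f ≤ xl + H → inner ℝ b f ≤ xl + H →
        |inner ℝ a e - inner ℝ b e| ≤ 3 * H := by
  set δ := ϑ / 8 with hδ
  have hδ0 : 0 < δ := by positivity
  set M := xr - xl with hMdef
  have hM0 : 0 < M := by
    have : 0 < ϑ * M := by linarith
    exact pos_of_mul_pos_right this hϑ₀.le
  have hMw : 32 * w ≤ M := hM.trans (by nlinarith)
  -- moving a point of `K` horizontally, by convexity
  have hmove : ∀ a ∈ K, ∀ c, inner ℝ a f ≤ c → c ≤ xr → inner ℝ a f < xr → ∃ a' ∈ K,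
      inner ℝ a' f = c ∧ inner ℝ a' e = inner ℝ a e +
        (c - inner ℝ a f) / (xr - inner ℝ a f) * (inner ℝ z e - inner ℝ a e) := by
    intro a ha c hac hcr har
    have hpos : 0 < xr - inner ℝ a f := by linarith
    set s := (c - inner ℝ a f) / (xr - inner ℝ a f) with hs
    refine ⟨a + s • (z - a), hK.segment_subset ha hz ?_, ?_, ?_⟩
    · rw [segment_eq_image']
      exact ⟨s, ⟨div_nonneg (by linarith) hpos.le, (div_le_one hpos).2 (by linarith)⟩, rfl⟩
    · rw [inner_add_left, inner_smul_left, inner_sub_left, hzr]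
      simp only [conj_trivial, hs]
      field_simp
      ring
    · rw [inner_add_left, inner_smul_left, inner_sub_left]
      simp only [conj_trivial]
  -- a vertical segment at the left end, moved towards the point `z` at the right end
  have hchord : ∀ a ∈ K, ∀ b ∈ K, inner ℝ a f = xl → inner ℝ b f = xl → ∀ t, 0 ≤ t → t ≤ M →
      ∃ a' ∈ K, ∃ b' ∈ K, inner ℝ a' f = xl + t ∧ inner ℝ b' f = xl + t ∧
        inner ℝ b' e - inner ℝ a' e = (1 - t / M) * |inner ℝ a e - inner ℝ b e| := by
    intro a ha b hb hal hbl t ht htM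
    wlog hab : inner ℝ a e ≤ inner ℝ b e generalizing a b
    · rw [abs_sub_comm]
      exact this b hb a ha hbl hal (le_of_not_ge hab)
    obtain ⟨a', ha', ha1, ha2⟩ := hmove a ha (xl + t) (by linarith) (by linarith) (by linarith)
    obtain ⟨b', hb', hb1, hb2⟩ := hmove b hb (xl + t) (by linarith) (by linarith) (by linarith)
    refine ⟨a', ha', b', hb', ha1, hb1, ?_⟩
    rw [ha2, hb2, hal, hbl, abs_of_nonpos (by linarith), add_sub_cancel_left, ← hMdef]
    ring
  set h₀ := |inner ℝ a₀ e - inner ℝ b₀ e| with hh₀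
  have hh₀0 : 0 < h₀ := by
    rw [hh₀, abs_pos, sub_ne_zero]
    intro h
    exact hab₀ (hf.ext (ha₀l.trans hb₀l.symm) h)
  -- choosing the scale among `T / 2 ^ j`
  set T := 2 * w / δ with hT
  have hT0 : 0 < T := by positivity
  have hex : ∃ j : ℕ, ∃ a ∈ K, ∃ b ∈ K, inner ℝ a f = xl + T * (1 / 2) ^ j ∧
      inner ℝ b f = xl + T * (1 / 2) ^ j ∧ δ * (T * (1 / 2) ^ j) ≤ inner ℝ b e - inner ℝ a e := by
    have hpos : 0 < min M (h₀ / (δ + h₀ / M)) := lt_min hM0 (by positivity)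
    obtain ⟨j, hj⟩ := exists_pow_lt_of_lt_one (div_pos hpos hT0) (by norm_num : (1 / 2 : ℝ) < 1)
    rw [lt_div_iff₀ hT0, mul_comm] at hj
    have h1 := hj.le.trans (min_le_left _ _)
    have h2 := hj.le.trans (min_le_right _ _)
    have h3 : 0 ≤ T * (1 / 2) ^ j := by positivity
    refine ⟨j, ?_⟩
    set t := T * (1 / 2) ^ j
    obtain ⟨a, ha, b, hb, haf, hbf, hab⟩ := hchord _ ha₀ _ hb₀ ha₀l hb₀l t h3 h1
    refine ⟨a, ha, b, hb, haf, hbf, ?_⟩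
    rw [hab, ← hh₀]
    rw [le_div_iff₀ (by positivity)] at h2
    have : (1 - t / M) * h₀ = h₀ - t * (h₀ / M) := by ring
    rw [this]
    linarith
  classical
  have hS := Nat.find_spec hex
  have hmin := fun m (hm : m < Nat.find hex) => Nat.find_min hex hm
  have hj0 : Nat.find hex ≠ 0 := by
    intro h0
    rw [h0] at hS
    obtain ⟨a, ha, b, hb, -, -, hab⟩ := hS
    have h1 := (le_abs_self _).trans (hwY b hb a ha)
    have h2 : δ * (T * (1 / 2) ^ 0) = 2 * w := by rw [pow_zero, mul_one, hT]; field_simp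
    linarith
  obtain ⟨i, hi⟩ := Nat.exists_eq_succ_of_ne_zero hj0
  have hno := hmin i (by omega)
  rw [hi] at hS
  set H := T * (1 / 2) ^ (i + 1) with hH
  have hH2 : T * (1 / 2) ^ i = 2 * H := by rw [hH, pow_succ]; ring
  rw [hH2] at hno
  have hH0 : 0 < H := by positivity
  have hHM : H ≤ M / 4 := by
    have h1 : (1 / 2 : ℝ) ^ (i + 1) ≤ 1 / 2 := by
      rw [pow_succ]
      have : (1 / 2 : ℝ) ^ i ≤ 1 := pow_le_one₀ (by norm_num) (by norm_num)
      linarith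
    have h2 : H ≤ T * (1 / 2) := mul_le_mul_of_nonneg_left h1 hT0.le
    have h3 : T * (1 / 2) = 8 * w / ϑ := by rw [hT, hδ]; field_simp
    have h4 : 8 * w / ϑ ≤ M / 4 := by
      rw [div_le_iff₀ hϑ₀]; linarith
    linarith
  have hno' : ∀ a ∈ K, ∀ b ∈ K, inner ℝ a f = xl + 2 * H → inner ℝ b f = xl + 2 * H →
      inner ℝ b e - inner ℝ a e < δ * (2 * H) := by
    intro a ha b hb haf hbf
    by_contra! h
    exact hno ⟨a, ha, b, hb, haf, hbf, h⟩
  -- the chords of the pockets at the left end are short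
  have hshort : ∀ a ∈ K, ∀ b ∈ K, inner ℝ a f = xl → inner ℝ b f = xl →
      |inner ℝ a e - inner ℝ b e| ≤ 4 * δ * H := by
    intro a ha b hb hal hbl
    obtain ⟨a', ha', b', hb', h1, h2, h3⟩ := hchord a ha b hb hal hbl (2 * H) (by linarith)
      (by linarith)
    have h4 := hno' a' ha' b' hb' h1 h2
    rw [h3] at h4
    have h5 : 1 / 2 ≤ 1 - 2 * H / M := by
      have : 2 * H / M ≤ 1 / 2 := by rw [div_le_iff₀ hM0]; linarith
      linarith
    have := mul_le_mul_of_nonneg_right h5 (abs_nonneg (inner ℝ a e - inner ℝ b e))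
    linarith
  set c := xl + H with hc
  refine ⟨H, hH0, hHM, hS, fun a ha b hb hal hbl => (hshort a ha b hb hal hbl).trans_eq ?_, ?_⟩
  · rw [hδ]; ring
  -- points to the left of the cut are moved to the short slice at distance `2 * H`
  · show ∀ a ∈ K, ∀ b ∈ K, inner ℝ a f ≤ c → inner ℝ b f ≤ c → _
    have hm : ∀ a ∈ K, inner ℝ a f ≤ c → ∃ a' ∈ K, inner ℝ a' f = xl + 2 * H ∧
        |inner ℝ a' e - inner ℝ a e| ≤ H := by
      intro a ha hac
      obtain ⟨a', ha', h1, h2⟩ := hmove a ha (xl + 2 * H) (by linarith) (by linarith) (by linarith)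
      refine ⟨a', ha', h1, ?_⟩
      have h3 : 0 < xr - inner ℝ a f := by linarith
      have h4 := hxl a ha
      rw [h2, add_sub_cancel_left, abs_mul, abs_of_nonneg (div_nonneg (by linarith) h3.le),
        div_mul_eq_mul_div, div_le_iff₀ h3]
      have h5 := hwY z hz a ha
      have h6 : (xl + 2 * H - inner ℝ a f) * |inner ℝ z e - inner ℝ a e| ≤ 2 * H * w :=
        mul_le_mul (by linarith) h5 (abs_nonneg _) (by linarith)
      have h7 : 2 * H * w ≤ H * (xr - inner ℝ a f) := by
        have : 2 * w ≤ xr - inner ℝ a f := by linarith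
        nlinarith
      linarith
    intro a ha b hb hac hbc
    obtain ⟨a', ha', h1, h2⟩ := hm a ha hac
    obtain ⟨b', hb', h3, h4⟩ := hm b hb hbc
    have h5 := hno' a' ha' b' hb' h1 h3
    have h6 := hno' b' hb' a' ha' h3 h1
    have h7 : δ * (2 * H) ≤ H := by nlinarith
    rw [abs_le] at h2 h4 ⊢
    constructor <;> linarith [h2.1, h2.2, h4.1, h4.2]

/-- Let the convex core `K` be much longer than high and let there be a pocket at its left end.
Then `P` can be cut along a vertical slice of `K` at a distance `H` from the left end, such that
the slice has length at least `ϑ H / 8` while the slice at distance `2 H` has length less than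
`ϑ H / 4`. The latter forces the pockets to have size at most `H / 2`, by convexity of `K` and since
the diameter of a pocket is controlled by the length of its chord. -/
theorem IsCore.exists_end {ϑ : ℝ} {e f : Plane} {P K : Set Plane} {F : Set Pocket}
    (hf : IsFrame f e) (hϑ₀ : 0 < ϑ) (hϑ₁ : ϑ < 1) (hP : IsPolygon P) (hcore : IsCore ϑ e P K F)
    (hK : Convex ℝ K) {w xl xr : ℝ} (hw : 0 < w)
    (hwY : ∀ x ∈ K, ∀ y ∈ K, |inner ℝ x e - inner ℝ y e| ≤ w)
    (hxl : ∀ x ∈ K, xl ≤ inner ℝ x f) {z : Plane} (hz : z ∈ K)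
    (hzr : inner ℝ z f = xr) (hM : 32 * w ≤ ϑ * (xr - xl)) {k₀ : Pocket} (hk₀ : k₀ ∈ F)
    (hk₀l : inner ℝ k₀.p f = xl) :
    ∃ c p q R₁ R₂ K₁ K₂, IsCoreCut P K F p q R₁ R₂ K₁ K₂ ∧ xl < c ∧ c ≤ xl + (xr - xl) / 4 ∧
      K ∩ {x | inner ℝ x f = c} = segment ℝ p q ∧
      K₁ = K ∩ {x | inner ℝ x f ≤ c} ∧ K₂ = K ∩ {x | c ≤ inner ℝ x f} ∧ dist p q ≤ w ∧
      maxWidth R₁ ≤ ENNReal.ofReal (400 / ϑ) * minWidth R₁ ∧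
      ∀ v ∈ concaveVertices R₁,
        maxWidth R₁ ≤ ENNReal.ofReal (400 / ϑ) * Metric.infEDist v (segment ℝ p q) := by
  set δ := ϑ / 8 with hδ
  have hδ0 : 0 < δ := by positivity
  set M := xr - xl with hMdef
  have hM0 : 0 < M := by
    have : 0 < ϑ * M := by linarith
    exact pos_of_mul_pos_right this hϑ₀.le
  have hMw : 32 * w ≤ M := hM.trans (by nlinarith)
  have hKJ := hcore.isPolygon.isJordanRegion
  have hpocket : ∀ k ∈ F, k.p ∈ K ∧ k.q ∈ K := fun k hk =>
    ⟨hKJ.frontier_subset ((hcore.isPocket k hk).segment_subset_frontier (left_mem_segment _ _ _)),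
      hKJ.frontier_subset ((hcore.isPocket k hk).segment_subset_frontier (right_mem_segment _ _ _))⟩
  obtain ⟨hk₀p, hk₀q⟩ := hpocket k₀ hk₀
  have hk₀ql : inner ℝ k₀.q f = xl := by rw [← (hcore.isPocket k₀ hk₀).inner_eq hf, hk₀l]
  obtain ⟨H, hH0, hHM, ⟨a₁, ha₁, b₁, hb₁, ha₁c, hb₁c, hab₁⟩, hshort, hheight⟩ :=
    hf.exists_scale hϑ₀ hϑ₁ hK hw hwY hxl hz hzr hM hk₀p hk₀q (hcore.isPocket k₀ hk₀).ne hk₀l hk₀ql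
  change δ * H ≤ _ at hab₁
  set c := xl + H with hc
  have hδH : 0 < δ * H := by positivity
  obtain ⟨p, q, R₁, R₂, K₁, K₂, hcut, hs, hK₁, hK₂⟩ := hcore.exists_slice hf hP hK
    ⟨k₀.p, hk₀p, by linarith⟩ ⟨z, hz, by linarith⟩
    ⟨a₁, ha₁, b₁, hb₁, ha₁c, hb₁c, by rintro rfl; linarith⟩
  have hsegK : ∀ x ∈ segment ℝ p q, x ∈ K ∧ inner ℝ x f = c := fun x hx => by
    rw [← hs] at hx; exact hx
  have hK₁R : K₁ ⊆ R₁ := hcut.subset₁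
  have hR₁ := hcut.eq_union hcore
  -- only the pockets at the left end belong to the piece
  have hleft : ∀ k ∈ {k ∈ F | k.R ⊆ R₁ ∧ segment ℝ k.p k.q ⊆ K₁},
      inner ℝ k.p f = xl ∧ k.p ∈ K₁ ∧ ∀ x ∈ k.R, dist x k.p ≤ H / 2 := by
    rintro k ⟨hk, -, hkK⟩
    have hk' := hcore.isPocket k hk
    have hpK := hkK (left_mem_segment _ _ _)
    have hkl : inner ℝ k.p f = xl := by
      have h1 := hpK
      rw [hK₁] at h1
      have h1 : inner ℝ k.p f ≤ c := h1.2
      rcases hcore.pocket_at_end hf hK hk with h | h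
      · have := h z hz
        linarith
      · exact le_antisymm (by rw [← hk₀l]; exact h _ hk₀p) (hxl _ (hpocket k hk).1)
    refine ⟨hkl, hpK, fun x hx => ?_⟩
    have h2 := hk'.dist_le x hx k.p (hk'.segment_subset (left_mem_segment _ _ _))
    rw [hf.dist_eq (hk'.inner_eq hf)] at h2
    have h3 := hshort _ (hpocket k hk).1 _ (hpocket k hk).2 hkl (by
      rw [← hk'.inner_eq hf, hkl])
    have h4 : ϑ * dist x k.p ≤ ϑ * (H / 2) := by
      linarith
    exact le_of_mul_le_mul_left h4 hϑ₀
  have hnear : ∀ x ∈ R₁, ∃ y ∈ K₁, dist x y ≤ H / 2 := by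
    intro x hx
    rw [hR₁] at hx
    rcases hx with hx | hx
    · exact ⟨x, hx, by rw [dist_self]; linarith⟩
    · simp only [mem_iUnion] at hx
      obtain ⟨k, hk, hxk⟩ := hx
      obtain ⟨-, h1, h2⟩ := hleft k hk
      exact ⟨k.p, h1, h2 x hxk⟩
  have hdiam : ∀ x ∈ R₁, ∀ y ∈ R₁, dist x y ≤ 5 * H := by
    intro x hx y hy
    obtain ⟨x', hx', hxx⟩ := hnear x hx
    obtain ⟨y', hy', hyy⟩ := hnear y hy
    rw [hK₁] at hx' hy'
    have h1 : inner ℝ x' f ≤ c := hx'.2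
    have h2 : inner ℝ y' f ≤ c := hy'.2
    have h3 := hheight x' hx'.1 y' hy'.1 h1 h2
    have h4 : |inner ℝ x' f - inner ℝ y' f| ≤ H := by
      have := hxl x' hx'.1
      have := hxl y' hy'.1
      rw [abs_le]; constructor <;> linarith
    have h5 := hf.dist_le x' y'
    have h6 := dist_triangle4 x x' y' y
    rw [dist_comm y y'] at hyy
    linarith
  have hmax : maxWidth R₁ ≤ ENNReal.ofReal (5 * H) := maxWidth_le hdiam
  have hmw : ENNReal.ofReal (δ * H / 10) ≤ minWidth R₁ := by
    have hmemR : ∀ x ∈ K, inner ℝ x f ≤ c → x ∈ R₁ := fun x hx hxc =>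
      hK₁R (by rw [hK₁]; exact ⟨hx, hxc⟩)
    refine le_minWidth fun u hu => ?_
    have hu2 : inner ℝ u f ^ 2 + inner ℝ u e ^ 2 = 1 := by rw [← hf.norm_sq_eq, hu, one_pow]
    -- the slice is wide in direction `u` unless `u` is almost horizontal, in which case the
    -- horizontal extent `H` of the piece suffices
    rcases le_or_gt (1 / 10) |inner ℝ u e| with hue | hue
    · refine ⟨b₁, hmemR _ hb₁ hb₁c.le, a₁, hmemR _ ha₁ ha₁c.le, ?_⟩
      rw [hf.inner_eq, inner_sub_left, inner_sub_left, ha₁c, hb₁c, sub_self, zero_mul, zero_add,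
        abs_mul, abs_of_nonneg (by linarith)]
      have h1 : δ * H ≤ inner ℝ b₁ e - inner ℝ a₁ e := hab₁
      have h2 : δ * H * (1 / 10) ≤ (inner ℝ b₁ e - inner ℝ a₁ e) * |inner ℝ u e| :=
        mul_le_mul h1 hue (by norm_num) (by linarith)
      linarith
    · refine ⟨a₁, hmemR _ ha₁ ha₁c.le, k₀.p, hmemR _ hk₀p (by linarith), ?_⟩
      rw [hf.inner_eq, inner_sub_left, inner_sub_left, ha₁c, hk₀l, hc, add_sub_cancel_left]
      have h1 := hheight _ ha₁ _ hk₀p ha₁c.le (by linarith)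
      have h2 : |(inner ℝ a₁ e - inner ℝ k₀.p e) * inner ℝ u e| ≤ 3 * H * (1 / 10) := by
        rw [abs_mul]
        exact mul_le_mul h1 hue.le (abs_nonneg _) (by linarith)
      have h3 : 9 / 10 ≤ |inner ℝ u f| := by
        apply le_of_sq_le_sq _ (abs_nonneg _)
        rw [sq_abs]
        have : inner ℝ u e ^ 2 ≤ (1 / 10) ^ 2 := by
          rw [← sq_abs]
          exact pow_le_pow_left₀ (abs_nonneg _) hue.le 2
        linarith
      have h4 : H * (9 / 10) ≤ |H * inner ℝ u f| := by
        rw [abs_mul, abs_of_pos hH0]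
        exact mul_le_mul_of_nonneg_left h3 hH0.le
      have h5 := abs_sub_abs_le_abs_sub (H * inner ℝ u f)
        (-((inner ℝ a₁ e - inner ℝ k₀.p e) * inner ℝ u e))
      rw [abs_neg, sub_neg_eq_add] at h5
      have h6 : δ * H ≤ H := by nlinarith
      linarith
  have hC : (0 : ℝ) ≤ 400 / ϑ := by positivity
  refine ⟨c, p, q, R₁, R₂, K₁, K₂, hcut, by linarith, by linarith, hs, hK₁, hK₂, ?_, ?_, ?_⟩
  · obtain ⟨h1, h2⟩ := hsegK p (left_mem_segment _ _ _)
    obtain ⟨h3, h4⟩ := hsegK q (right_mem_segment _ _ _)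
    rw [hf.dist_eq (h2.trans h4.symm)]
    exact hwY p h1 q h3
  · refine hmax.trans (le_trans ?_ (mul_le_mul_right hmw _))
    rw [← ENNReal.ofReal_mul hC]
    apply ENNReal.ofReal_le_ofReal
    have : 400 / ϑ * (δ * H / 10) = 5 * H := by rw [hδ]; field_simp; norm_num
    rw [this]
  · intro v hv
    -- a concave vertex belongs to a pocket, since otherwise the piece is convex nearby
    have hvk : ∃ k ∈ {k ∈ F | k.R ⊆ R₁ ∧ segment ℝ k.p k.q ⊆ K₁}, v ∈ k.R := by
      by_contra! hnot
      have hclosed : IsClosed (⋃ k ∈ {k ∈ F | k.R ⊆ R₁ ∧ segment ℝ k.p k.q ⊆ K₁}, k.R) :=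
        (hcore.finite.subset (sep_subset _ _)).isClosed_biUnion fun k hk =>
          (hcore.isPocket k hk.1).isPolygon.isJordanRegion.isClosed
      have hvn : v ∉ ⋃ k ∈ {k ∈ F | k.R ⊆ R₁ ∧ segment ℝ k.p k.q ⊆ K₁}, k.R := by
        simp only [mem_iUnion, not_exists]
        exact fun k hk => hnot k hk
      obtain ⟨r, hr, hb⟩ := Metric.isOpen_iff.1 hclosed.isOpen_compl v hvn
      have hconv : Convex ℝ K₁ := by
        rw [hK₁]
        refine hK.inter fun x hx y hy a b ha hb hab => ?_
        have hx : inner ℝ x f ≤ c := hx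
        have hy : inner ℝ y f ≤ c := hy
        change inner ℝ (a • x + b • y) f ≤ c
        rw [inner_add_left, inner_smul_left, inner_smul_left]
        simp only [conj_trivial]
        have h1 := mul_le_mul_of_nonneg_left hx ha
        have h2 := mul_le_mul_of_nonneg_left hy hb
        have h3 : a * c + b * c = c := by rw [← add_mul, hab, one_mul]
        linarith
      refine not_convex_of_mem_concaveVertices hv hconv
        hcut.cutK.isPolygon₁.isJordanRegion.closure_interior.ge hr fun x hx => ?_
      constructor
      · intro hxR
        rw [hR₁] at hxR
        exact hxR.resolve_right (hb hx)
      · exact fun hxK => hK₁R hxK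
    obtain ⟨k, hk, hvk⟩ := hvk
    obtain ⟨h1, -, h2⟩ := hleft k hk
    have hvf : inner ℝ v f ≤ xl + H / 2 := by
      have := (le_abs_self _).trans ((hf.abs_inner_f_le v k.p).trans (h2 v hvk))
      linarith
    have hdist : ENNReal.ofReal (H / 2) ≤ Metric.infEDist v (segment ℝ p q) := by
      refine Metric.le_infEDist.2 fun y hy => ?_
      rw [edist_dist]
      apply ENNReal.ofReal_le_ofReal
      have h3 := (hsegK y hy).2
      have h4 := (neg_le_abs _).trans (hf.abs_inner_f_le v y)
      linarith
    refine hmax.trans (le_trans ?_ (mul_le_mul_right hdist _))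
    rw [← ENNReal.ofReal_mul hC]
    apply ENNReal.ofReal_le_ofReal
    rw [div_mul_eq_mul_div, le_div_iff₀ hϑ₀]
    nlinarith

/-! ### The partition -/

section Partition

/-- The properties required of the piece `R` that the segment `S` cuts off from `P`. The constant
`400 / ϑ` is the ratio of `5 H`, which bounds the diameter of the pieces from above, and `ϑ H / 80`,
which bounds their minimal width from below. -/
structure IsGoodPiece (ϑ : ℝ) (P S R : Set Plane) : Prop where
  length_le : Measure.hausdorffMeasure 1 S ≤
    ENNReal.ofReal ϑ * Measure.hausdorffMeasure 1 (frontier P)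
  width_le : maxWidth R ≤ ENNReal.ofReal (400 / ϑ) * minWidth R
  infEDist_le : ∀ v ∈ concaveVertices R,
    maxWidth R ≤ ENNReal.ofReal (400 / ϑ) * Metric.infEDist v S

lemma maxWidth_empty : maxWidth ∅ = 0 := by
  simp [maxWidth, widthAlong]

lemma IsGoodPiece.empty (ϑ : ℝ) (P : Set Plane) : IsGoodPiece ϑ P ∅ ∅ where
  length_le := by simp
  width_le := by simp [maxWidth_empty]
  infEDist_le := by simp [maxWidth_empty]

variable {ϑ : ℝ} {e f : Plane} {P K : Set Plane} {F : Set Pocket}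

lemma IsPreconnected.exists_mem_frontier {X : Type*} [TopologicalSpace X] {t s : Set X}
    (ht : IsPreconnected t) (hs : (t ∩ s).Nonempty) (hsc : (t ∩ sᶜ).Nonempty) :
    ∃ x ∈ t, x ∈ frontier s := by
  by_contra! h
  obtain ⟨x, hxt, hxs⟩ := hs
  obtain ⟨y, hyt, hys⟩ := hsc
  rcases ht.subset_or_subset isOpen_interior isClosed_closure.isOpen_compl
    (disjoint_compl_right.mono_left interior_subset_closure) (fun z hz => by
      by_contra hzn
      rw [mem_union, not_or, notMem_compl_iff] at hzn
      exact h z hz ⟨hzn.2, hzn.1⟩) with h1 | h1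
  · exact hys (interior_subset (h1 hyt))
  · exact h1 hxt (subset_closure hxs)

/-- The boundary of a bounded set is at least as long as the horizontal extent of a convex subset,
since it meets each vertical line through a point of the set. -/
lemma IsFrame.ofReal_le_hausdorffMeasure_frontier (hf : IsFrame f e)
    (hP : Bornology.IsBounded P) (hK : Convex ℝ K) (hKP : K ⊆ P) {a b : Plane} (ha : a ∈ K)
    (hb : b ∈ K) :
    ENNReal.ofReal (inner ℝ b f - inner ℝ a f) ≤ Measure.hausdorffMeasure 1 (frontier P) := by
  have hlip : LipschitzWith 1 fun x : Plane => inner ℝ x f :=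
    LipschitzWith.of_dist_le_mul fun x y => by
      rw [NNReal.coe_one, one_mul, Real.dist_eq]
      exact hf.abs_inner_f_le x y
  have himage : Icc (inner ℝ a f) (inner ℝ b f) ⊆ (fun x : Plane => inner ℝ x f) '' frontier P := by
    intro t ht
    obtain ⟨x, hx, hxt⟩ := hK.isPreconnected.intermediate_value ha hb
      hlip.continuous.continuousOn ht
    obtain ⟨r, hr⟩ := hP.exists_norm_le
    have hline : IsPreconnected (range fun s : ℝ => x + s • e) :=
      isPreconnected_range (by fun_prop)
    obtain ⟨y, ⟨s, rfl⟩, hy⟩ := hline.exists_mem_frontier (s := P)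
      ⟨x, ⟨0, by simp⟩, hKP hx⟩
      ⟨x + (r + 1 - inner ℝ x e) • e, ⟨_, rfl⟩, fun h => by
        have h1 := (real_inner_le_norm (x + (r + 1 - inner ℝ x e) • e) e).trans_eq
          (by rw [hf.norm_eq_one, mul_one])
        rw [inner_add_left, inner_smul_left, hf.inner_e_e] at h1
        simp only [conj_trivial] at h1
        linarith [hr _ h]⟩
    refine ⟨_, hy, ?_⟩
    change inner ℝ (x + s • e) f = t
    rw [inner_add_left, inner_smul_left, hf.inner_e_f, mul_zero, add_zero]
    exact hxt
  calc ENNReal.ofReal (inner ℝ b f - inner ℝ a f)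
      = Measure.hausdorffMeasure 1 (Icc (inner ℝ a f) (inner ℝ b f)) := by
        rw [hausdorffMeasure_real, Real.volume_Icc]
    _ ≤ _ := measure_mono himage
    _ ≤ _ := by simpa using hlip.hausdorffMeasure_image_le zero_le_one (frontier P)

lemma convex_setOf_le_inner (f : Plane) (c : ℝ) : Convex ℝ {x : Plane | c ≤ inner ℝ x f} :=
  convex_halfSpace_ge (𝕜 := ℝ) (f := fun x : Plane => inner ℝ x f)
    ⟨fun x y => inner_add_left x y f, fun a x => by simp [inner_smul_left]⟩ c

/-- The core is long in horizontal direction and has height at most `w`. Its left and right ends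
are at `xl` and `xr`. By the factor `32` the scale in `IsFrame.exists_scale` is at most a quarter of
the length of the core, which leaves room for a cut at each end. -/
structure IsLongCore (ϑ : ℝ) (f e : Plane) (P K : Set Plane) (F : Set Pocket) (w xl xr : ℝ) :
    Prop where
  isFrame : IsFrame f e
  isCore : IsCore ϑ e P K F
  convex : Convex ℝ K
  pos : 0 < w
  height_le : ∀ x ∈ K, ∀ y ∈ K, |inner ℝ x e - inner ℝ y e| ≤ w
  left_le : ∀ x ∈ K, xl ≤ inner ℝ x f
  le_right : ∀ x ∈ K, inner ℝ x f ≤ xr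
  exists_left : ∃ x ∈ K, inner ℝ x f = xl
  exists_right : ∃ x ∈ K, inner ℝ x f = xr
  long : 32 * w ≤ ϑ * (xr - xl)

namespace IsLongCore

variable {w xl xr : ℝ}

lemma neg (h : IsLongCore ϑ f e P K F w xl xr) :
    IsLongCore ϑ (-f) e P K F w (-xr) (-xl) where
  isFrame := h.isFrame.neg
  isCore := h.isCore
  convex := h.convex
  pos := h.pos
  height_le := h.height_le
  left_le x hx := by rw [inner_neg_right]; exact neg_le_neg (h.le_right x hx)
  le_right x hx := by rw [inner_neg_right]; exact neg_le_neg (h.left_le x hx)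
  exists_left := by simpa [inner_neg_right] using h.exists_right
  exists_right := by simpa [inner_neg_right] using h.exists_left
  long := by rw [neg_sub_neg]; exact h.long

lemma eq_or_eq (h : IsLongCore ϑ f e P K F w xl xr) {k : Pocket} (hk : k ∈ F) :
    inner ℝ k.p f = xl ∨ inner ℝ k.p f = xr := by
  have hkK := h.isCore.isPolygon.isJordanRegion.frontier_subset
    ((h.isCore.isPocket k hk).segment_subset_frontier (left_mem_segment _ _ _))
  rcases h.isCore.pocket_at_end h.isFrame h.convex hk with h1 | h1
  · obtain ⟨x, hx, rfl⟩ := h.exists_right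
    exact Or.inr (le_antisymm (h.le_right _ hkK) (h1 x hx))
  · obtain ⟨x, hx, rfl⟩ := h.exists_left
    exact Or.inl (le_antisymm (h1 x hx) (h.left_le _ hkK))

/-- If there is a pocket at the left end, a vertical slice of the core cuts off a good piece. -/
lemma exists_goodPiece (h : IsLongCore ϑ f e P K F w xl xr) (hϑ₀ : 0 < ϑ) (hϑ₁ : ϑ < 1)
    (hP : IsPolygon P) (hleft : ∃ k ∈ F, inner ℝ k.p f = xl) :
    ∃ c p q R₁ R₂ K₁ K₂, IsCoreCut P K F p q R₁ R₂ K₁ K₂ ∧ xl < c ∧ c ≤ xl + (xr - xl) / 4 ∧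
      K ∩ {x | inner ℝ x f = c} = segment ℝ p q ∧
      K₁ = K ∩ {x | inner ℝ x f ≤ c} ∧ K₂ = K ∩ {x | c ≤ inner ℝ x f} ∧
      IsGoodPiece ϑ P (segment ℝ p q) R₁ := by
  obtain ⟨k₀, hk₀, hk₀l⟩ := hleft
  obtain ⟨a, ha, hal⟩ := h.exists_left
  obtain ⟨z, hz, hzr⟩ := h.exists_right
  obtain ⟨c, p, q, R₁, R₂, K₁, K₂, hcut, h1, h2, h3, h4, h5, h6, h7, h8⟩ :=
    h.isCore.exists_end h.isFrame hϑ₀ hϑ₁ hP h.convex h.pos h.height_le h.left_le hz hzr h.long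
      hk₀ hk₀l
  refine ⟨c, p, q, R₁, R₂, K₁, K₂, hcut, h1, h2, h3, h4, h5, ?_, h7, h8⟩
  have hb := h.isFrame.ofReal_le_hausdorffMeasure_frontier hP.isJordanRegion.isCompact.isBounded
    h.convex h.isCore.subset ha hz
  rw [hal, hzr] at hb
  rw [hausdorffMeasure_segment, edist_dist]
  calc ENNReal.ofReal (dist p q) ≤ ENNReal.ofReal (ϑ * (xr - xl)) :=
        ENNReal.ofReal_le_ofReal (by linarith [h.long, h.pos])
    _ = ENNReal.ofReal ϑ * ENNReal.ofReal (xr - xl) := ENNReal.ofReal_mul hϑ₀.le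
    _ ≤ _ := mul_le_mul_right hb _

/-- If all pockets are at the left end, a single cut suffices. -/
lemma exists_partition_of_left (h : IsLongCore ϑ f e P K F w xl xr) (hϑ₀ : 0 < ϑ) (hϑ₁ : ϑ < 1)
    (hP : IsPolygon P) (hleft : ∃ k ∈ F, inner ℝ k.p f = xl)
    (hright : ¬ ∃ k ∈ F, inner ℝ k.p f = xr) :
    ∃ (S Q : Fin 2 → Set Plane) (P' : Set Plane), IsTwoSegmentPartition P S Q P' ∧
      ∀ i, IsGoodPiece ϑ P (S i) (Q i) := by
  obtain ⟨c, p, q, R₁, R₂, K₁, K₂, hcut, hc, -, hs, hK₁, hK₂, hgood⟩ :=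
    h.exists_goodPiece hϑ₀ hϑ₁ hP hleft
  have hR₂ : R₂ = K₂ := by
    refine subset_antisymm ?_ hcut.subset₂
    rw [hcut.swap.eq_union h.isCore]
    refine union_subset subset_rfl (iUnion₂_subset ?_)
    rintro k ⟨hk, -, hkK⟩
    have h1 := hkK (left_mem_segment _ _ _)
    rw [hK₂] at h1
    have h1 : c ≤ inner ℝ k.p f := h1.2
    rcases h.eq_or_eq hk with h2 | h2
    · linarith
    · exact absurd ⟨k, hk, h2⟩ hright
  rw [hR₂] at hcut
  refine ⟨![segment ℝ p q, ∅], ![R₁, ∅], K₂, Or.inr ⟨hcut.cutK.isPolygon₂, ?_, ?_, ?_, ?_⟩, ?_⟩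
  · rw [hK₂]
    exact h.convex.inter (convex_setOf_le_inner f c)
  · simpa using hcut.cutP.union_eq
  · rw [Fin.forall_fin_two]
    exact ⟨hcut.cutP.inter_eq.symm, by simp⟩
  · intro i j hij
    fin_cases i <;> fin_cases j
    · exact absurd rfl hij
    · exact Or.inr ⟨p, q, rfl, by simpa using hcut.cutP.inducesPartition⟩
    · exact Or.inl ⟨rfl, rfl, by simpa [union_comm] using hcut.cutP.union_eq.symm⟩
    · exact absurd rfl hij
  · rw [Fin.forall_fin_two]
    exact ⟨hgood, IsGoodPiece.empty ϑ P⟩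

end IsLongCore

/-- Let two cuts separate the core into a left, a middle and a right part such that no pocket
belongs to the middle part. Then the complementary piece of the left cut consists of the middle
part and of the piece that the right cut cuts off. -/
lemma IsCoreCut.right_eq {p q p' q' : Plane} {R₁ R₂ K₁ K₂ R₁' R₂' K₁' K₂' : Set Plane}
    (h : IsCoreCut P K F p q R₁ R₂ K₁ K₂) (h' : IsCoreCut P K F p' q' R₁' R₂' K₁' K₂')
    (hcore : IsCore ϑ e P K F) (hsub : K₁' ⊆ K₂) (hdisj : Disjoint K₁ K₁')
    (hF : ∀ k ∈ F, k.p ∉ K₂ ∩ K₂') : R₂ = K₂ ∩ K₂' ∪ R₁' := by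
  apply subset_antisymm
  · rw [h.swap.eq_union hcore]
    refine union_subset (fun x hx => ?_) (iUnion₂_subset ?_)
    · have hxK := h.cutK.swap.subset₁ hx
      rw [h'.cutK.union_eq] at hxK
      exact hxK.elim (fun h1 => Or.inr (h'.subset₁ h1)) fun h1 => Or.inl ⟨hx, h1⟩
    · rintro k ⟨hk, -, hkK⟩
      rcases h'.pocket k hk with h1 | h1
      · exact subset_union_of_subset_right h1.1 _
      · exact absurd ⟨hkK (left_mem_segment _ _ _), h1.2 (left_mem_segment _ _ _)⟩ (hF k hk)
  · refine union_subset (inter_subset_left.trans h.subset₂) ?_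
    rw [h'.eq_union hcore]
    refine union_subset (hsub.trans h.subset₂) (iUnion₂_subset ?_)
    rintro k ⟨hk, -, hkK⟩
    rcases h.pocket k hk with h1 | h1
    · exact absurd (hkK (left_mem_segment _ _ _))
        (Set.disjoint_left.1 hdisj (h1.2 (left_mem_segment _ _ _)))
    · exact h1.1

/-- The part of the core between two vertical slices is a polygon. -/
lemma IsCoreCut.isPolygon_inter {p q p' q' : Plane} {R₁ R₂ K₁ K₂ R₁' R₂' K₁' K₂' : Set Plane}
    (h : IsCoreCut P K F p q R₁ R₂ K₁ K₂) (h' : IsCoreCut P K F p' q' R₁' R₂' K₁' K₂')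
    (hcore : IsCore ϑ e P K F) {c c' : ℝ} (hcc : c < c')
    (hs : K ∩ {x | inner ℝ x f = c} = segment ℝ p q)
    (hs' : K ∩ {x | inner ℝ x f = c'} = segment ℝ p' q')
    (hK₂ : K₂ = K ∩ {x | c ≤ inner ℝ x f}) (hK₂' : K₂' = K ∩ {x | inner ℝ x f ≤ c'})
    (hr : ∃ x ∈ K, c' < inner ℝ x f) : IsPolygon (K₂ ∩ K₂') := by
  have hJ₂ := h.cutK.isPolygon₂.isJordanRegion
  have hmem : ∀ x ∈ segment ℝ p' q', x ∈ K ∧ inner ℝ x f = c' := fun x hx => by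
    rw [← hs'] at hx; exact hx
  have hmem₂ : ∀ x ∈ segment ℝ p' q', x ∈ K₂ := fun x hx => by
    rw [hK₂]; exact ⟨(hmem x hx).1, hcc.le.trans_eq (hmem x hx).2.symm⟩
  have hfr : ∀ x ∈ segment ℝ p' q', x ∈ frontier P → x ∈ frontier K₂ := fun x hx hxP =>
    hJ₂.mem_frontier.2 ⟨hmem₂ x hx, fun hi => hxP.2
      (interior_mono (h.cutK.swap.subset₁.trans hcore.subset) hi)⟩
  obtain ⟨A, B, hAB⟩ := h.cutK.isPolygon₂.exists_chordCut
    (hfr p' (left_mem_segment _ _ _) h'.cutP.left_mem)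
    (hfr q' (right_mem_segment _ _ _) h'.cutP.right_mem) h'.cutP.ne (fun x hx => by
      have hopen : IsOpen (interior K ∩ {x | c < inner ℝ x f}) :=
        isOpen_interior.inter (isOpen_lt continuous_const (by fun_prop))
      refine interior_maximal ?_ hopen ⟨h'.cutK.openSegment_subset hx,
        hcc.trans_eq (hmem x (openSegment_subset_segment _ _ _ hx)).2.symm⟩
      rw [hK₂]
      exact fun y hy => ⟨interior_subset hy.1, le_of_lt (show c < inner ℝ y f from hy.2)⟩)
  have heq : K₂ ∩ K₂' = K₂ ∩ {x | inner ℝ x f ≤ c'} := by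
    rw [hK₂', ← inter_assoc, inter_eq_left.2 h.cutK.swap.subset₁]
  have hs₂ : K₂ ∩ {x | inner ℝ x f = c'} = segment ℝ p' q' := by
    refine subset_antisymm ?_ fun x hx => ⟨hmem₂ x hx, (hmem x hx).2⟩
    rw [← hs']
    exact inter_subset_inter_left _ h.cutK.swap.subset₁
  have hp := left_mem_segment ℝ p q
  have hp' := hp
  rw [← hs] at hp'
  obtain ⟨z, hz, hzr⟩ := hr
  rw [heq]
  rcases hAB.eq_slices hs₂ ⟨p, h.cutK.swap.segment_subset₁ hp, by rw [hp'.2]; exact hcc⟩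
    ⟨z, by rw [hK₂]; exact ⟨hz, hcc.le.trans hzr.le⟩, hzr⟩ with h1 | h1
  · exact h1.1 ▸ hAB.isPolygon₁
  · exact h1.1 ▸ hAB.isPolygon₂

namespace IsLongCore

variable {w xl xr : ℝ}

/-- If there are pockets at both ends, the core is cut near both of them. -/
lemma exists_partition_of_left_of_right (h : IsLongCore ϑ f e P K F w xl xr) (hϑ₀ : 0 < ϑ)
    (hϑ₁ : ϑ < 1) (hP : IsPolygon P) (hleft : ∃ k ∈ F, inner ℝ k.p f = xl)
    (hright : ∃ k ∈ F, inner ℝ k.p f = xr) :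
    ∃ (S Q : Fin 2 → Set Plane) (P' : Set Plane), IsTwoSegmentPartition P S Q P' ∧
      ∀ i, IsGoodPiece ϑ P (S i) (Q i) := by
  obtain ⟨c, p, q, R₁, R₂, K₁, K₂, hcut, hlc, hcM, hs, hK₁, hK₂, hgood⟩ :=
    h.exists_goodPiece hϑ₀ hϑ₁ hP hleft
  obtain ⟨d, p', q', R₁', R₂', K₁', K₂', hcut', hrd, hdM, hs', hK₁', hK₂', hgood'⟩ :=
    h.neg.exists_goodPiece hϑ₀ hϑ₁ hP (by simpa [inner_neg_right] using hright)
  simp only [inner_neg_right, neg_eq_iff_eq_neg, neg_le, le_neg] at hs' hK₁' hK₂'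
  have hlr : 0 < xr - xl := by
    have h1 := h.long
    have h2 := h.pos
    exact pos_of_mul_pos_right (by linarith : 0 < ϑ * (xr - xl)) hϑ₀.le
  obtain ⟨c', rfl⟩ : ∃ c', d = -c' := ⟨-d, (neg_neg d).symm⟩
  rw [neg_neg] at hs' hK₁' hK₂'
  have hcc : c < c' := by linarith
  have hsub : K₁' ⊆ K₂ := by
    rw [hK₁', hK₂]
    exact fun x hx => ⟨hx.1, hcc.le.trans hx.2⟩
  have hsub' : K₁ ⊆ K₂' := by
    rw [hK₁, hK₂']
    exact fun x hx => ⟨hx.1, le_trans hx.2 hcc.le⟩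
  have hdisj : Disjoint K₁ K₁' := by
    rw [hK₁, hK₁', Set.disjoint_left]
    exact fun x hx hx' => absurd (le_trans hx'.2 hx.2) (not_le.2 hcc)
  -- the pockets are at the ends of the core
  have hF : ∀ k ∈ F, k.p ∉ K₂ ∩ K₂' := by
    rintro k hk ⟨h1, h2⟩
    rw [hK₂] at h1
    rw [hK₂'] at h2
    have h1 : c ≤ inner ℝ k.p f := h1.2
    have h2 : inner ℝ k.p f ≤ c' := h2.2
    rcases h.eq_or_eq hk with h3 | h3 <;> linarith
  have hR := hcut.right_eq hcut' h.isCore hsub hdisj hF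
  have hR' := hcut'.right_eq hcut h.isCore hsub' hdisj.symm (by rwa [inter_comm K₂'])
  rw [inter_comm K₂'] at hR'
  obtain ⟨z, hz, hzr⟩ := h.exists_right
  have hsP : segment ℝ p q ⊆ K₂ ∩ K₂' := by
    refine subset_inter hcut.cutK.swap.segment_subset₁ ?_
    exact hcut.cutK.segment_subset₁.trans hsub'
  have hsP' : segment ℝ p' q' ⊆ K₂ ∩ K₂' := by
    refine subset_inter ?_ hcut'.cutK.swap.segment_subset₁
    exact hcut'.cutK.segment_subset₁.trans hsub
  refine ⟨![segment ℝ p q, segment ℝ p' q'], ![R₁, R₁'], K₂ ∩ K₂',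
    Or.inr ⟨hcut.isPolygon_inter hcut' h.isCore hcc hs hs' hK₂ hK₂' ⟨z, hz, by linarith⟩,
      ?_, ?_, ?_, ?_⟩, ?_⟩
  · have h1 : {x : Plane | inner ℝ x f ≤ c'} = {x | -c' ≤ inner ℝ x (-f)} := by
      ext x; simp [inner_neg_right]
    rw [hK₂, hK₂', h1]
    exact (h.convex.inter (convex_setOf_le_inner f c)).inter (h.convex.inter (convex_setOf_le_inner (-f) (-c')))
  · change P = R₁ ∪ K₂ ∩ K₂' ∪ R₁'
    rw [union_assoc, ← hR]
    exact hcut.cutP.union_eq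
  · rw [Fin.forall_fin_two]
    constructor
    · refine subset_antisymm ?_ (subset_inter hcut.cutP.segment_subset₁ hsP)
      rw [hcut.cutP.inter_eq]
      exact inter_subset_inter_right _ (inter_subset_left.trans hcut.subset₂)
    · refine subset_antisymm ?_ (subset_inter hcut'.cutP.segment_subset₁ hsP')
      change _ ⊆ segment ℝ p' q'
      rw [hcut'.cutP.inter_eq]
      exact inter_subset_inter_right _ (inter_subset_right.trans hcut'.subset₂)
  · intro i j hij
    fin_cases i <;> fin_cases j
    · exact absurd rfl hij
    · exact Or.inr ⟨p, q, rfl, hR ▸ hcut.cutP.inducesPartition⟩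
    · exact Or.inr ⟨p', q', rfl, hR' ▸ hcut'.cutP.inducesPartition⟩
    · exact absurd rfl hij
  · rw [Fin.forall_fin_two]
    exact ⟨hgood, hgood'⟩

lemma exists_partition (h : IsLongCore ϑ f e P K F w xl xr) (hϑ₀ : 0 < ϑ) (hϑ₁ : ϑ < 1)
    (hP : IsPolygon P) :
    ∃ (S Q : Fin 2 → Set Plane) (P' : Set Plane), IsTwoSegmentPartition P S Q P' ∧
      ∀ i, IsGoodPiece ϑ P (S i) (Q i) := by
  by_cases hleft : ∃ k ∈ F, inner ℝ k.p f = xl <;> by_cases hright : ∃ k ∈ F, inner ℝ k.p f = xr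
  · exact h.exists_partition_of_left_of_right hϑ₀ hϑ₁ hP hleft hright
  · exact h.exists_partition_of_left hϑ₀ hϑ₁ hP hleft hright
  · exact h.neg.exists_partition_of_left hϑ₀ hϑ₁ hP (by simpa [inner_neg_right] using hright)
      (by simpa [inner_neg_right] using hleft)
  · have hF : F = ∅ := by
      refine eq_empty_of_forall_notMem fun k hk => ?_
      exact (h.eq_or_eq hk).elim (fun h1 => hleft ⟨k, hk, h1⟩) fun h1 => hright ⟨k, hk, h1⟩
    have hPK : P = K := by simpa [hF] using h.isCore.union_eq
    refine ⟨fun _ => ∅, fun _ => ∅, P, Or.inr ⟨hP, hPK ▸ h.convex, by simp, by simp, ?_⟩,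
      fun _ => IsGoodPiece.empty ϑ P⟩
    exact fun _ _ _ => Or.inl ⟨rfl, rfl, by simp⟩

end IsLongCore

/-- If the maximal width of a semiconvex polygon is much larger than its width `w` in direction
`e`, its convex core is long. -/
lemma IsSemiconvex.exists_isLongCore (hsc : IsSemiconvex ϑ P) (hϑ₀ : 0 < ϑ) (hϑ₁ : ϑ < 1)
    (hP : IsPolygon P) (hf : IsFrame f e) {w : ℝ} (hw : 0 < w)
    (hwP : ∀ x ∈ P, ∀ y ∈ P, |inner ℝ x e - inner ℝ y e| ≤ w) {x y : Plane} (hx : x ∈ P)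
    (hy : y ∈ P) (hxy : 400 / ϑ * w ≤ dist x y) :
    ∃ K F xl xr, IsLongCore ϑ f e P K F w xl xr := by
  obtain ⟨K, F, hcore, hK⟩ := exists_convex_core hϑ₀ hf.norm_eq_one hP hsc
  have hJ := hcore.isPolygon.isJordanRegion
  have hne : K.Nonempty := hJ.nonempty.mono interior_subset
  have hcont : ContinuousOn (fun x : Plane => inner ℝ x f) K := by fun_prop
  obtain ⟨a, ha, hamin⟩ := hJ.isCompact.exists_isMinOn hne hcont
  obtain ⟨b, hb, hbmax⟩ := hJ.isCompact.exists_isMaxOn hne hcont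
  have hamin : ∀ x ∈ K, inner ℝ a f ≤ inner ℝ x f := hamin
  have hbmax : ∀ x ∈ K, inner ℝ x f ≤ inner ℝ b f := hbmax
  refine ⟨K, F, inner ℝ a f, inner ℝ b f, hf, hcore, hK, hw,
    fun x hx y hy => hwP x (hcore.subset hx) y (hcore.subset hy), hamin, hbmax,
    ⟨a, ha, rfl⟩, ⟨b, hb, rfl⟩, ?_⟩
  -- the chord of a pocket is vertical, so that the pocket has diameter at most `w / ϑ`
  have hnear : ∀ x ∈ P, ∃ x' ∈ K, ϑ * |inner ℝ x f - inner ℝ x' f| ≤ w := by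
    intro x hx
    have hxP := hx
    rw [hcore.union_eq] at hx
    rcases hx with hx | hx
    · exact ⟨x, hx, by rw [sub_self, abs_zero, mul_zero]; exact hw.le⟩
    · simp only [mem_iUnion] at hx
      obtain ⟨k, hk, hxk⟩ := hx
      have hk' := hcore.isPocket k hk
      have hp := hk'.segment_subset (left_mem_segment _ _ _)
      have hq := hk'.segment_subset (right_mem_segment _ _ _)
      refine ⟨k.p, hJ.frontier_subset (hk'.segment_subset_frontier (left_mem_segment _ _ _)), ?_⟩
      calc ϑ * |inner ℝ x f - inner ℝ k.p f| ≤ ϑ * dist x k.p :=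
            mul_le_mul_of_nonneg_left (hf.abs_inner_f_le _ _) hϑ₀.le
        _ ≤ dist k.p k.q := hk'.dist_le x hxk _ hp
        _ = |inner ℝ k.p e - inner ℝ k.q e| := hf.dist_eq (hk'.inner_eq hf)
        _ ≤ w := hwP _ (hk'.subset hp) _ (hk'.subset hq)
  obtain ⟨x', hx', hxx⟩ := hnear x hx
  obtain ⟨y', hy', hyy⟩ := hnear y hy
  have h1 := hxy.trans (hf.dist_le x y)
  have h2 := hwP x hx y hy
  have h3 : |inner ℝ x f - inner ℝ y f| ≤ |inner ℝ x f - inner ℝ x' f| +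
      |inner ℝ y f - inner ℝ y' f| + (inner ℝ b f - inner ℝ a f) := by
    have h4 : |inner ℝ x' f - inner ℝ y' f| ≤ inner ℝ b f - inner ℝ a f := by
      rw [abs_le]
      constructor <;> linarith [hamin x' hx', hamin y' hy', hbmax x' hx', hbmax y' hy']
    have h5 := abs_sub_le (inner ℝ x f) (inner ℝ x' f) (inner ℝ y f)
    have h6 := abs_sub_le (inner ℝ x' f) (inner ℝ y' f) (inner ℝ y f)
    rw [abs_sub_comm (inner ℝ y' f)] at h6
    linarith
  have h4 : 400 * w ≤ ϑ * (|inner ℝ x f - inner ℝ x' f| + |inner ℝ y f - inner ℝ y' f| +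
      (inner ℝ b f - inner ℝ a f) + w) := by
    have h5 := mul_le_mul_of_nonneg_left (h1.trans (add_le_add h3 h2)) hϑ₀.le
    rwa [← mul_assoc, mul_div_cancel₀ _ hϑ₀.ne'] at h5
  nlinarith

end Partition

theorem mainTheorem7 (ϑ : ℝ) (hϑ₀ : 0 < ϑ) (hϑ₁ : ϑ < 1) :
    ∃ C : ℝ, 0 < C ∧ ∀ P : Set Plane, IsPolygon P → IsSemiconvex ϑ P →
      ∃ (S Q : Fin 2 → Set Plane) (P' : Set Plane), IsTwoSegmentPartition P S Q P' ∧
        ∀ i : Fin 2,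
          Measure.hausdorffMeasure 1 (S i) ≤
            ENNReal.ofReal ϑ * Measure.hausdorffMeasure 1 (frontier P) ∧
          maxWidth (Q i) ≤ ENNReal.ofReal C * minWidth (Q i) ∧
          ∀ v ∈ concaveVertices (Q i),
            maxWidth (Q i) ≤ ENNReal.ofReal C * Metric.infEDist v (S i) := by
  have hC : 0 < 400 / ϑ := by positivity
  refine ⟨400 / ϑ, hC, fun P hP hsc => ?_⟩
  suffices H : ∃ (S Q : Fin 2 → Set Plane) (P' : Set Plane), IsTwoSegmentPartition P S Q P' ∧
      ∀ i, IsGoodPiece ϑ P (S i) (Q i) by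
    obtain ⟨S, Q, P', h1, h2⟩ := H
    exact ⟨S, Q, P', h1, fun i => ⟨(h2 i).length_le, (h2 i).width_le, (h2 i).infEDist_le⟩⟩
  by_cases hthick : maxWidth P ≤ ENNReal.ofReal (400 / ϑ) * minWidth P
  · refine ⟨fun _ => ∅, ![P, ∅], ∅, Or.inl ⟨rfl, rfl, rfl, fun _ => rfl⟩, ?_⟩
    rw [Fin.forall_fin_two]
    refine ⟨⟨by simp, hthick, fun v _ => ?_⟩, IsGoodPiece.empty ϑ P⟩
    rw [Metric.infEDist_empty, ENNReal.mul_top (ENNReal.ofReal_pos.2 hC).ne']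
    exact le_top
  · rw [not_le, maxWidth, lt_iSup_iff] at hthick
    obtain ⟨u, hu⟩ := hthick
    simp only [widthAlong, lt_iSup_iff] at hu
    obtain ⟨hu, x, hx, y, hy, hxy⟩ := hu
    -- a direction `e` in which the width of `P` is less than `ϑ / 400` times `|⟪x - y, u⟫|`
    rw [mul_comm, ← ENNReal.lt_div_iff_mul_lt (Or.inl (ENNReal.ofReal_pos.2 hC).ne')
      (Or.inl ENNReal.ofReal_ne_top), ← ENNReal.ofReal_div_of_pos hC, minWidth, iInf_lt_iff] at hxy
    obtain ⟨e, he⟩ := hxy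
    rw [iInf_lt_iff] at he
    obtain ⟨he, hwe⟩ := he
    set w := |inner ℝ (x - y) u| / (400 / ϑ) with hw
    have hw0 : 0 < w := ENNReal.ofReal_pos.1 (pos_of_gt hwe)
    have hwP : ∀ x ∈ P, ∀ y ∈ P, |inner ℝ x e - inner ℝ y e| ≤ w := by
      intro x hx y hy
      rw [← inner_sub_left, ← ENNReal.ofReal_le_ofReal_iff hw0.le]
      exact (le_iSup₂_of_le (f := fun x (_ : x ∈ P) => ⨆ y ∈ P, ENNReal.ofReal |inner ℝ (x - y) e|)
        x hx (le_iSup₂_of_le y hy le_rfl)).trans hwe.le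
    have hf : IsFrame !₂[e 1, -e 0] e := ⟨mem_sphere_zero_iff_norm.1 he, Or.inl rfl⟩
    have hdist : 400 / ϑ * w ≤ dist x y := by
      rw [hw, mul_div_cancel₀ _ hC.ne', dist_eq_norm]
      have := abs_real_inner_le_norm (x - y) u
      rwa [mem_sphere_zero_iff_norm.1 hu, mul_one] at this
    obtain ⟨K, F, xl, xr, hlong⟩ := hsc.exists_isLongCore hϑ₀ hϑ₁ hP hf hw0 hwP hx hy hdist
    exact hlong.exists_partition hϑ₀ hϑ₁ hP
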